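/- Let $m\ge 1$ and $0\le a\le m-1$ be integers. For a complex number $q$ put $(q)_n=\prod_{i=1}^n(1-q^i)$ and let $\begin{bmatrix} n\\ c\end{bmatrix}$ be the $q$-binomial coefficient, that is, the value at $q$ of the polynomial $\frac{(q)_n}{(q)_c(q)_{n-c}}$ for $0\le c\le n$, and $0$ otherwise. With $k_0=0$ define $$X_m^{(a)}(q)=\sum_{k_1,\dots,k_m=0}^\infty (q)_{k_m}\,q^{k_1^2+\dots+k_{m-1}^2+k_{a+1}+\dots+k_{m-1}}\Bigl(\prod_{\substack{i=1\\ i\ne a}}^{m-1}\begin{bmatrix} k_{i+1}\\ k_i\end{bmatrix}\Bigr)\begin{bmatrix} k_{a+1}+1\\ k_a\end{bmatrix},$$ a finite sum when $q$ is a root of unity. Let $\chi_{8m+4}^{(a)}$ be the function of period $8m+4$ on the integers with value $1$ at $2m-2a-1$ and $6m+2a+5$, value $-1$ at $2m+2a+3$ and $6m-2a+1$ (modulo $8m+4$), and value $0$ elsewhere; let $L(s,\chi_{8m+4}^{(a)})$ be the analytic continuation of $\sum_{n\ge1}\chi_{8m+4}^{(a)}(n)n^{-s}$, and $$T_m^{(a)}(n)=\tfrac12(-1)^{n+1}L(-2n-1,\chi_{8m+4}^{(a)})\qquad(n\ge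 0).$$ (i) For $\omega=e^{2\pi i/N}$ and $N\to\infty$ through the positive integers, $$X_m^{(a)}(\omega)\simeq\frac{2}{\sqrt{2m+1}}\,N^{3/2}\,e^{\frac{\pi i}{4}-\frac{\pi i}{N}\frac{(2m-2a-1)^2}{4(2m+1)}}\sum_{k=0}^{m-1}(-1)^k(m-k)\sin\Bigl((a+1)\frac{2k+1}{2m+1}\pi\Bigr)e^{-N\pi i\frac{(2k+1)^2}{4(2m+1)}}$$ $$\qquad+\;e^{-\frac{\pi i}{N}\frac{(2m-2a-1)^2}{4(2m+1)}}\sum_{n=0}^\infty\frac{T_m^{(a)}(n)}{n!}\Bigl(\frac{\pi}{4(2m+1)Ni}\Bigr)^n ,$$ where $\simeq$ means an asymptotic expansion: for every $K\ge0$, if the last series is cut off after the terms with $n<K$, the difference of the two sides is $O(N^{-K})$ as $N\to\infty$, with $m,a,K$ fixed. (ii) Equivalently, for rational $\alpha$ put $\widetilde\Phi_m^{(a)}(\alpha)=e^{\frac{(2m-2a-1)^2}{4(2m+1)}\pi i\alpha}X_m^{(a)}(e^{2\pi i\alpha})$, let $\widetilde{\boldsymbol\Phi}_m(\alpha)$ and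 $\mathbf T_m(n)$ be the column vectors with the entries $\widetilde\Phi_m^{(m-1)}(\alpha),\dots,\widetilde\Phi_m^{(0)}(\alpha)$ and $T_m^{(m-1)}(n),\dots,T_m^{(0)}(n)$, and let $\mathbf M^{(2m+1)}$ be the $m\times m$ matrix with the entries $\frac{2}{\sqrt{2m+1}}\cos\bigl(\frac{(2a-1)(2b-1)}{2(2m+1)}\pi\bigr)$, $1\le a,b\le m$. Then, with the principal value of the power, in the same sense as $N\to\infty$, $$\widetilde{\boldsymbol\Phi}_m\Bigl(\frac1N\Bigr)+(-iN)^{3/2}\,\mathbf M^{(2m+1)}\,\widetilde{\boldsymbol\Phi}_m(-N)\simeq\sum_{n=0}^\infty\frac{\mathbf T_m(n)}{n!}\Bigl(\frac{\pi}{4(2m+1)iN}\Bigr)^n .$$ -/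

import Mathlib

open Filter Asymptotics

/-- The finite product `(q)_n = (1 - q) (1 - q ^ 2) ⋯ (1 - q ^ n)`. -/
def qPoch (q : ℂ) (n : ℕ) : ℂ := ∏ i ∈ Finset.Icc 1 n, (1 - q ^ i)

/-- The `q`-binomial coefficient `[n, c]`: the value at `q` of the polynomial that the quotient
`(q)_n / ((q)_c (q)_{n-c})` is for `0 ≤ c ≤ n`, and `0` for `c > n`. It is given by the Pascal rule
`[n + 1, c] = q ^ c [n, c] + [n, c - 1]`, so that it also has its correct value where the quotient
reads `0 / 0`. -/
def qBinom (q : ℂ) : ℕ → ℕ → ℂ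
  | _, 0 => 1
  | 0, _ + 1 => 0
  | n + 1, c + 1 => q ^ (c + 1) * qBinom q n (c + 1) + qBinom q n c

theorem qBinom_zero_right (q : ℂ) (n : ℕ) : qBinom q n 0 = 1 := by
  cases n <;> rfl

theorem qBinom_eq_zero_of_lt (q : ℂ) : ∀ n c : ℕ, n < c → qBinom q n c = 0
  | 0, 0, h => absurd h (lt_irrefl 0)
  | _ + 1, 0, h => absurd h (Nat.not_lt_zero _)
  | 0, _ + 1, _ => rfl
  | n + 1, c + 1, h => by
      rw [qBinom, qBinom_eq_zero_of_lt q n (c + 1) (by omega),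
        qBinom_eq_zero_of_lt q n c (by omega)]
      simp

theorem qPoch_succ (q : ℂ) (n : ℕ) : qPoch q (n + 1) = qPoch q n * (1 - q ^ (n + 1)) := by
  unfold qPoch
  rw [Finset.prod_Icc_succ_top (by omega)]

/-- The defining quotient of the `q`-binomial coefficient, with the denominators cleared. -/
theorem qBinom_mul_qPoch (q : ℂ) :
    ∀ c d : ℕ, qBinom q (c + d) c * (qPoch q c * qPoch q d) = qPoch q (c + d)
  | 0, d => by simp [qBinom_zero_right, qPoch]
  | c + 1, 0 => by
      have h := qBinom_mul_qPoch q c 0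
      simp only [Nat.add_zero] at h ⊢
      rw [qBinom, qBinom_eq_zero_of_lt q c (c + 1) (by omega), qPoch_succ]
      linear_combination (1 - q ^ (c + 1)) * h
  | c + 1, d + 1 => by
      have h1 := qBinom_mul_qPoch q (c + 1) d
      have h2 := qBinom_mul_qPoch q c (d + 1)
      have e1 : c + 1 + (d + 1) = (c + d + 1) + 1 := by omega
      have e2 : c + 1 + d = c + d + 1 := by omega
      have e3 : c + (d + 1) = c + d + 1 := by omega
      rw [e2] at h1
      rw [e3] at h2
      rw [e1, qBinom, qPoch_succ q (c + d + 1)]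
      have h3 := qPoch_succ q c
      have h4 := qPoch_succ q d
      rw [h3] at h1 ⊢
      rw [h4] at h2 ⊢
      linear_combination q ^ (c + 1) * (1 - q ^ (d + 1)) * h1 + (1 - q ^ (c + 1)) * h2

/-- The summation indices `k_1, …, k_m` of a tuple, with the convention `k_0 = 0`. -/
def kIdx {m : ℕ} (k : Fin m → ℕ) (i : ℕ) : ℕ :=
  if h : 1 ≤ i ∧ i ≤ m then k ⟨i - 1, by omega⟩ else 0

/-- The summand of the `q`-series `X_m^{(a)}(q)` that belongs to `(k_1, …, k_m)`. -/
def XTerm (m a : ℕ) (q : ℂ) (k : Fin m → ℕ) : ℂ :=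
  qPoch q (kIdx k m)
    * q ^ ((∑ i ∈ Finset.Ico 1 m, kIdx k i ^ 2) + ∑ i ∈ Finset.Ico (a + 1) m, kIdx k i)
    * (∏ i ∈ (Finset.Ico 1 m).erase a, qBinom q (kIdx k (i + 1)) (kIdx k i))
    * qBinom q (kIdx k (a + 1) + 1) (kIdx k a)

/-- The `q`-series `X_m^{(a)}(q)`, for `0 ≤ a ≤ m - 1`. At a root of unity only finitely many
summands are nonzero (`XTerm_support_finite`). -/
noncomputable def XSeries (m a : ℕ) (q : ℂ) : ℂ := ∑' k : Fin m → ℕ, XTerm m a q k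

theorem XTerm_support_finite (m a : ℕ) (ha : a < m) (q : ℂ) (N : ℕ) (hN : 0 < N)
    (hq : q ^ N = 1) : (Function.support (XTerm m a q)).Finite := by
  apply (Set.finite_Iic (fun _ : Fin m => N + m)).subset
  intro k hk
  rw [Function.mem_support, XTerm] at hk
  have hb := right_ne_zero_of_mul hk
  have hk2 := left_ne_zero_of_mul hk
  have hp := right_ne_zero_of_mul hk2
  have h0 := left_ne_zero_of_mul (left_ne_zero_of_mul hk2)
  have hm : kIdx k m < N := by
    by_contra hlt
    apply h0
    exact Finset.prod_eq_zero (i := N) (Finset.mem_Icc.2 ⟨hN, by omega⟩) (by rw [hq]; simp)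
  have hstep : ∀ i, 1 ≤ i → i < m → kIdx k i ≤ kIdx k (i + 1) + 1 := by
    intro i hi him
    by_cases hia : i = a
    · subst hia
      by_contra hlt
      exact hb (qBinom_eq_zero_of_lt q _ _ (by omega))
    · have := Finset.prod_ne_zero_iff.1 hp i
        (Finset.mem_erase.2 ⟨hia, Finset.mem_Ico.2 ⟨hi, him⟩⟩)
      by_contra hlt
      exact this (qBinom_eq_zero_of_lt q _ _ (by omega))
  have hall : ∀ j, j < m → kIdx k (m - j) ≤ N + j := by
    intro j
    induction j with
    | zero => intro _; simpa using hm.le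
    | succ j ih =>
      intro hj
      have h1 := ih (by omega)
      have h2 := hstep (m - (j + 1)) (by omega) (by omega)
      have e : m - (j + 1) + 1 = m - j := by omega
      rw [e] at h2
      omega
  intro i
  have hi := i.2
  have h := hall (m - (i + 1)) (by omega)
  have e : m - (m - ((i : ℕ) + 1)) = i + 1 := by omega
  rw [e, kIdx, dif_pos ⟨by omega, by omega⟩] at h
  simp only [Nat.add_sub_cancel, Fin.eta] at h
  show k i ≤ N + m
  omega

/-- The root of unity `ω = exp (2 π i / N)`. -/
noncomputable def rootOmega (N : ℕ) : ℂ := Complex.exp (2 * Real.pi * Complex.I / N)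

/-- The periodic function `χ_{8m+4}^{(a)}`, as a function on `ℤ / (8 m + 4)`. -/
noncomputable def chiFun (m a : ℕ) (n : ZMod (8 * m + 4)) : ℂ :=
  if n = 2 * m - 2 * a - 1 then 1
  else if n = 2 * m + 2 * a + 3 then -1
  else if n = 6 * m - 2 * a + 1 then -1
  else if n = 6 * m + 2 * a + 5 then 1
  else 0

/-- The numbers `T_m^{(a)}(n) = (1 / 2) (-1) ^ (n + 1) L(-2 n - 1, χ_{8m+4}^{(a)})`, where
`L(s, χ)` is the analytic continuation of `∑ χ(n) / n ^ s`. -/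
noncomputable def TCoeff (m a n : ℕ) : ℂ :=
  1 / 2 * (-1) ^ (n + 1) * ZMod.LFunction (chiFun m a) (-2 * n - 1)

/-- The exponent `(2 m - 2 a - 1) ^ 2 / (4 (2 m + 1))`. -/
noncomputable def expo (m a : ℕ) : ℂ := (2 * m - 2 * a - 1) ^ 2 / (4 * (2 * m + 1))

/-- The function `Φ̃_m^{(a)}` on the rational numbers. -/
noncomputable def PhiTilde (m a : ℕ) (α : ℚ) : ℂ :=
  Complex.exp (expo m a * Real.pi * Complex.I * α)
    * XSeries m a (Complex.exp (2 * Real.pi * Complex.I * α))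

/-- The vector with the entries `Φ̃_m^{(m-1)}(α), …, Φ̃_m^{(1)}(α), Φ̃_m^{(0)}(α)`, in this order. -/
noncomputable def PhiTildeVec (m : ℕ) (α : ℚ) : Fin m → ℂ :=
  fun j => PhiTilde m (m - 1 - j) α

/-- The vector with the entries `T_m^{(m-1)}(n), …, T_m^{(1)}(n), T_m^{(0)}(n)`, in this order. -/
noncomputable def TVec (m n : ℕ) : Fin m → ℂ := fun j => TCoeff m (m - 1 - j) n

/-- The matrix `M^{(2m+1)}`. Rows and columns are numbered from `0` here, so the factors `2 a - 1`
and `2 b - 1` for the numbering from `1` read `2 i + 1` and `2 j + 1`. -/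
noncomputable def MMat (m : ℕ) : Matrix (Fin m) (Fin m) ℂ :=
  Matrix.of fun i j =>
    ((2 / Real.sqrt (2 * m + 1)
      * Real.cos ((2 * (i : ℕ) + 1) * (2 * (j : ℕ) + 1) / (2 * (2 * m + 1)) * Real.pi) : ℝ) : ℂ)

/-- The leading, oscillating term of order `N ^ (3 / 2)`. -/
noncomputable def leadTerm (m a N : ℕ) : ℂ :=
  2 / (Real.sqrt (2 * m + 1) : ℂ) * (((N : ℝ) ^ (3 / 2 : ℝ) : ℝ) : ℂ)
    * Complex.exp (Real.pi * Complex.I / 4 - Real.pi * Complex.I / N * expo m a)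
    * ∑ k ∈ Finset.range m, (-1) ^ k * ((m : ℂ) - k)
        * (Real.sin ((a + 1) * ((2 * k + 1) / (2 * m + 1)) * Real.pi) : ℂ)
        * Complex.exp (-(N * Real.pi * Complex.I * ((2 * k + 1) ^ 2 / (4 * (2 * m + 1)))))

/-! The proof has an algebraic half, which writes `XSeries m a ω` at a root of unity as a finite
theta-type sum, and an analytic half, which reads that sum off an integral.

Algebra. Summing over one index `k_i` is a Bailey step φ ↦ ∑ [k, j] q^{j²} X^j φ(j), with X = 1 for
the first a steps and X = q afterwards. The functions [k, r] / (X q^r)_{k+1} are eigenvectors of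
this step (`baileyStep_kernel`), and the raised top entry of the a-th binomial is exactly what
changes the base from X to X q (`sum_kernel_succ`). With two parameters b, z in place of q, 1, a
terminating q-Gauss sum collapses everything to one sum over s (`multiSum_eq`), and shifting s gives
a functional equation relating (b, z) to (b q, z q). On the diagonal b = z = x, for q = ω a
primitive N-th root of unity, it reads H(x) = 1 - (x² ω)^{a+1} - ω^{2m-a} x^{2m+1} H(x ω) modulo (1
- x^N)² (`diagPoly_functional`). Here H(1) = 0 and H'(1) = -`XSeries m a ω`. Running once through x
= 1, ω, …, ω^{N-1} returns to the start with the factor -1. For the values this makes a theta sum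
vanish, and for the derivatives it gives twice the q-series as a finite sum
(`XSeries_eq_partial_theta`).

Analysis. Let h(w) = sinh(2(a+1)w) / cosh((2m+1)w) and λ = (2m+1)N/π, and integrate w e^{iλw²} h(w)
along the line through 0 in direction e^{πi/4}. Write w e^{iλw²} = L(w) + L'(w) with the linear
factors w/2 ∓ πi/4. For this λ, L(w + πi) is (-1)^N e^{-2(2m+1)Nw} L'(w). Hence the integrand
differs from (L(w) + L(w + πi)) h(w) by L' times a finite geometric sum of exponentials. The former
integrates to residues at the 2m+1 poles of h between 0 and πi, the latter to the finite theta sum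
(`integral_hypRatio`). So the normalized q-series is the integral minus residues, exactly
(`XSeries_rootOmega_eq`). The residues are the term of order N^{3/2}, again exactly
(`gaussCoeff_mul_leadTerm`).

The integral has the Watson expansion given by the Taylor coefficients of h at 0
(`exists_norm_integral_hypRatio_sub_le`). By the Bernoulli generating function these coefficients
are the L-values (`TCoeff_eq`). The vector form follows since the q-series at q = 1 equals a + 1,
which identifies the matrix term with minus the leading term (`cpow_smul_MMat_mulVec`). -/

section GaussBinomial

/-! ### Gaussian binomials over an arbitrary commutative ring, since polynomial rings and their
quotients are needed later. -/

variable {A : Type*} [CommRing A]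

/-- The Gaussian binomial coefficient at an element `q` of a commutative ring. -/
def gaussBinom (q : A) : ℕ → ℕ → A
  | _, 0 => 1
  | 0, _ + 1 => 0
  | n + 1, c + 1 => q ^ (c + 1) * gaussBinom q n (c + 1) + gaussBinom q n c

/-- The shifted product `(x; q)_n = ∏_{i < n} (1 - x q ^ i)`. -/
def shiftPoch (x q : A) (n : ℕ) : A := ∏ i ∈ Finset.range n, (1 - x * q ^ i)

theorem gaussBinom_eq_qBinom (q : ℂ) : ∀ n c : ℕ, gaussBinom q n c = qBinom q n c
  | 0, 0 => rfl
  | _ + 1, 0 => rfl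
  | 0, _ + 1 => rfl
  | n + 1, c + 1 => by
      rw [gaussBinom, qBinom, gaussBinom_eq_qBinom q n (c + 1), gaussBinom_eq_qBinom q n c]

@[simp]
theorem gaussBinom_zero_right (q : A) (n : ℕ) : gaussBinom q n 0 = 1 := by
  cases n <;> rfl

theorem gaussBinom_succ_succ (q : A) (n c : ℕ) :
    gaussBinom q (n + 1) (c + 1) = q ^ (c + 1) * gaussBinom q n (c + 1) + gaussBinom q n c := rfl

theorem gaussBinom_eq_zero_of_lt (q : A) : ∀ n c : ℕ, n < c → gaussBinom q n c = 0
  | 0, 0, h => absurd h (lt_irrefl 0)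
  | _ + 1, 0, h => absurd h (Nat.not_lt_zero _)
  | 0, _ + 1, _ => rfl
  | n + 1, c + 1, h => by
      rw [gaussBinom, gaussBinom_eq_zero_of_lt q n (c + 1) (by omega),
        gaussBinom_eq_zero_of_lt q n c (by omega)]
      simp

/-- The second Pascal rule. -/
theorem gaussBinom_succ_succ' (q : A) : ∀ c d : ℕ,
    gaussBinom q (c + d + 1) (c + 1)
      = gaussBinom q (c + d) (c + 1) + q ^ d * gaussBinom q (c + d) c
  | 0, 0 => by simp [gaussBinom]
  | 0, d + 1 => by
      have h := gaussBinom_succ_succ' q 0 d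
      have p := gaussBinom_succ_succ q d 0
      simp only [Nat.zero_add, gaussBinom_zero_right, mul_one, pow_one] at h p ⊢
      rw [gaussBinom_succ_succ q (d + 1) 0]
      simp only [Nat.zero_add, gaussBinom_zero_right, pow_one]
      linear_combination q * h - p
  | c + 1, 0 => by
      have h := gaussBinom_succ_succ' q c 0
      simp only [Nat.add_zero] at h ⊢
      rw [gaussBinom_succ_succ, gaussBinom_eq_zero_of_lt q (c + 1) (c + 1 + 1) (by omega)]
      simp
  | c + 1, d + 1 => by
      have h1 := gaussBinom_succ_succ' q (c + 1) d
      have h2 := gaussBinom_succ_succ' q c (d + 1)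
      have e1 : c + 1 + (d + 1) = (c + d + 1) + 1 := by omega
      have e2 : c + 1 + d = c + d + 1 := by omega
      have e3 : c + (d + 1) = c + d + 1 := by omega
      rw [e2] at h1
      rw [e3] at h2
      rw [e1, gaussBinom_succ_succ q (c + d + 1 + 1) (c + 1)]
      have h3 := gaussBinom_succ_succ q (c + d + 1) (c + 1)
      have h4 := gaussBinom_succ_succ q (c + d + 1) c
      linear_combination q ^ (c + 1 + 1) * h1 + h2 - h3 - q ^ (d + 1) * h4

theorem gaussBinom_succ_succ_shift (q : A) (n c : ℕ) (h : c ≤ n) :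
    gaussBinom q (n + 1) (c + 1)
      = gaussBinom q n (c + 1) + q ^ (n - c) * gaussBinom q n c := by
  obtain ⟨d, rfl⟩ := Nat.exists_eq_add_of_le h
  rw [gaussBinom_succ_succ', Nat.add_sub_cancel_left]

theorem shiftPoch_succ (x q : A) (n : ℕ) :
    shiftPoch x q (n + 1) = shiftPoch x q n * (1 - x * q ^ n) :=
  Finset.prod_range_succ _ _

theorem shiftPoch_succ' (x q : A) (n : ℕ) :
    shiftPoch x q (n + 1) = (1 - x) * shiftPoch (x * q) q n := by
  unfold shiftPoch
  rw [Finset.prod_range_succ', mul_comm]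
  simp [pow_succ', mul_assoc]

theorem gaussBinom_mul_shiftPoch (q : A) :
    ∀ c d : ℕ, gaussBinom q (c + d) c * (shiftPoch q q c * shiftPoch q q d) = shiftPoch q q (c + d)
  | 0, d => by simp [shiftPoch]
  | c + 1, 0 => by
      have h := gaussBinom_mul_shiftPoch q c 0
      simp only [Nat.add_zero] at h ⊢
      rw [gaussBinom, gaussBinom_eq_zero_of_lt q c (c + 1) (by omega), shiftPoch_succ]
      linear_combination (1 - q * q ^ c) * h
  | c + 1, d + 1 => by
      have h1 := gaussBinom_mul_shiftPoch q (c + 1) d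
      have h2 := gaussBinom_mul_shiftPoch q c (d + 1)
      have e1 : c + 1 + (d + 1) = (c + d + 1) + 1 := by omega
      have e2 : c + 1 + d = c + d + 1 := by omega
      have e3 : c + (d + 1) = c + d + 1 := by omega
      rw [e2] at h1
      rw [e3] at h2
      rw [e1, gaussBinom, shiftPoch_succ q q (c + d + 1)]
      have h3 := shiftPoch_succ q q c
      have h4 := shiftPoch_succ q q d
      rw [h3] at h1 ⊢
      rw [h4] at h2 ⊢
      linear_combination q ^ (c + 1) * (1 - q * q ^ d) * h1 + (1 - q * q ^ c) * h2

section Map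

variable {B : Type*} [CommRing B] (f : A →+* B)

theorem map_gaussBinom (q : A) : ∀ n c : ℕ, f (gaussBinom q n c) = gaussBinom (f q) n c
  | 0, 0 => map_one f
  | _ + 1, 0 => map_one f
  | 0, _ + 1 => map_zero f
  | n + 1, c + 1 => by
      rw [gaussBinom, gaussBinom, map_add, map_mul, map_pow, map_gaussBinom q n (c + 1),
        map_gaussBinom q n c]

theorem map_shiftPoch (x q : A) (n : ℕ) : f (shiftPoch x q n) = shiftPoch (f x) (f q) n := by
  simp [shiftPoch, map_prod]

end Map

/-- The trinomial revision of Gaussian binomial coefficients. -/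
theorem gaussBinom_mul_gaussBinom (q : A) (r l d : ℕ) :
    gaussBinom q (r + (l + d)) (r + l) * gaussBinom q (r + l) r
      = gaussBinom q (r + (l + d)) r * gaussBinom q (l + d) l := by
  -- Over ℤ[X] the products (X; X)_n are nonzero and can be cancelled; at a root of unity they could
  -- not. The identity is then specialized.
  have key : gaussBinom (Polynomial.X : Polynomial ℤ) (r + (l + d)) (r + l)
        * gaussBinom Polynomial.X (r + l) r
      = gaussBinom Polynomial.X (r + (l + d)) r * gaussBinom Polynomial.X (l + d) l := by
    have hne : ∀ n, shiftPoch (Polynomial.X : Polynomial ℤ) Polynomial.X n ≠ 0 := by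
      intro n
      refine Finset.prod_ne_zero_iff.2 fun i _ h => ?_
      have := congrArg (Polynomial.eval 0) h
      simp at this
    have h1 := gaussBinom_mul_shiftPoch (Polynomial.X : Polynomial ℤ) (r + l) d
    have h2 := gaussBinom_mul_shiftPoch (Polynomial.X : Polynomial ℤ) r l
    have h3 := gaussBinom_mul_shiftPoch (Polynomial.X : Polynomial ℤ) r (l + d)
    have h4 := gaussBinom_mul_shiftPoch (Polynomial.X : Polynomial ℤ) l d
    rw [add_assoc] at h1
    refine mul_right_cancel₀ (mul_ne_zero (hne r) (mul_ne_zero (hne l) (hne d))) ?_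
    linear_combination (gaussBinom Polynomial.X (r + (l + d)) (r + l) * shiftPoch Polynomial.X Polynomial.X d) * h2
      + h1 - h3 - (gaussBinom Polynomial.X (r + (l + d)) r * shiftPoch Polynomial.X Polynomial.X r) * h4
  have := congrArg (Polynomial.eval₂RingHom (Int.castRingHom A) q) key
  simpa only [map_mul, map_gaussBinom, Polynomial.coe_eval₂RingHom, Polynomial.eval₂_X] using this

end GaussBinomial

/-! ### The Bailey chain. Here d i is an inverse of 1 - X q^i, so `segProd d r n` stands for 1 / (X
q^r; q)_n. -/

section Bailey

variable {A : Type*} [CommRing A]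

/-- The product of the consecutive values `d r, …, d (r + n - 1)`. -/
def segProd (d : ℕ → A) (r n : ℕ) : A := ∏ i ∈ Finset.range n, d (r + i)

theorem segProd_succ (d : ℕ → A) (r n : ℕ) : segProd d r (n + 1) = segProd d r n * d (r + n) :=
  Finset.prod_range_succ _ _

theorem segProd_succ' (d : ℕ → A) (r n : ℕ) :
    segProd d r (n + 1) = d r * segProd d (r + 1) n := by
  unfold segProd
  rw [Finset.prod_range_succ', mul_comm]
  simp [add_assoc, add_comm 1]

theorem segProd_add (d : ℕ → A) (r n l : ℕ) :
    segProd d r (n + l) = segProd d r n * segProd d (r + n) l := by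
  unfold segProd
  rw [Finset.prod_range_add]
  simp [add_assoc]

theorem segProd_shift (d : ℕ → A) (s r n : ℕ) :
    segProd (fun i => d (i + s)) r n = segProd d (r + s) n := by
  unfold segProd
  refine Finset.prod_congr rfl fun i _ => ?_
  show d (r + i + s) = d (r + s + i)
  rw [add_right_comm]

variable (q : A)

/-- A finite form of the Durfee square identity. -/
theorem sum_gaussBinom_mul_segProd {X : A} {d : ℕ → A} (hd : ∀ i, d i * (1 - X * q ^ i) = 1)
    (n r : ℕ) :
    ∑ l ∈ Finset.range (n + 1), gaussBinom q n l * q ^ l ^ 2 * (X * q ^ r) ^ l * segProd d r (l + 1)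
      = segProd d r (n + 1) := by
  induction n generalizing r with
  | zero => simp
  | succ n ih =>
    have hsplit : ∀ l ∈ Finset.range (n + 1),
        gaussBinom q (n + 1) (l + 1) * q ^ (l + 1) ^ 2 * (X * q ^ r) ^ (l + 1)
            * segProd d r (l + 1 + 1)
          = gaussBinom q n (l + 1) * q ^ (l + 1) ^ 2 * (X * q ^ r) ^ (l + 1)
              * segProd d r (l + 1 + 1)
            + X * q ^ r * q ^ (n + 1) * d r * (gaussBinom q n l * q ^ l ^ 2
              * (X * q ^ (r + 1)) ^ l * segProd d (r + 1) (l + 1)) := by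
      intro l hl
      have hl' : l ≤ n := by simpa [Nat.lt_succ_iff] using hl
      rw [gaussBinom_succ_succ_shift q n l hl', segProd_succ' d r (l + 1)]
      obtain ⟨t, rfl⟩ := Nat.exists_eq_add_of_le hl'
      rw [Nat.add_sub_cancel_left]
      ring
    rw [Finset.sum_range_succ', Finset.sum_congr rfl hsplit, Finset.sum_add_distrib,
      ← Finset.mul_sum, ih (r + 1)]
    have h0 := ih r
    rw [Finset.sum_range_succ'] at h0
    have htop : ∑ l ∈ Finset.range (n + 1), gaussBinom q n (l + 1) * q ^ (l + 1) ^ 2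
          * (X * q ^ r) ^ (l + 1) * segProd d r (l + 1 + 1)
        = ∑ l ∈ Finset.range n, gaussBinom q n (l + 1) * q ^ (l + 1) ^ 2
          * (X * q ^ r) ^ (l + 1) * segProd d r (l + 1 + 1) := by
      rw [Finset.sum_range_succ, gaussBinom_eq_zero_of_lt q n (n + 1) (by omega)]
      simp
    rw [htop]
    simp only [gaussBinom_zero_right] at h0 ⊢
    have e1 := segProd_succ d r (n + 1)
    have e2 := segProd_succ' d r (n + 1)
    have e3 := hd (r + (n + 1))
    linear_combination h0 - (1 - X * q ^ (r + (n + 1))) * e1 - segProd d r (n + 1) * e3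
      - X * q ^ (r + (n + 1)) * e2

/-- One step of the Bailey chain. -/
def baileyStep (X : A) (φ : ℕ → A) (k : ℕ) : A :=
  ∑ j ∈ Finset.range (k + 1), gaussBinom q k j * q ^ j ^ 2 * X ^ j * φ j

/-- The functions `k ↦ [k, r] / (X q ^ r)_{k + 1}` are eigenvectors of the Bailey step. -/
theorem baileyStep_kernel {X : A} {d : ℕ → A} (hd : ∀ i, d i * (1 - X * q ^ i) = 1) (r k : ℕ) :
    baileyStep q X (fun j => gaussBinom q j r * segProd d r (j + 1)) k
      = X ^ r * q ^ r ^ 2 * (gaussBinom q k r * segProd d r (k + 1)) := by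
  unfold baileyStep
  rcases lt_or_ge k r with h | h
  · rw [gaussBinom_eq_zero_of_lt q k r h]
    simp only [zero_mul, mul_zero]
    refine Finset.sum_eq_zero fun j hj => ?_
    have hj' : j < k + 1 := by simpa using hj
    rw [gaussBinom_eq_zero_of_lt q j r (by omega)]
    simp
  · obtain ⟨n, rfl⟩ := Nat.exists_eq_add_of_le h
    rw [add_assoc, Finset.sum_range_add]
    have hz : ∑ j ∈ Finset.range r, gaussBinom q (r + n) j * q ^ j ^ 2 * X ^ j
        * (gaussBinom q j r * segProd d r (j + 1)) = 0 := by
      refine Finset.sum_eq_zero fun j hj => ?_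
      rw [gaussBinom_eq_zero_of_lt q j r (by simpa using hj)]
      simp
    rw [hz, zero_add]
    -- With j = r + l, the product 1 / (X q^r)_{r+l+1} splits as 1 / (X q^r)_r times 1 / (X
    -- q^{2r})_{l+1}. Trinomial revision isolates [n, l], and what remains is the Durfee sum at the
    -- start 2r.
    have key := sum_gaussBinom_mul_segProd q hd n (r + r)
    rw [segProd_add d r r (n + 1), ← key, Finset.mul_sum, Finset.mul_sum, Finset.mul_sum]
    refine Finset.sum_congr rfl fun l hl => ?_
    have hl' : l ≤ n := by simpa [Nat.lt_succ_iff] using hl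
    obtain ⟨t, rfl⟩ := Nat.exists_eq_add_of_le hl'
    have h1 := gaussBinom_mul_gaussBinom q r l t
    beta_reduce
    rw [add_assoc r l 1, segProd_add d r r (l + 1)]
    linear_combination (q ^ (r + l) ^ 2 * X ^ (r + l) * segProd d r r
      * segProd d (r + r) (l + 1)) * h1

theorem baileyStep_sum_kernel {X : A} {d : ℕ → A} (hd : ∀ i, d i * (1 - X * q ^ i) = 1)
    (c : ℕ → A) :
    baileyStep q X (fun j => ∑ r ∈ Finset.range (j + 1), gaussBinom q j r * segProd d r (j + 1) * c r)
      = fun k => ∑ r ∈ Finset.range (k + 1),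
          gaussBinom q k r * segProd d r (k + 1) * (X ^ r * q ^ r ^ 2 * c r) := by
  funext k
  have hext : ∀ j ∈ Finset.range (k + 1),
      gaussBinom q k j * q ^ j ^ 2 * X ^ j
          * ∑ r ∈ Finset.range (j + 1), gaussBinom q j r * segProd d r (j + 1) * c r
        = ∑ r ∈ Finset.range (k + 1), gaussBinom q k j * q ^ j ^ 2 * X ^ j
          * (gaussBinom q j r * segProd d r (j + 1)) * c r := by
    intro j hj
    have hj' : j + 1 ≤ k + 1 := by simpa using hj
    rw [Finset.mul_sum]
    refine (Finset.sum_subset (Finset.range_subset_range.2 hj') fun r _ hr => ?_).trans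
      (Finset.sum_congr rfl fun r _ => by ring)
    rw [gaussBinom_eq_zero_of_lt q j r (by simpa [Nat.succ_le_iff] using hr)]
    simp
  unfold baileyStep
  rw [Finset.sum_congr rfl hext, Finset.sum_comm]
  refine Finset.sum_congr rfl fun r _ => ?_
  rw [← Finset.sum_mul]
  have := baileyStep_kernel q hd r k
  unfold baileyStep at this
  rw [this]
  ring

theorem baileyStep_iterate_sum_kernel {X : A} {d : ℕ → A} (hd : ∀ i, d i * (1 - X * q ^ i) = 1)
    (c : ℕ → A) (n : ℕ) :
    (baileyStep q X)^[n]
        (fun j => ∑ r ∈ Finset.range (j + 1), gaussBinom q j r * segProd d r (j + 1) * c r)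
      = fun k => ∑ r ∈ Finset.range (k + 1),
          gaussBinom q k r * segProd d r (k + 1) * ((X ^ r * q ^ r ^ 2) ^ n * c r) := by
  induction n with
  | zero => simp
  | succ n ih =>
    rw [Function.iterate_succ_apply', ih, baileyStep_sum_kernel q hd]
    simp only [pow_succ', mul_assoc]

/-- Passage from the base `X` to the base `X q`. -/
theorem kernel_succ {X : A} {d : ℕ → A} (hd : ∀ i, d i * (1 - X * q ^ i) = 1) (k r : ℕ) :
    gaussBinom q (k + 1) (r + 1) * segProd d (r + 1) (k + 1 + 1) * (1 - X * q ^ (2 * (r + 1)))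
      = q ^ (r + 1) * (gaussBinom q k (r + 1) * segProd d (r + 1 + 1) (k + 1))
        + gaussBinom q k r * segProd d (r + 1) (k + 1) := by
  have e1 := segProd_succ d (r + 1) (k + 1)
  have e2 := segProd_succ' d (r + 1) (k + 1)
  have h1 := hd (r + 1)
  have h2 := hd (r + 1 + (k + 1))
  have f1 : segProd d (r + 1 + 1) (k + 1)
      = segProd d (r + 1) (k + 1 + 1) * (1 - X * q ^ (r + 1)) := by
    linear_combination (-segProd d (r + 1 + 1) (k + 1)) * h1 - (1 - X * q ^ (r + 1)) * e2
  have f2 : segProd d (r + 1) (k + 1)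
      = segProd d (r + 1) (k + 1 + 1) * (1 - X * q ^ (r + 1 + (k + 1))) := by
    linear_combination (-segProd d (r + 1) (k + 1)) * h2 - (1 - X * q ^ (r + 1 + (k + 1))) * e1
  rw [f1, f2]
  have p1 := gaussBinom_succ_succ q k r
  rcases lt_or_ge k r with h | h
  · rw [gaussBinom_eq_zero_of_lt q k r h, gaussBinom_eq_zero_of_lt q k (r + 1) (by omega),
      gaussBinom_eq_zero_of_lt q (k + 1) (r + 1) (by omega)]
    ring
  · have p2 := gaussBinom_succ_succ_shift q k r h
    obtain ⟨t, rfl⟩ := Nat.exists_eq_add_of_le h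
    rw [Nat.add_sub_cancel_left] at p2
    -- Over the common denominator (X q^{r+1})_{k+2} the claim is the first Pascal rule minus X
    -- q^{2(r+1)} times the second.
    linear_combination segProd d (r + 1) (r + t + 1 + 1)
      * (p1 - X * q ^ (2 * (r + 1)) * p2)

theorem kernel_succ_zero {X : A} {d : ℕ → A} (hd : ∀ i, d i * (1 - X * q ^ i) = 1) (k : ℕ) :
    segProd d 0 (k + 1 + 1) * (1 - X) = segProd d 1 (k + 1) := by
  rw [segProd_succ']
  have := hd 0
  simp only [pow_zero, mul_one] at this
  linear_combination segProd d (0 + 1) (k + 1) * this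

/-- A combination of the kernels to the base `X`, rewritten in kernels to the base `X q`. -/
theorem sum_kernel_succ {X : A} {d : ℕ → A} (hd : ∀ i, d i * (1 - X * q ^ i) = 1) (c : ℕ → A)
    (k : ℕ) :
    ∑ r ∈ Finset.range (k + 1 + 1), gaussBinom q (k + 1) r * segProd d r (k + 1 + 1)
        * ((1 - X * q ^ (2 * r)) * c r)
      = ∑ s ∈ Finset.range (k + 1), gaussBinom q k s * segProd d (s + 1) (k + 1)
        * (q ^ s * c s + c (s + 1)) := by
  rw [Finset.sum_range_succ']
  have h : ∀ r ∈ Finset.range (k + 1),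
      gaussBinom q (k + 1) (r + 1) * segProd d (r + 1) (k + 1 + 1)
          * ((1 - X * q ^ (2 * (r + 1))) * c (r + 1))
        = gaussBinom q k (r + 1) * segProd d (r + 1 + 1) (k + 1) * (q ^ (r + 1) * c (r + 1))
          + gaussBinom q k r * segProd d (r + 1) (k + 1) * c (r + 1) := by
    intro r _
    linear_combination c (r + 1) * kernel_succ q hd k r
  rw [Finset.sum_congr rfl h, Finset.sum_add_distrib]
  simp only [mul_add (gaussBinom q k _ * _), Finset.sum_add_distrib]
  rw [Finset.sum_range_succ' (fun s => gaussBinom q k s * segProd d (s + 1) (k + 1) * (q ^ s * c s)),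
    Finset.sum_range_succ, gaussBinom_eq_zero_of_lt q k (k + 1) (by omega)]
  have h0 := kernel_succ_zero q hd k
  simp only [gaussBinom_zero_right, pow_zero, mul_zero, zero_mul, mul_one, one_mul, add_zero,
    zero_add]
  linear_combination c 0 * h0

/-- The unit Bailey pair. -/
theorem sum_kernel_unit {X : A} {d : ℕ → A} (hd : ∀ i, d i * (1 - X * q ^ i) = 1) (k : ℕ) :
    ∑ r ∈ Finset.range (k + 1), gaussBinom q k r * segProd d r (k + 1)
        * ((1 - X * q ^ (2 * r)) * ((-1) ^ r * q ^ r.choose 2))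
      = if k = 0 then 1 else 0 := by
  cases k with
  | zero =>
    have := hd 0
    simp only [pow_zero, mul_one] at this
    simpa [segProd] using this
  | succ k =>
    rw [sum_kernel_succ q hd, if_neg (by omega)]
    -- For c_s = (-1)^s q^{s(s-1)/2} the new coefficients q^s c_s + c_{s+1} cancel.
    refine Finset.sum_eq_zero fun s _ => ?_
    have : (s + 1).choose 2 = s + s.choose 2 := by
      rw [Nat.choose_succ_succ, Nat.choose_one_right]
    rw [this]
    ring

/-- The constant function 1 is the Bailey step of the indicator of 0, which the unit Bailey pair
expands in eigenvectors. This is why the eigenvalue enters to the power n + 1 and not n. -/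
theorem baileyStep_iterate_one {X : A} {d : ℕ → A} (hd : ∀ i, d i * (1 - X * q ^ i) = 1) (n : ℕ) :
    (baileyStep q X)^[n] (fun _ => 1) = fun k => ∑ r ∈ Finset.range (k + 1),
      gaussBinom q k r * segProd d r (k + 1)
        * ((1 - X * q ^ (2 * r)) * ((X ^ r * q ^ r ^ 2) ^ (n + 1) * ((-1) ^ r * q ^ r.choose 2))) := by
  have h : baileyStep q X (fun k => ∑ r ∈ Finset.range (k + 1),
      gaussBinom q k r * segProd d r (k + 1)
        * ((1 - X * q ^ (2 * r)) * ((-1) ^ r * q ^ r.choose 2))) = fun _ => 1 := by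
    funext k
    simp only [sum_kernel_unit q hd]
    unfold baileyStep
    rw [Finset.sum_range_succ', Finset.sum_eq_zero]
    · simp
    · intro j _
      simp
  rw [← h, ← Function.iterate_succ_apply, baileyStep_iterate_sum_kernel q hd]
  funext k
  refine Finset.sum_congr rfl fun r _ => ?_
  rw [Nat.succ_eq_add_one]
  ring

/-- The inner sums of the multisum. -/
def innerSum (m a : ℕ) (X : A) : ℕ → A :=
  (baileyStep q (X * q))^[m - 1 - a] fun k => (baileyStep q X)^[a] (fun _ => 1) (k + 1)

/-- The coefficients in the expansion of the inner sums. -/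
def innerCoeff (m a : ℕ) (X : A) (s : ℕ) : A :=
  (-1) ^ s * q ^ ((s + 1).choose 2 + m * s ^ 2 + (m - 1 - a) * s) * X ^ (m * s)
    * (1 - (X * q ^ (2 * s + 1)) ^ (a + 1))

/-- After a steps the coefficients still carry the factor 1 - X q^{2r}, so evaluation at k + 1 is a
passage to the base X q, in which the remaining m - 1 - a steps are diagonal too. Merging
neighbouring coefficients in this passage produces the factor 1 - (X q^{2s+1})^{a+1}. -/
theorem innerSum_eq {X : A} {d : ℕ → A} (hd : ∀ i, d i * (1 - X * q ^ i) = 1) {m a : ℕ}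
    (ha : a < m) (k : ℕ) :
    innerSum q m a X k = ∑ s ∈ Finset.range (k + 1),
      gaussBinom q k s * segProd d (s + 1) (k + 1) * innerCoeff q m a X s := by
  have hd' : ∀ i, (fun i => d (i + 1)) i * (1 - X * q * q ^ i) = 1 := by
    intro i
    have := hd (i + 1)
    rw [pow_succ'] at this
    simpa [mul_assoc] using this
  have h1 : (fun k => (baileyStep q X)^[a] (fun _ => 1) (k + 1))
      = fun k => ∑ s ∈ Finset.range (k + 1), gaussBinom q k s
          * segProd (fun i => d (i + 1)) s (k + 1)
          * ((-1) ^ s * q ^ ((s + 1).choose 2 + (a + 1) * s ^ 2) * X ^ ((a + 1) * s)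
            * (1 - (X * q ^ (2 * s + 1)) ^ (a + 1))) := by
    funext k
    rw [baileyStep_iterate_one q hd]
    simp only [segProd_shift]
    rw [sum_kernel_succ q hd]
    refine Finset.sum_congr rfl fun s _ => ?_
    have : (s + 1).choose 2 = s + s.choose 2 := by
      rw [Nat.choose_succ_succ, Nat.choose_one_right]
    rw [this]
    ring
  unfold innerSum
  rw [h1, baileyStep_iterate_sum_kernel q hd']
  simp only [segProd_shift]
  refine Finset.sum_congr rfl fun s _ => ?_
  obtain ⟨t, rfl⟩ := Nat.exists_eq_add_of_le (show a + 1 ≤ m from ha)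
  have e : a + 1 + t - 1 - a = t := by omega
  unfold innerCoeff
  rw [e]
  ring

end Bailey

/-! ### Collapse of the multisum to a single sum, and its functional equation. -/

section FunctionalEquation

variable {A : Type*} [CommRing A]

theorem shiftPoch_eq_zero_of_le {b q : A} {K n : ℕ} (hK : shiftPoch b q K = 0) (h : K ≤ n) :
    shiftPoch b q n = 0 := by
  obtain ⟨t, rfl⟩ := Nat.exists_eq_add_of_le h
  unfold shiftPoch at hK ⊢
  rw [Finset.prod_range_add, hK, zero_mul]

/-- A terminating form of the `q`-Gauss sum. -/
theorem sum_shiftPoch_mul_kernel {b q qi : A} (hq : qi * q = 1) {K : ℕ}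
    (hK : shiftPoch b q K = 0) (s : ℕ) : ∀ (z : A) (d e : ℕ → A),
    (∀ i, d i * (1 - b * z * q ^ i) = 1) → (∀ i, e i * (1 - z * q ^ i) = 1) →
    ∑ k ∈ Finset.range K, shiftPoch b q (k + 1) * z ^ k
        * (gaussBinom q k s * segProd d (s + 1) (k + 1))
      = shiftPoch b q (s + 1) * z ^ s * segProd e 0 (s + 1) := by
  induction s with
  | zero =>
    intro z d e hd he
    -- The terms (b)_{k+1} z^k / (b z q)_k telescope with differences (1 - z) times the summand. The
    -- upper end vanishes because (b)_{K+1} = 0.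
    have htel := Finset.sum_range_sub'
      (fun k => shiftPoch b q (k + 1) * z ^ k * segProd d 1 k) K
    have hterm : ∀ k ∈ Finset.range K,
        shiftPoch b q (k + 1) * z ^ k * segProd d 1 k
            - shiftPoch b q (k + 1 + 1) * z ^ (k + 1) * segProd d 1 (k + 1)
          = (1 - z) * (shiftPoch b q (k + 1) * z ^ k
              * (gaussBinom q k 0 * segProd d (0 + 1) (k + 1))) := by
      intro k _
      have e1 := segProd_succ d 1 k
      have h1 := hd (1 + k)
      rw [shiftPoch_succ b q (k + 1), gaussBinom_zero_right, zero_add]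
      linear_combination (-(shiftPoch b q (k + 1) * z ^ k * (1 - b * z * q ^ (1 + k)))) * e1
        - shiftPoch b q (k + 1) * z ^ k * segProd d 1 k * h1
    rw [Finset.sum_congr rfl hterm, ← Finset.mul_sum,
      shiftPoch_eq_zero_of_le hK (Nat.le_succ K)] at htel
    have h0 := he 0
    simp only [segProd, shiftPoch, Finset.prod_range_zero, Finset.prod_range_one, pow_zero,
      mul_one, zero_add, zero_mul, sub_zero] at htel h0 ⊢
    linear_combination e 0 * htel - (∑ k ∈ Finset.range K,
      (∏ i ∈ Finset.range (k + 1), (1 - b * q ^ i)) * z ^ k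
        * (gaussBinom q k 0 * ∏ i ∈ Finset.range (k + 1), d (1 + i))) * h0
  | succ s ih =>
    intro z d e hd he
    have ih' := ih (z * q) (fun i => d (i + 1)) (fun i => e (i + 1))
      (fun i => by linear_combination hd (i + 1)) (fun i => by linear_combination he (i + 1))
    simp only [segProd_shift, zero_add] at ih'
    -- Writing S_s(z) for the sum, this telescoping gives q^s (1 - z) S_{s+1}(z) = z (1 - b q^{s+1})
    -- S_s(z q): both ends vanish, the lower one since [0, s+1] = 0. Solving for S_{s+1} is the only
    -- use of the inverse qi of q.
    have htel := Finset.sum_range_sub'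
      (fun k => shiftPoch b q (k + 1) * z ^ k * (gaussBinom q k (s + 1) * segProd d (s + 1 + 1) k)) K
    have hterm : ∀ k ∈ Finset.range K,
        q ^ s * (shiftPoch b q (k + 1) * z ^ k * (gaussBinom q k (s + 1) * segProd d (s + 1 + 1) k)
            - shiftPoch b q (k + 1 + 1) * z ^ (k + 1)
              * (gaussBinom q (k + 1) (s + 1) * segProd d (s + 1 + 1) (k + 1)))
          = q ^ s * (1 - z) * (shiftPoch b q (k + 1) * z ^ k
              * (gaussBinom q k (s + 1) * segProd d (s + 1 + 1) (k + 1)))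
            - z * (1 - b * q ^ (s + 1)) * (shiftPoch b q (k + 1) * (z * q) ^ k
              * (gaussBinom q k s * segProd d (s + 1 + 1) (k + 1))) := by
      intro k _
      have e1 := segProd_succ d (s + 1 + 1) k
      have h1 := hd (s + 1 + 1 + k)
      have f1 : segProd d (s + 1 + 1) k
          = segProd d (s + 1 + 1) (k + 1) * (1 - b * z * q ^ (s + 1 + 1 + k)) := by
        linear_combination (-segProd d (s + 1 + 1) k) * h1
          - (1 - b * z * q ^ (s + 1 + 1 + k)) * e1
      rw [f1, shiftPoch_succ b q (k + 1)]
      rcases lt_or_ge k s with h | h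
      · rw [gaussBinom_eq_zero_of_lt q k s h, gaussBinom_eq_zero_of_lt q k (s + 1) (by omega),
          gaussBinom_eq_zero_of_lt q (k + 1) (s + 1) (by omega)]
        ring
      · have p1 := gaussBinom_succ_succ q k s
        have p2 := gaussBinom_succ_succ_shift q k s h
        obtain ⟨t, rfl⟩ := Nat.exists_eq_add_of_le h
        rw [Nat.add_sub_cancel_left] at p2
        linear_combination (shiftPoch b q (s + t + 1) * z ^ (s + t)
          * segProd d (s + 1 + 1) (s + t + 1) * q ^ s * z)
          * (b * q ^ (s + t + 1) * p1 - p2)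
    rw [shiftPoch_eq_zero_of_le hK (Nat.le_succ K), gaussBinom_eq_zero_of_lt q 0 (s + 1) (by omega)]
      at htel
    have hsum := congrArg (q ^ s * ·) htel
    simp only [Finset.mul_sum] at hsum
    rw [Finset.sum_congr rfl hterm, Finset.sum_sub_distrib, ← Finset.mul_sum, ← Finset.mul_sum, ih']
      at hsum
    have h0 := he 0
    have hqs : qi ^ s * q ^ s = 1 := by rw [← mul_pow, hq, one_pow]
    rw [shiftPoch_succ b q (s + 1), segProd_succ' e 0 (s + 1)]
    rw [pow_zero, mul_one] at h0
    set S := ∑ k ∈ Finset.range K, shiftPoch b q (k + 1) * z ^ k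
        * (gaussBinom q k (s + 1) * segProd d (s + 1 + 1) (k + 1)) with hS
    rw [zero_add]
    linear_combination (qi ^ s * e 0) * hsum - S * h0 - (S * e 0 * (1 - z)) * hqs
      + (shiftPoch b q (s + 1) * z ^ (s + 1) * (1 - b * q ^ (s + 1)) * e 0 * segProd e 1 (s + 1))
        * hqs

/-- The multisum in the two variables `b` and `z`, cut off at `k_m < K`. -/
def multiSum (q : A) (m a K : ℕ) (b z : A) : A :=
  ∑ k ∈ Finset.range K, shiftPoch b q (k + 1) * z ^ k * innerSum q m a (b * z) k

/-- Inserting the kernel expansion of the inner sums and exchanging the sums leaves, for each s, a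
sum over k that the terminating q-Gauss sum evaluates. -/
theorem multiSum_eq {b q qi z : A} (hq : qi * q = 1) {K : ℕ} (hK : shiftPoch b q K = 0)
    {d e : ℕ → A} (hd : ∀ i, d i * (1 - b * z * q ^ i) = 1) (he : ∀ i, e i * (1 - z * q ^ i) = 1)
    {m a : ℕ} (ha : a < m) :
    multiSum q m a K b z = ∑ s ∈ Finset.range K, innerCoeff q m a (b * z) s
      * (shiftPoch b q (s + 1) * z ^ s * segProd e 0 (s + 1)) := by
  unfold multiSum
  have h : ∀ k ∈ Finset.range K,
      shiftPoch b q (k + 1) * z ^ k * innerSum q m a (b * z) k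
        = ∑ s ∈ Finset.range K, innerCoeff q m a (b * z) s
          * (shiftPoch b q (k + 1) * z ^ k * (gaussBinom q k s * segProd d (s + 1) (k + 1))) := by
    intro k hk
    have hk' : k + 1 ≤ K := by simpa [Nat.succ_le_iff] using hk
    rw [innerSum_eq q hd ha, Finset.mul_sum]
    refine (Finset.sum_subset (Finset.range_subset_range.2 hk') fun r _ hr => ?_).trans
      (Finset.sum_congr rfl fun r _ => by ring)
    rw [gaussBinom_eq_zero_of_lt q k r (by simpa [Nat.succ_le_iff] using hr)]
    simp
  rw [Finset.sum_congr rfl h, Finset.sum_comm]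
  refine Finset.sum_congr rfl fun s _ => ?_
  rw [← Finset.mul_sum, sum_shiftPoch_mul_kernel hq hK s z d e hd he]

/-- Shifting s by one amounts to replacing X by X q², up to a monomial. As X = b z, this is the
substitution (b, z) ↦ (b q, z q), the source of the functional equation. -/
theorem innerCoeff_succ (q : A) {m a : ℕ} (ha : a < m) (X : A) (s : ℕ) :
    innerCoeff q m a X (s + 1)
      = -(q ^ (s + (2 * m - a)) * X ^ m * innerCoeff q m a (X * q ^ 2) s) := by
  obtain ⟨t, rfl⟩ := Nat.exists_eq_add_of_le (show a + 1 ≤ m from ha)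
  have e1 : a + 1 + t - 1 - a = t := by omega
  have e2 : 2 * (a + 1 + t) - a = a + 2 + 2 * t := by omega
  have e3 : (s + 1 + 1).choose 2 = s + 1 + (s + 1).choose 2 := by
    rw [Nat.choose_succ_succ, Nat.choose_one_right]
  unfold innerCoeff
  rw [e1, e2, e3]
  ring

/-- The functional equation of the multisum. -/
theorem multiSum_functional {b q qi z : A} (hq : qi * q = 1) {K : ℕ} (hK : shiftPoch b q K = 0)
    (hK' : shiftPoch (b * q) q K = 0)
    {d e : ℕ → A} (hd : ∀ i, d i * (1 - b * z * q ^ i) = 1) (he : ∀ i, e i * (1 - z * q ^ i) = 1)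
    {m a : ℕ} (ha : a < m) :
    (1 - z) * multiSum q m a K b z = (1 - b) * (1 - (b * z * q) ^ (a + 1)
      - q ^ (2 * m - a) * (b * z) ^ m * z * multiSum q m a K (b * q) (z * q)) := by
  have hd2 : ∀ i, (fun i => d (i + 2)) i * (1 - b * q * (z * q) * q ^ i) = 1 := fun i => by
    linear_combination hd (i + 2)
  have he1 : ∀ i, (fun i => e (i + 1)) i * (1 - z * q * q ^ i) = 1 := fun i => by
    linear_combination he (i + 1)
  have h0 := he 0
  rw [pow_zero, mul_one] at h0
  have hX : b * q * (z * q) = b * z * q ^ 2 := by ring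
  -- One vanishing term is appended, so that splitting off s = 0 leaves the range s < K of the
  -- shifted multisum.
  have hext : ∑ s ∈ Finset.range K, innerCoeff q m a (b * z) s
        * (shiftPoch b q (s + 1) * z ^ s * segProd e 0 (s + 1))
      = ∑ s ∈ Finset.range (K + 1), innerCoeff q m a (b * z) s
        * (shiftPoch b q (s + 1) * z ^ s * segProd e 0 (s + 1)) := by
    rw [Finset.sum_range_succ, shiftPoch_eq_zero_of_le hK (Nat.le_succ K)]
    simp
  rw [multiSum_eq hq hK hd he ha, multiSum_eq hq hK' hd2 he1 ha, hX, hext, Finset.sum_range_succ',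
    mul_add, Finset.mul_sum, Finset.mul_sum, mul_sub, Finset.mul_sum]
  have hterm : ∀ s ∈ Finset.range K, (1 - z) * (innerCoeff q m a (b * z) (s + 1)
        * (shiftPoch b q (s + 1 + 1) * z ^ (s + 1) * segProd e 0 (s + 1 + 1)))
      = -((1 - b) * (q ^ (2 * m - a) * (b * z) ^ m * z * (innerCoeff q m a (b * z * q ^ 2) s
        * (shiftPoch (b * q) q (s + 1) * (z * q) ^ s
          * segProd (fun i => e (i + 1)) 0 (s + 1))))) := by
    intro s _
    rw [innerCoeff_succ q ha, shiftPoch_succ' b q (s + 1), segProd_succ' e 0 (s + 1),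
      segProd_shift, zero_add]
    linear_combination (-(q ^ (s + (2 * m - a)) * (b * z) ^ m * innerCoeff q m a (b * z * q ^ 2) s
      * ((1 - b) * shiftPoch (b * q) q (s + 1) * z ^ (s + 1) * segProd e 1 (s + 1)))) * h0
  rw [Finset.sum_congr rfl hterm, Finset.sum_neg_distrib]
  have hfirst : (1 - z) * (innerCoeff q m a (b * z) 0
      * (shiftPoch b q (0 + 1) * z ^ 0 * segProd e 0 (0 + 1)))
      = (1 - b) * (1 - (b * z * q) ^ (a + 1)) := by
    simp only [innerCoeff, shiftPoch, segProd]
    norm_num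
    linear_combination ((1 - (b * z * q) ^ (a + 1)) * (1 - b)) * h0
  rw [hfirst, ← Finset.mul_sum]
  ring

end FunctionalEquation

/-! ### Transport of the multisum along ring homomorphisms. -/

section Maps

variable {A B : Type*} [CommRing A] [CommRing B] (f : A →+* B)

theorem map_baileyStep_iterate (q X : A) (n : ℕ) : ∀ (φ : ℕ → A) (k : ℕ),
    f ((baileyStep q X)^[n] φ k) = (baileyStep (f q) (f X))^[n] (fun k => f (φ k)) k := by
  induction n with
  | zero => intro φ k; rfl
  | succ n ih =>
    intro φ k
    rw [Function.iterate_succ_apply, Function.iterate_succ_apply, ih]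
    refine congrArg (fun ψ => (baileyStep (f q) (f X))^[n] ψ k) (funext fun j => ?_)
    simp [baileyStep, map_sum, map_gaussBinom]

theorem map_innerSum (q : A) (m a : ℕ) (X : A) (k : ℕ) :
    f (innerSum q m a X k) = innerSum (f q) m a (f X) k := by
  unfold innerSum
  rw [map_baileyStep_iterate]
  simp only [map_baileyStep_iterate, map_mul, map_one]

theorem map_multiSum (q : A) (m a K : ℕ) (b z : A) :
    f (multiSum q m a K b z) = multiSum (f q) m a K (f b) (f z) := by
  simp [multiSum, map_sum, map_shiftPoch, map_innerSum]

end Maps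

/-! ### The functional equation at z = b, where 1 - z q^i need not be invertible. -/

section Nilpotent

variable {A : Type*} [CommRing A]

/-- The functional equation of the multisum at `z = b`, without any invertibility hypotheses on
`1 - b q ^ i`. -/
theorem multiSum_functional_diag {b q qi : A} (hq : qi * q = 1) {K : ℕ} (hK : shiftPoch b q K = 0)
    (hK' : shiftPoch (b * q) q K = 0) {m a : ℕ} (ha : a < m) :
    (1 - b) * (multiSum q m a K b b - (1 - (b ^ 2 * q) ^ (a + 1))
      + q ^ (2 * m - a) * b ^ (2 * m + 1) * multiSum q m a K (b * q) (b * q)) = 0 := by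
  -- Let z be an indeterminate. Both sides are polynomials in z, and in the power series ring all 1
  -- - b z q^i and 1 - z q^i are units, so the functional equation holds there. Setting z = b
  -- afterwards involves no denominators.
  have key : (1 - Polynomial.X) * multiSum (Polynomial.C q) m a K (Polynomial.C b) Polynomial.X
      = (1 - Polynomial.C b) * (1 - (Polynomial.C b * Polynomial.X * Polynomial.C q) ^ (a + 1)
        - Polynomial.C q ^ (2 * m - a) * (Polynomial.C b * Polynomial.X) ^ m * Polynomial.X
          * multiSum (Polynomial.C q) m a K (Polynomial.C b * Polynomial.C q)
              (Polynomial.X * Polynomial.C q)) := by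
    apply Polynomial.coe_injective A
    let F : Polynomial A →+* PowerSeries A := Polynomial.coeToPowerSeries.ringHom
    have hF : ∀ p : Polynomial A, (p : PowerSeries A) = F p := fun p => rfl
    simp only [hF, map_mul, map_sub, map_one, map_multiSum, map_pow]
    have hu : ∀ x : A, ∀ i : ℕ, IsUnit (1 - F (Polynomial.C x) * F Polynomial.X
        * F (Polynomial.C q) ^ i) := by
      intro x i
      rw [← map_mul, ← map_pow, ← map_mul, ← map_one F, ← map_sub, ← hF,
        PowerSeries.isUnit_iff_constantCoeff]
      simp
    choose d hd using fun i => (hu b i).exists_left_inv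
    choose e he using fun i => (hu 1 i).exists_left_inv
    refine multiSum_functional (qi := F (Polynomial.C qi)) (e := e) ?_ ?_ ?_ hd (fun i => ?_) ha
    · rw [← map_mul, ← map_mul, hq, map_one, map_one]
    · rw [← map_shiftPoch, ← map_shiftPoch, hK, map_zero, map_zero]
    · rw [← map_mul, ← map_mul, ← map_shiftPoch, ← map_shiftPoch, hK', map_zero, map_zero]
    · have := he i
      rwa [map_one, map_one, one_mul] at this
  have := congrArg (Polynomial.evalRingHom b) key
  simp only [map_mul, map_sub, map_one, map_multiSum, map_pow, Polynomial.coe_evalRingHom,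
    Polynomial.eval_X, Polynomial.eval_C] at this
  linear_combination this

end Nilpotent

/-! ### The q-series as an iterated Bailey step. -/

section Multisum

/-- The summand of a chain sum: `F (k_n) ∏ g (i + 1) (k_{i+1}) (k_i)`. -/
def chainTerm (g : ℕ → ℕ → ℕ → ℂ) (n : ℕ) (F : ℕ → ℂ) (k : Fin (n + 1) → ℕ) : ℂ :=
  F (k (Fin.last n)) * ∏ i : Fin n, g (i + 1) (k i.succ) (k i.castSucc)

/-- The inner part of a chain sum, as a function of the last summation index. -/
noncomputable def chainInner (g : ℕ → ℕ → ℕ → ℂ) : ℕ → ℕ → ℂ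
  | 0, _ => 1
  | n + 1, k => ∑' j, g (n + 1) k j * chainInner g n j

theorem chainTerm_snoc (g : ℕ → ℕ → ℕ → ℂ) (n : ℕ) (F : ℕ → ℂ) (l : ℕ) (k : Fin (n + 1) → ℕ) :
    chainTerm g (n + 1) F (Fin.snoc (α := fun _ => ℕ) k l)
      = F l * chainTerm g n (g (n + 1) l) k := by
  unfold chainTerm
  rw [Fin.prod_univ_castSucc]
  simp only [Fin.snoc_last, Fin.succ_castSucc, Fin.snoc_castSucc, Fin.succ_last, Fin.val_castSucc,
    Fin.val_last]
  ring

/-- Splitting off the last entry of a tuple. -/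
def snocPairEquiv (n : ℕ) : ℕ × (Fin n → ℕ) ≃ (Fin (n + 1) → ℕ) where
  toFun p := Fin.snoc (α := fun _ => ℕ) p.2 p.1
  invFun k := (k (Fin.last n), Fin.init (α := fun _ => ℕ) k)
  left_inv p := by simp
  right_inv k := Fin.snoc_init_self k

/-- Fixing the last index l leaves a shorter chain with the end weight `g (n + 1) l`, again of
finite support. The induction therefore runs over all end weights, and finiteness is carried along
to justify the iterated summation. -/
theorem tsum_chainTerm (g : ℕ → ℕ → ℕ → ℂ) (hg : ∀ i k, (Function.support (g i k)).Finite)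
    (n : ℕ) : ∀ F : ℕ → ℂ, (Function.support F).Finite →
    (Function.support (chainTerm g n F)).Finite ∧
      ∑' k, chainTerm g n F k = ∑' l, F l * chainInner g n l := by
  induction n with
  | zero =>
    intro F hF
    have h : ∀ k : Fin 1 → ℕ, chainTerm g 0 F k = F (Equiv.funUnique (Fin 1) ℕ k) := by
      intro k
      simp [chainTerm]
    constructor
    · have : chainTerm g 0 F = F ∘ Equiv.funUnique (Fin 1) ℕ := funext h
      rw [this, Function.support_comp_eq_preimage]
      exact hF.preimage (Equiv.injective _).injOn
    · rw [tsum_congr h, (Equiv.funUnique (Fin 1) ℕ).tsum_eq F]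
      simp [chainInner]
  | succ n ih =>
    intro F hF
    have hfin : (Function.support (chainTerm g (n + 1) F)).Finite := by
      refine (hF.biUnion fun l _ => ((ih (g (n + 1) l) (hg _ _)).1.image
        fun k => Fin.snoc (α := fun _ => ℕ) k l)).subset ?_
      intro k hk
      rw [Function.mem_support, ← Fin.snoc_init_self k, chainTerm_snoc] at hk
      simp only [Set.mem_iUnion, Set.mem_image, Function.mem_support]
      exact ⟨_, left_ne_zero_of_mul hk, _, right_ne_zero_of_mul hk, Fin.snoc_init_self k⟩
    refine ⟨hfin, ?_⟩
    have hs0 : Summable (chainTerm g (n + 1) F) := summable_of_hasFiniteSupport hfin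
    have hs : Summable (chainTerm g (n + 1) F ∘ snocPairEquiv (n + 1)) :=
      (Equiv.summable_iff (snocPairEquiv (n + 1))).2 hs0
    simp only [Function.comp_def] at hs
    rw [← (snocPairEquiv (n + 1)).tsum_eq, hs.tsum_prod]
    refine tsum_congr fun l => ?_
    have h : ∀ k : Fin (n + 1) → ℕ, chainTerm g (n + 1) F (snocPairEquiv (n + 1) (l, k))
        = F l * chainTerm g n (g (n + 1) l) k := fun k => chainTerm_snoc g n F l k
    rw [tsum_congr h, tsum_mul_left, (ih (g (n + 1) l) (hg _ _)).2]
    rfl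

/-- The factors that link consecutive indices in `XTerm`. -/
noncomputable def linkFactor (a : ℕ) (q : ℂ) (i k j : ℕ) : ℂ :=
  gaussBinom q (if i = a then k + 1 else k) j * q ^ j ^ 2 * (if a < i then q else 1) ^ j

theorem XTerm_eq_chainTerm (n a : ℕ) (q : ℂ) (k : Fin (n + 1) → ℕ) (ha : a < n + 1) :
    XTerm (n + 1) a q k = chainTerm (linkFactor a q) n (qPoch q) k := by
  have hidx : ∀ i (hi : i < n + 1), kIdx k (i + 1) = k ⟨i, hi⟩ := by
    intro i hi
    unfold kIdx
    rw [dif_pos ⟨by omega, by omega⟩]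
    rfl
  have hprod : ∏ i : Fin n, linkFactor a q (i + 1) (k i.succ) (k i.castSucc)
      = ∏ i ∈ Finset.Ico 1 (n + 1), linkFactor a q i (kIdx k (i + 1)) (kIdx k i) := by
    rw [Finset.prod_Ico_eq_prod_range, Nat.add_sub_cancel, Finset.prod_range]
    refine Finset.prod_congr rfl fun i _ => ?_
    rw [add_comm 1 (i : ℕ), hidx i (by omega), hidx (i + 1) (by omega)]
    rfl
  have hlast : k (Fin.last n) = kIdx k (n + 1) := (hidx n (by omega)).symm
  unfold chainTerm
  rw [hprod, hlast]
  simp only [linkFactor, Finset.prod_mul_distrib]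
  have h1 : ∏ i ∈ Finset.Ico 1 (n + 1), (if a < i then q else 1) ^ kIdx k i
      = q ^ ∑ i ∈ Finset.Ico (a + 1) (n + 1), kIdx k i := by
    rw [← Finset.prod_pow_eq_pow_sum]
    symm
    rw [Finset.prod_congr rfl fun i hi => by
      rw [show q ^ kIdx k i = (if a < i then q else 1) ^ kIdx k i by
        rw [if_pos (show a < i from (Finset.mem_Ico.1 hi).1)]]]
    refine Finset.prod_subset (Finset.Ico_subset_Ico (by omega) le_rfl) fun i hi hi' => ?_
    rw [Finset.mem_Ico] at hi hi'
    rw [if_neg (by omega), one_pow]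
  have h2 : ∏ i ∈ Finset.Ico 1 (n + 1),
        gaussBinom q (if i = a then kIdx k (i + 1) + 1 else kIdx k (i + 1)) (kIdx k i)
      = (∏ i ∈ (Finset.Ico 1 (n + 1)).erase a, qBinom q (kIdx k (i + 1)) (kIdx k i))
        * qBinom q (kIdx k (a + 1) + 1) (kIdx k a) := by
    simp only [gaussBinom_eq_qBinom]
    have h3 : ∀ i ∈ (Finset.Ico 1 (n + 1)).erase a,
        qBinom q (if i = a then kIdx k (i + 1) + 1 else kIdx k (i + 1)) (kIdx k i)
          = qBinom q (kIdx k (i + 1)) (kIdx k i) := by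
      intro i hi
      rw [if_neg (Finset.ne_of_mem_erase hi)]
    -- For a = 0 the extra binomial is [k_1 + 1, k_0] = 1 since k_0 = 0. For a ≥ 1 it takes the
    -- place of the erased factor.
    rcases Nat.eq_zero_or_pos a with h | h
    · subst h
      rw [← Finset.prod_congr rfl h3, Finset.erase_eq_of_notMem (by simp)]
      simp [kIdx, qBinom_zero_right]
    · rw [← Finset.prod_congr rfl h3,
        ← Finset.prod_erase_mul _ _ (Finset.mem_Ico.2 ⟨h, ha⟩), if_pos rfl]
  rw [h1, h2, Finset.prod_pow_eq_pow_sum]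
  unfold XTerm
  ring

theorem support_linkFactor_finite (a : ℕ) (q : ℂ) (i k : ℕ) :
    (Function.support (linkFactor a q i k)).Finite := by
  refine (Set.finite_Iic (k + 1)).subset fun j hj => ?_
  by_contra h
  refine hj ?_
  rw [Set.mem_Iic] at h
  unfold linkFactor
  rw [gaussBinom_eq_zero_of_lt q _ j (by split_ifs <;> omega)]
  simp

/-- The weight q^{k_i} is present exactly for i > a, so the base of the step is 1 up to i = a and q
beyond; the raised binomial at i = a moves the argument to k + 1. -/
theorem tsum_linkFactor (a : ℕ) (q : ℂ) (i k : ℕ) (φ : ℕ → ℂ) :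
    ∑' j, linkFactor a q i k j * φ j
      = baileyStep q (if a < i then q else 1) φ (if i = a then k + 1 else k) := by
  unfold baileyStep
  rw [tsum_eq_sum]
  · rfl
  · intro j hj
    unfold linkFactor
    rw [gaussBinom_eq_zero_of_lt q _ j (by simpa [Nat.succ_le_iff] using hj)]
    simp

theorem chainInner_linkFactor_of_lt (a : ℕ) (q : ℂ) : ∀ n k : ℕ, n < a →
    chainInner (linkFactor a q) n k = (baileyStep q 1)^[n] (fun _ => 1) k
  | 0, k, _ => rfl
  | n + 1, k, h => by
      rw [chainInner, tsum_linkFactor, if_neg (by omega), if_neg (by omega),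
        Function.iterate_succ_apply']
      exact congrArg (fun ψ => baileyStep q 1 ψ k)
        (funext fun j => chainInner_linkFactor_of_lt a q n j (by omega))

theorem chainInner_linkFactor_self (a : ℕ) (q : ℂ) (k : ℕ) :
    chainInner (linkFactor a q) a k = (baileyStep q 1)^[a] (fun _ => 1) (k + 1) := by
  cases a with
  | zero => rfl
  | succ a =>
    rw [chainInner, tsum_linkFactor, if_neg (by omega), if_pos rfl, Function.iterate_succ_apply']
    exact congrArg (fun ψ => baileyStep q 1 ψ (k + 1))
      (funext fun j => chainInner_linkFactor_of_lt (a + 1) q a j (by omega))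

theorem chainInner_linkFactor_add (a : ℕ) (q : ℂ) : ∀ t k : ℕ,
    chainInner (linkFactor a q) (a + t) k
      = (baileyStep q q)^[t] (fun k => (baileyStep q 1)^[a] (fun _ => 1) (k + 1)) k
  | 0, k => chainInner_linkFactor_self a q k
  | t + 1, k => by
      rw [← add_assoc, chainInner, tsum_linkFactor, if_pos (by omega), if_neg (by omega),
        Function.iterate_succ_apply']
      exact congrArg (fun ψ => baileyStep q q ψ k)
        (funext fun j => chainInner_linkFactor_add a q t j)

theorem shiftPoch_self (q : ℂ) (n : ℕ) : shiftPoch q q n = qPoch q n := by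
  induction n with
  | zero => rfl
  | succ n ih => rw [shiftPoch_succ, qPoch_succ, ih, pow_succ']

theorem qPoch_eq_zero_of_le {q : ℂ} {N n : ℕ} (hN : 0 < N) (hq : q ^ N = 1) (h : N ≤ n) :
    qPoch q n = 0 :=
  Finset.prod_eq_zero (i := N) (Finset.mem_Icc.2 ⟨hN, h⟩) (by rw [hq]; simp)

/-- Since (q)_k = 0 for k ≥ N, any cutoff from N on is admissible; the cutoff 3N is the one needed
later. -/
theorem XSeries_eq_sum {m a : ℕ} (ha : a < m) {q : ℂ} {N K : ℕ} (hN : 0 < N) (hq : q ^ N = 1)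
    (hK : N ≤ K) :
    XSeries m a q = ∑ k ∈ Finset.range K, shiftPoch q q k * innerSum q m a 1 k := by
  obtain ⟨t, rfl⟩ := Nat.exists_eq_add_of_le (show a + 1 ≤ m from ha)
  have e : a + 1 + t = a + t + 1 := by omega
  rw [e]
  unfold XSeries
  have hF : (Function.support (qPoch q)).Finite := by
    refine (Set.finite_Iic N).subset fun k hk => ?_
    by_contra h
    rw [Set.mem_Iic] at h
    exact hk (qPoch_eq_zero_of_le hN hq (by omega))
  rw [tsum_congr fun k => XTerm_eq_chainTerm (a + t) a q k (by omega),
    (tsum_chainTerm _ (support_linkFactor_finite a q) _ _ hF).2, tsum_eq_sum (s := Finset.range K)]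
  · refine Finset.sum_congr rfl fun k _ => ?_
    rw [shiftPoch_self, chainInner_linkFactor_add]
    unfold innerSum
    have e2 : a + t + 1 - 1 - a = t := by omega
    rw [e2, one_mul]
  · intro k hk
    rw [qPoch_eq_zero_of_le hN hq (hK.trans (by simpa using hk)), zero_mul]

end Multisum

/-! ### The functional equation at a primitive root of unity, and the resulting finite theta sums.
-/

section RootOfUnity

open Polynomial

theorem shiftPoch_add {A : Type*} [CommRing A] (x q : A) (n l : ℕ) :
    shiftPoch x q (n + l) = shiftPoch x q n * shiftPoch (x * q ^ n) q l := by
  unfold shiftPoch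
  rw [Finset.prod_range_add]
  simp [pow_add, mul_assoc]

theorem shiftPoch_of_isPrimitiveRoot {A : Type*} [CommRing A] [IsDomain A] {ζ : A} {N : ℕ}
    (hN : 0 < N) (hζ : IsPrimitiveRoot ζ N) (x : A) : shiftPoch x ζ N = 1 - x ^ N := by
  have h := hζ.pow_sub_pow_eq_prod_sub_mul 1 x hN
  rw [one_pow] at h
  rw [h]
  unfold shiftPoch
  refine Finset.prod_bij (fun i _ => ζ ^ i) (fun i _ => ?_) (fun i hi j hj hij => ?_)
    (fun y hy => ?_) (fun i _ => by rw [mul_comm])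
  · rw [mem_nthRootsFinset hN, ← pow_mul, mul_comm, pow_mul, hζ.pow_eq_one, one_pow]
  · exact hζ.pow_inj (Finset.mem_range.1 hi) (Finset.mem_range.1 hj) hij
  · rw [mem_nthRootsFinset hN] at hy
    have : NeZero N := ⟨hN.ne'⟩
    obtain ⟨i, hi, rfl⟩ := hζ.eq_pow_of_pow_eq_one hy
    exact ⟨i, Finset.mem_range.2 hi, rfl⟩

/-- The multisum on the diagonal as a polynomial in `b`, for `q` an `N`-th root of unity. -/
noncomputable def diagPoly (ω : ℂ) (m a N : ℕ) : ℂ[X] := multiSum (C ω) m a (N + (N + N)) X X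

/-- The cutoff 3N makes (X; ω)_{3N} = (1 - X^N)^3, and likewise at X ω, so the sums terminate in the
quotient by this polynomial. The diagonal functional equation carries a factor 1 - X, whose
cancellation costs at most one factor 1 - X^N. The remaining square permits evaluation of both the
equation and its derivative at every power of ω. -/
theorem diagPoly_functional {ω : ℂ} {N : ℕ} (hN : 0 < N) (hω : IsPrimitiveRoot ω N) {m a : ℕ}
    (ha : a < m) :
    (1 - X ^ N) ^ 2 ∣ diagPoly ω m a N - (1 - (X ^ 2 * C ω) ^ (a + 1))
      + C ω ^ (2 * m - a) * X ^ (2 * m + 1) * (diagPoly ω m a N).comp (X * C ω) := by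
  have hC : IsPrimitiveRoot (C ω) N := hω.map_of_injective (C_injective (R := ℂ))
  have hcube : ∀ x : ℂ[X], shiftPoch x (C ω) (N + (N + N)) = (1 - x ^ N) ^ 3 := by
    intro x
    rw [shiftPoch_add, shiftPoch_add, hC.pow_eq_one, mul_one, mul_one,
      shiftPoch_of_isPrimitiveRoot hN hC]
    ring
  let I : Ideal ℂ[X] := Ideal.span {(1 - X ^ N) ^ 3}
  let f := Ideal.Quotient.mk I
  have hzero : ∀ x : ℂ[X], x ^ N = X ^ N → shiftPoch (f x) (f (C ω)) (N + (N + N)) = 0 := by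
    intro x hx
    rw [← map_shiftPoch, hcube, hx]
    exact Ideal.Quotient.eq_zero_iff_mem.2 (Ideal.mem_span_singleton_self _)
  have hcomp : (diagPoly ω m a N).comp (X * C ω)
      = multiSum (C ω) m a (N + (N + N)) (X * C ω) (X * C ω) := by
    unfold diagPoly
    have := map_multiSum (compRingHom (X * C ω)) (C ω) m a (N + (N + N)) X X
    simpa only [coe_compRingHom_apply, X_comp, C_comp] using this
  have key := multiSum_functional_diag (b := f X) (q := f (C ω)) (qi := f (C ω⁻¹))
    (K := N + (N + N)) (m := m) (a := a) ?_ (hzero X rfl) ?_ ha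
  · rw [hcomp]
    have hmem : (1 - X : ℂ[X]) * (diagPoly ω m a N - (1 - (X ^ 2 * C ω) ^ (a + 1))
        + C ω ^ (2 * m - a) * X ^ (2 * m + 1)
          * multiSum (C ω) m a (N + (N + N)) (X * C ω) (X * C ω)) ∈ I := by
      rw [← Ideal.Quotient.eq_zero_iff_mem]
      unfold diagPoly
      simp only [map_mul, map_add, map_sub, map_one, map_pow, map_multiSum]
      exact key
    have hdvd := Ideal.mem_span_singleton.1 hmem
    have h1 : (1 - X : ℂ[X]) ∣ 1 - X ^ N := one_sub_dvd_one_sub_pow X N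
    obtain ⟨S, hS⟩ := h1
    have hne : (1 - X : ℂ[X]) ≠ 0 := by
      intro h
      have := congrArg (eval 0) h
      simp at this
    refine (mul_dvd_mul_iff_left hne).1 (dvd_trans ⟨S, ?_⟩ hdvd)
    rw [pow_succ _ 2]
    nth_rewrite 2 [hS]
    ring
  · rw [← map_mul, ← C_mul, inv_mul_cancel₀ (hω.ne_zero hN.ne'), C_1, map_one]
  · rw [← map_mul]
    refine hzero _ ?_
    rw [mul_pow, hC.pow_eq_one, mul_one]

/-- From (X)_{k+1} = (1 - X) (X ω)_k. The polynomial thus vanishes at 1, and its derivative there is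
minus the value of the cofactor, which is the q-series. -/
theorem diagPoly_eq (ω : ℂ) (m a N : ℕ) :
    diagPoly ω m a N = (1 - X) * ∑ k ∈ Finset.range (N + (N + N)),
      shiftPoch (X * C ω) (C ω) k * X ^ k * innerSum (C ω) m a (X * X) k := by
  unfold diagPoly multiSum
  rw [Finset.mul_sum]
  refine Finset.sum_congr rfl fun k _ => ?_
  rw [shiftPoch_succ']
  ring

theorem diagPoly_eval_one (ω : ℂ) (m a N : ℕ) : (diagPoly ω m a N).eval 1 = 0 := by
  rw [diagPoly_eq]
  simp

theorem diagPoly_derivative_eval_one {ω : ℂ} {N : ℕ} (hN : 0 < N) (hω : ω ^ N = 1) {m a : ℕ}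
    (ha : a < m) : (derivative (diagPoly ω m a N)).eval 1 = -XSeries m a ω := by
  have h : ∀ k, eval 1 (shiftPoch (X * C ω) (C ω) k * X ^ k * innerSum (C ω) m a (X * X) k)
      = shiftPoch ω ω k * innerSum ω m a 1 k := by
    intro k
    rw [← coe_evalRingHom, map_mul, map_mul, map_shiftPoch, map_innerSum]
    simp
  rw [diagPoly_eq, derivative_mul, eval_add, eval_mul, eval_mul, eval_finsetSum,
    Finset.sum_congr rfl fun k _ => h k, ← XSeries_eq_sum ha hN hω (Nat.le_add_right _ _)]
  simp

/-- For even N the exponent is an odd multiple of N / 2, and ω^{N/2} = -1 by primitivity; for odd N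
it is a multiple of N. -/
theorem pow_choose_two_of_isPrimitiveRoot {ω : ℂ} {N : ℕ} (hN : 0 < N) (hω : IsPrimitiveRoot ω N) :
    ω ^ N.choose 2 = (-1) ^ (N + 1) := by
  rcases Nat.even_or_odd' N with ⟨t, rfl | rfl⟩
  · have h1 : (2 * t).choose 2 = t * (2 * (t - 1) + 1) := by
      rw [Nat.choose_two_right, mul_assoc, Nat.mul_div_cancel_left _ two_pos]
      congr 1
      omega
    have h2 : ω ^ t = -1 := by
      have h3 : ω ^ t * ω ^ t = 1 := by rw [← pow_add, ← two_mul, hω.pow_eq_one]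
      rcases mul_self_eq_one_iff.1 h3 with h | h
      · exact absurd h (hω.pow_ne_one_of_pos_of_lt (by omega) (by omega))
      · exact h
    rw [h1, pow_mul, h2]
    simp [pow_succ, pow_mul]
  · have h1 : (2 * t + 1).choose 2 = (2 * t + 1) * t := by
      rw [Nat.choose_two_right, Nat.add_sub_cancel, mul_comm 2 t, ← mul_assoc,
        Nat.mul_div_cancel _ two_pos]
    rw [h1, pow_mul, hω.pow_eq_one, one_pow, add_assoc, ← two_mul, ← mul_add, pow_mul]
    simp

/-- The values of the `q`-series at roots of unity as partial theta sums, together with the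
vanishing of the corresponding theta sum. -/
theorem XSeries_eq_partial_theta {ω : ℂ} {N : ℕ} (hN : 0 < N) (hω : IsPrimitiveRoot ω N) {m a : ℕ}
    (ha : a < m) :
    2 * XSeries m a ω = -∑ j ∈ Finset.range N,
        (-1) ^ j * ω ^ (j * (2 * m - a) + (2 * m + 1) * j.choose 2)
          * ((2 * m + 1) * j * (1 - ω ^ ((a + 1) * (2 * j + 1)))
            - (2 * a + 2) * ω ^ ((a + 1) * (2 * j + 1)))
      ∧ ∑ j ∈ Finset.range N, (-1) ^ j * ω ^ (j * (2 * m - a) + (2 * m + 1) * j.choose 2)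
          * (1 - ω ^ ((a + 1) * (2 * j + 1))) = 0 := by
  obtain ⟨Z, hZ⟩ := diagPoly_functional hN hω ha
  set H := diagPoly ω m a N with hH
  -- u and v are the values of H and of x H'(x) along the orbit x = ω^j. The functional equation and
  -- its derivative become first-order recursions in j, since (1 - x^N)² has double zeros there.
  let u : ℕ → ℂ := fun j => H.eval (ω ^ j)
  let v : ℕ → ℂ := fun j => ω ^ j * (derivative H).eval (ω ^ j)
  have hpow : ∀ j, (ω ^ j) ^ N = 1 := fun j => by
    rw [← pow_mul, mul_comm, pow_mul, hω.pow_eq_one, one_pow]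
  have hu : ∀ j, u j = 1 - ω ^ ((a + 1) * (2 * j + 1))
      - ω ^ (2 * m - a) * (ω ^ j) ^ (2 * m + 1) * u (j + 1) := by
    intro j
    have h := congrArg (eval (ω ^ j)) hZ
    simp only [eval_add, eval_sub, eval_mul, eval_pow, eval_comp, eval_X, eval_C, eval_one,
      hpow, sub_self] at h
    simp only [u]
    rw [pow_succ ω j]
    have e : ω ^ ((a + 1) * (2 * j + 1)) = ((ω ^ j) ^ 2 * ω) ^ (a + 1) := by ring
    rw [e]
    linear_combination h
  have hv : ∀ j, v j = -((2 * a + 2) * ω ^ ((a + 1) * (2 * j + 1)))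
      - ω ^ (2 * m - a) * (ω ^ j) ^ (2 * m + 1) * ((2 * m + 1) * u (j + 1) + v (j + 1)) := by
    intro j
    have h := congrArg (fun p => eval (ω ^ j) (derivative p)) hZ
    simp only [derivative_add, derivative_sub, derivative_mul, derivative_pow, derivative_comp,
      derivative_X, derivative_C, derivative_one, eval_add, eval_sub, eval_mul, eval_pow, eval_comp,
      eval_X, eval_C, eval_one, eval_zero, hpow, sub_self, map_natCast, eval_natCast] at h
    simp only [u, v]
    rw [pow_succ ω j]
    have e : ω ^ ((a + 1) * (2 * j + 1)) = ((ω ^ j) ^ 2 * ω) ^ (a + 1) := by ring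
    rw [e]
    simp only [Nat.add_sub_cancel] at h
    push_cast at h
    norm_num at h
    linear_combination ω ^ j * h
  have hcoef : ∀ j, (-1 : ℂ) ^ (j + 1)
        * ω ^ ((j + 1) * (2 * m - a) + (2 * m + 1) * (j + 1).choose 2)
      = -((-1) ^ j * ω ^ (j * (2 * m - a) + (2 * m + 1) * j.choose 2)
        * (ω ^ (2 * m - a) * (ω ^ j) ^ (2 * m + 1))) := by
    intro j
    have : (j + 1).choose 2 = j + j.choose 2 := by
      rw [Nat.choose_succ_succ, Nat.choose_one_right]
    rw [this]
    ring
  have hsumu : ∀ n, u 0 = ∑ j ∈ Finset.range n,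
      (-1) ^ j * ω ^ (j * (2 * m - a) + (2 * m + 1) * j.choose 2)
        * (1 - ω ^ ((a + 1) * (2 * j + 1)))
      + (-1) ^ n * ω ^ (n * (2 * m - a) + (2 * m + 1) * n.choose 2) * u n := by
    intro n
    induction n with
    | zero => simp
    | succ n ih =>
      rw [Finset.sum_range_succ, ih, hcoef, hu n]
      ring
  have hsumv : ∀ n, v 0 = ∑ j ∈ Finset.range n,
      (-1) ^ j * ω ^ (j * (2 * m - a) + (2 * m + 1) * j.choose 2)
        * ((2 * m + 1) * j * (1 - ω ^ ((a + 1) * (2 * j + 1)))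
            - (2 * a + 2) * ω ^ ((a + 1) * (2 * j + 1)))
      + (-1) ^ n * ω ^ (n * (2 * m - a) + (2 * m + 1) * n.choose 2)
        * (v n + (2 * m + 1) * n * u n) := by
    intro n
    induction n with
    | zero => simp
    | succ n ih =>
      rw [Finset.sum_range_succ, ih, hcoef, hu n, hv n]
      push_cast
      ring
  -- The factor collected in one turn of the orbit. Since it is -1 while u and v return to their
  -- initial values, the relation for v yields 2 v(0), and with u(0) = 0 the one for u makes the
  -- theta sum vanish.
  have hend : (-1 : ℂ) ^ N * ω ^ (N * (2 * m - a) + (2 * m + 1) * N.choose 2) = -1 := by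
    rw [pow_add, pow_mul, hω.pow_eq_one, one_pow, mul_comm (2 * m + 1), pow_mul,
      pow_choose_two_of_isPrimitiveRoot hN hω, one_mul, ← pow_mul, ← pow_add]
    refine Odd.neg_one_pow ?_
    rw [Nat.odd_add]
    constructor
    · intro h
      exact (h.add_odd odd_one).mul_right _
    · intro h
      by_contra h'
      rw [Nat.not_odd_iff_even] at h'
      exact (Nat.not_even_iff_odd.2 ((h'.add_odd odd_one).mul ⟨m, rfl⟩)) h
  have hu0 : u 0 = 0 := by
    simp only [u, pow_zero, hH]
    exact diagPoly_eval_one ω m a N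
  have huN : u N = 0 := by
    rw [← hu0]
    simp only [u, hω.pow_eq_one, pow_zero]
  have hv0 : v 0 = -XSeries m a ω := by
    simp only [v, pow_zero, one_mul, hH]
    exact diagPoly_derivative_eval_one hN hω.pow_eq_one ha
  have hvN : v N = -XSeries m a ω := by
    rw [← hv0]
    simp only [v, hω.pow_eq_one, pow_zero]
  have h1 := hsumu N
  have h2 := hsumv N
  rw [hend, hu0, huN] at h1
  rw [hend, hv0, hvN, huN] at h2
  constructor
  · linear_combination -h2
  · linear_combination -h1

end RootOfUnity

/-! ### Cauchy's integral formula on rectangles. -/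

section Residue

open Complex MeasureTheory Set
open scoped Interval Topology

/-- The boundary integral of a function over the rectangle with the corners `z` and `w`. -/
noncomputable def rectIntegral (f : ℂ → ℂ) (z w : ℂ) : ℂ :=
  (∫ x : ℝ in z.re..w.re, f (x + z.im * I)) - (∫ x : ℝ in z.re..w.re, f (x + w.im * I))
    + I * (∫ y : ℝ in z.im..w.im, f (w.re + y * I)) - I * ∫ y : ℝ in z.im..w.im, f (z.re + y * I)

theorem log_neg_of_im_pos {z : ℂ} (h : 0 < z.im) : log (-z) = log z - Real.pi * I := by
  unfold log
  rw [norm_neg, arg_neg_eq_arg_sub_pi_of_im_pos h]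
  push_cast
  ring

theorem log_neg_of_im_neg {z : ℂ} (h : z.im < 0) : log (-z) = log z + Real.pi * I := by
  unfold log
  rw [norm_neg, arg_neg_eq_arg_add_pi_of_im_neg h]
  push_cast
  ring

theorem integral_inv_horizontal (a b y : ℝ) (c : ℂ) (h : y ≠ c.im) :
    ∫ x : ℝ in a..b, ((x : ℂ) + y * I - c)⁻¹ = log (b + y * I - c) - log (a + y * I - c) := by
  have hne : ∀ x : ℝ, (x : ℂ) + y * I - c ∈ slitPlane := fun x => by
    rw [mem_slitPlane_iff]
    right
    simpa [sub_eq_zero] using h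
  refine intervalIntegral.integral_eq_sub_of_hasDerivAt
    (f := fun x : ℝ => log ((x : ℂ) + y * I - c)) (fun x _ => ?_) ?_
  · have h1 : HasDerivAt (fun x : ℝ => (x : ℂ) + y * I - c) 1 x :=
      ((hasDerivAt_id x).ofReal_comp.add_const _).sub_const _
    simpa using h1.clog_real (hne x)
  · refine ContinuousOn.intervalIntegrable (Continuous.continuousOn ?_)
    exact Continuous.inv₀ (by fun_prop) fun x => slitPlane_ne_zero (hne x)

theorem integral_inv_vertical_right (a b x : ℝ) (c : ℂ) (h : c.re < x) :
    I * ∫ y : ℝ in a..b, ((x : ℂ) + y * I - c)⁻¹ = log (x + b * I - c) - log (x + a * I - c) := by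
  have hne : ∀ y : ℝ, (x : ℂ) + y * I - c ∈ slitPlane := fun y => by
    rw [mem_slitPlane_iff]
    left
    simpa using h
  rw [← intervalIntegral.integral_const_mul]
  refine intervalIntegral.integral_eq_sub_of_hasDerivAt
    (f := fun y : ℝ => log ((x : ℂ) + y * I - c)) (fun y _ => ?_) ?_
  · have h1 : HasDerivAt (fun y : ℝ => (x : ℂ) + y * I - c) (1 * I) y :=
      (((hasDerivAt_id y).ofReal_comp.mul_const I).const_add _).sub_const _
    simpa [div_eq_mul_inv] using h1.clog_real (hne y)
  · refine ContinuousOn.intervalIntegrable (Continuous.continuousOn ?_)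
    exact continuous_const.mul
      (Continuous.inv₀ (by fun_prop) fun x => slitPlane_ne_zero (hne x))

theorem integral_inv_vertical_left (a b x : ℝ) (c : ℂ) (h : x < c.re) :
    I * ∫ y : ℝ in a..b, ((x : ℂ) + y * I - c)⁻¹
      = log (-(x + b * I - c)) - log (-(x + a * I - c)) := by
  have hne : ∀ y : ℝ, -((x : ℂ) + y * I - c) ∈ slitPlane := fun y => by
    rw [mem_slitPlane_iff]
    left
    simpa using h
  rw [← intervalIntegral.integral_const_mul]
  refine intervalIntegral.integral_eq_sub_of_hasDerivAt
    (f := fun y : ℝ => log (-((x : ℂ) + y * I - c))) (fun y _ => ?_) ?_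
  · have h1 : HasDerivAt (fun y : ℝ => -((x : ℂ) + y * I - c)) (-(1 * I)) y :=
      ((((hasDerivAt_id y).ofReal_comp.mul_const I).const_add _).sub_const _).neg
    have h2 := h1.clog_real (hne y)
    rwa [neg_div_neg_eq, one_mul, div_eq_mul_inv] at h2
  · refine ContinuousOn.intervalIntegrable (Continuous.continuousOn ?_)
    refine continuous_const.mul
      (Continuous.inv₀ (by fun_prop) fun x => ?_)
    exact neg_ne_zero.1 (slitPlane_ne_zero (hne x))

/-- A primitive is log (v - c) on three sides. The left side crosses its cut, so log (-(v - c)) is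
used there; the two differ by ±πi at the left corners, which add up to 2πi. -/
theorem rectIntegral_inv {z w c : ℂ} (h1 : z.re < c.re) (h2 : c.re < w.re) (h3 : z.im < c.im)
    (h4 : c.im < w.im) : rectIntegral (fun v => (v - c)⁻¹) z w = 2 * Real.pi * I := by
  unfold rectIntegral
  rw [integral_inv_horizontal _ _ _ _ h3.ne, integral_inv_horizontal _ _ _ _ h4.ne',
    integral_inv_vertical_right _ _ _ _ h2, integral_inv_vertical_left _ _ _ _ h1,
    log_neg_of_im_pos (by simpa using h4), log_neg_of_im_neg (by simpa using h3)]
  ring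

/-- Cauchy's integral formula for a rectangle. -/
theorem rectIntegral_div {G : ℂ → ℂ} {z w c : ℂ} (h1 : z.re < c.re) (h2 : c.re < w.re)
    (h3 : z.im < c.im) (h4 : c.im < w.im)
    (hG : DifferentiableOn ℂ G ([[z.re, w.re]] ×ℂ [[z.im, w.im]])) :
    rectIntegral (fun v => G v / (v - c)) z w = 2 * Real.pi * I * G c := by
  have hre : z.re ≤ w.re := (h1.trans h2).le
  have him : z.im ≤ w.im := (h3.trans h4).le
  have hnhds : [[z.re, w.re]] ×ℂ [[z.im, w.im]] ∈ 𝓝 c := by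
    rw [uIcc_of_le hre, uIcc_of_le him]
    refine mem_of_superset (IsOpen.mem_nhds (isOpen_Ioo.reProdIm isOpen_Ioo)
      (show c ∈ Ioo z.re w.re ×ℂ Ioo z.im w.im from ⟨⟨h1, h2⟩, ⟨h3, h4⟩⟩)) ?_
    intro x hx
    exact ⟨Ioo_subset_Icc_self hx.1, Ioo_subset_Icc_self hx.2⟩
  -- The difference quotient of G at c has no singularity, so its boundary integral is 0. What is
  -- left of G(v) / (v - c) is G(c) / (v - c).
  have hd := (differentiableOn_dslope hnhds).2 hG
  have h0 := integral_boundary_rect_eq_zero_of_differentiableOn (dslope G c) z w hd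
  simp only [smul_eq_mul] at h0
  have hsplit : ∀ v, v ≠ c → G v / (v - c) = dslope G c v + G c * (v - c)⁻¹ := by
    intro v hv
    rw [dslope_of_ne _ hv, slope_def_field]
    field_simp
    ring
  have hmaps : ∀ x ∈ [[z.re, w.re]], ∀ y ∈ [[z.im, w.im]],
      (x : ℂ) + y * I ∈ [[z.re, w.re]] ×ℂ [[z.im, w.im]] := by
    intro x hx y hy
    rw [mem_reProdIm]
    simpa using ⟨hx, hy⟩
  have hint : ∀ (γ : ℝ → ℂ) (a b : ℝ), Continuous γ → (∀ t, γ t ≠ c) →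
      (∀ t ∈ [[a, b]], γ t ∈ [[z.re, w.re]] ×ℂ [[z.im, w.im]]) →
      ∫ t in a..b, G (γ t) / (γ t - c)
        = (∫ t in a..b, dslope G c (γ t)) + G c * ∫ t in a..b, (γ t - c)⁻¹ := by
    intro γ a b hγ hne hm
    rw [← intervalIntegral.integral_const_mul, ← intervalIntegral.integral_add]
    · exact intervalIntegral.integral_congr fun t _ => hsplit _ (hne t)
    · exact (hd.continuousOn.comp hγ.continuousOn hm).intervalIntegrable
    · refine (Continuous.intervalIntegrable ?_ _ _)
      exact continuous_const.mul ((hγ.sub continuous_const).inv₀ fun t => sub_ne_zero.2 (hne t))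
  have hinv := rectIntegral_inv h1 h2 h3 h4
  unfold rectIntegral at hinv ⊢
  have hz : ∀ t : ℝ, (t : ℂ) + z.im * I ≠ c := fun t h => by
    rw [← h] at h3
    simp at h3
  have hw : ∀ t : ℝ, (t : ℂ) + w.im * I ≠ c := fun t h => by
    rw [← h] at h4
    simp at h4
  have hz' : ∀ t : ℝ, (z.re : ℂ) + t * I ≠ c := fun t h => by
    rw [← h] at h1
    simp at h1
  have hw' : ∀ t : ℝ, (w.re : ℂ) + t * I ≠ c := fun t h => by
    rw [← h] at h2
    simp at h2
  rw [hint (fun x : ℝ => (x : ℂ) + z.im * I) _ _ (by fun_prop) hz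
      (fun t ht => hmaps t ht _ left_mem_uIcc),
    hint (fun x : ℝ => (x : ℂ) + w.im * I) _ _ (by fun_prop) hw
      (fun t ht => hmaps t ht _ right_mem_uIcc),
    hint (fun y : ℝ => (w.re : ℂ) + y * I) _ _ (by fun_prop) hw'
      (fun t ht => hmaps _ right_mem_uIcc t ht),
    hint (fun y : ℝ => (z.re : ℂ) + y * I) _ _ (by fun_prop) hz'
      (fun t ht => hmaps _ left_mem_uIcc t ht)]
  linear_combination h0 + G c * hinv

end Residue

/-! ### Gaussian integrals with a linear factor. -/

section GaussianIntegrals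

open Complex MeasureTheory Set
open scoped Topology

/-- The primitive eighth root of unity `exp (π i / 4)`. -/
noncomputable def eighthRoot : ℂ := ((√2 / 2 : ℝ) : ℂ) * (1 + I)

theorem half_sqrt_two_sq : ((√2 / 2 : ℝ) : ℂ) ^ 2 = 1 / 2 := by
  rw [← ofReal_pow, div_pow, Real.sq_sqrt (by norm_num)]
  norm_num

theorem eighthRoot_sq : eighthRoot ^ 2 = I := by
  unfold eighthRoot
  rw [mul_pow, half_sqrt_two_sq]
  linear_combination (1 / 2 : ℂ) * I_sq

theorem eighthRoot_ne_zero : eighthRoot ≠ 0 := by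
  intro h
  have := eighthRoot_sq
  rw [h, zero_pow two_ne_zero] at this
  exact I_ne_zero this.symm

theorem eighthRoot_eq_exp : eighthRoot = exp (Real.pi * I / 4) := by
  have h : (Real.pi : ℂ) * I / 4 = ((Real.pi / 4 : ℝ) : ℂ) * I := by
    push_cast
    ring
  rw [h, exp_mul_I, ← ofReal_cos, ← ofReal_sin, Real.cos_pi_div_four, Real.sin_pi_div_four]
  unfold eighthRoot
  ring

theorem norm_eighthRoot : ‖eighthRoot‖ = 1 := by
  have h : ‖eighthRoot‖ ^ 2 = 1 := by
    rw [← norm_pow, eighthRoot_sq, norm_I]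
  nlinarith [norm_nonneg eighthRoot]

theorem eighthRoot_mul_re (z : ℂ) : (eighthRoot * z).re = √2 / 2 * (z.re - z.im) := by
  simp [eighthRoot]
  ring

theorem integrable_id_mul_cexp_quadratic {lam : ℝ} (hl : 0 < lam) (c d : ℂ) :
    Integrable fun u : ℝ => (u : ℂ) * cexp (-lam * u ^ 2 + c * u + d) := by
  have hre : 0 < (lam : ℂ).re := by simpa using hl
  -- By |u| ≤ e^{|u|} the integrand is dominated by the sum of two Gaussians with linear terms ±(‖c‖
  -- + 1) u.
  have h1 := (integrable_cexp_quadratic hre ((‖c‖ + 1 : ℝ) : ℂ) d).norm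
  have h2 := (integrable_cexp_quadratic hre (-(‖c‖ + 1 : ℝ) : ℂ) d).norm
  refine (h1.add h2).mono' (Continuous.aestronglyMeasurable (by fun_prop)) (ae_of_all _ fun u => ?_)
  simp only [Pi.add_apply, norm_mul, norm_exp, norm_real, Real.norm_eq_abs]
  have e : ∀ z : ℂ, (-(lam : ℂ) * (u : ℂ) ^ 2 + z * u + d).re = -lam * u ^ 2 + z.re * u + d.re := by
    intro z
    simp [← ofReal_pow]
  rw [e, e, e]
  simp only [neg_re, ofReal_re]
  have hc : c.re * u ≤ ‖c‖ * |u| := by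
    calc c.re * u ≤ |c.re * u| := le_abs_self _
      _ = |c.re| * |u| := abs_mul _ _
      _ ≤ ‖c‖ * |u| := by gcongr; exact abs_re_le_norm c
  have hu : |u| ≤ Real.exp |u| := (by linarith [Real.add_one_le_exp |u|])
  calc |u| * Real.exp (-lam * u ^ 2 + c.re * u + d.re)
      ≤ Real.exp |u| * Real.exp (-lam * u ^ 2 + ‖c‖ * |u| + d.re) := by gcongr
    _ = Real.exp (-lam * u ^ 2 + (‖c‖ + 1) * |u| + d.re) := by
        rw [← Real.exp_add]
        ring_nf
    _ ≤ _ := by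
        rcases abs_cases u with ⟨h, _⟩ | ⟨h, _⟩
        · rw [h]
          exact le_add_of_nonneg_right (Real.exp_nonneg _)
        · rw [h]
          refine le_add_of_nonneg_of_le (Real.exp_nonneg _) (le_of_eq ?_)
          ring_nf

theorem integrable_linear_mul_cexp_quadratic {lam : ℝ} (hl : 0 < lam) (α β c d : ℂ) :
    Integrable fun u : ℝ => (α * u + β) * cexp (-lam * u ^ 2 + c * u + d) := by
  have h1 := (integrable_id_mul_cexp_quadratic hl c d).const_mul α
  have h2 := (integrable_cexp_quadratic (show 0 < (lam : ℂ).re by simpa using hl) c d).const_mul β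
  refine (h1.add h2).congr (ae_of_all _ fun u => ?_)
  simp only [Pi.add_apply]
  ring

theorem integral_cexp_gaussian {lam : ℝ} (hl : 0 < lam) (c : ℂ) :
    ∫ u : ℝ, cexp (-lam * u ^ 2 + c * u) = (√(Real.pi / lam) : ℝ) * cexp (c ^ 2 / (4 * lam)) := by
  have h := integral_cexp_quadratic (b := -lam) (by simpa using hl) c 0
  simp only [add_zero, neg_neg] at h
  have hs : ((Real.pi : ℂ) / (lam : ℂ)) ^ (1 / 2 : ℂ) = (√(Real.pi / lam) : ℝ) := by
    rw [Real.sqrt_eq_rpow, ofReal_cpow (by positivity)]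
    push_cast
    rfl
  rw [h, hs]
  congr 2
  ring

/-- The integral of a linear function against a Gaussian. -/
theorem integral_linear_mul_cexp_gaussian {lam : ℝ} (hl : 0 < lam) (α β c : ℂ) :
    ∫ u : ℝ, (α * u + β) * cexp (-lam * u ^ 2 + c * u)
      = (α * (c / (2 * lam)) + β) * ((√(Real.pi / lam) : ℝ) * cexp (c ^ 2 / (4 * lam))) := by
  have hl' : (lam : ℂ) ≠ 0 := by exact_mod_cast hl.ne'
  have hint : Integrable fun u : ℝ => cexp (-lam * u ^ 2 + c * u) := by
    simpa using integrable_cexp_quadratic (show 0 < (lam : ℂ).re by simpa using hl) c 0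
  have hint1 : Integrable fun u : ℝ => (u : ℂ) * cexp (-lam * u ^ 2 + c * u) := by
    simpa using integrable_id_mul_cexp_quadratic hl c 0
  -- The integrand is the derivative of the Gaussian, so the first moment is c / (2λ) times the
  -- zeroth.
  have h0 : ∫ u : ℝ, (-(2 * lam) * ((u : ℂ) * cexp (-lam * u ^ 2 + c * u))
      + c * cexp (-lam * u ^ 2 + c * u)) = 0 := by
    refine integral_eq_zero_of_hasDerivAt_of_integrable
      (f := fun u : ℝ => cexp (-lam * u ^ 2 + c * u)) (fun u => ?_)
      ((hint1.const_mul _).add (hint.const_mul _)) hint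
    have h1 : HasDerivAt (fun u : ℝ => (u : ℂ)) 1 u := (hasDerivAt_id u).ofReal_comp
    have h2 : HasDerivAt (fun u : ℝ => cexp (-lam * (u : ℂ) ^ 2 + c * u)) _ u :=
      (((h1.pow 2).const_mul (-lam : ℂ)).add (h1.const_mul c)).cexp
    refine h2.congr_deriv ?_
    simp only [Pi.add_apply, Pi.pow_apply]
    push_cast
    ring
  rw [integral_add (hint1.const_mul _) (hint.const_mul _), integral_const_mul,
    integral_const_mul] at h0
  have hsplit : ∀ u : ℝ, (α * u + β) * cexp (-lam * u ^ 2 + c * u)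
      = α * ((u : ℂ) * cexp (-lam * u ^ 2 + c * u)) + β * cexp (-lam * u ^ 2 + c * u) := by
    intro u
    ring
  simp only [hsplit]
  rw [integral_add (hint1.const_mul _) (hint.const_mul _), integral_const_mul, integral_const_mul]
  rw [integral_cexp_gaussian hl] at h0 ⊢
  set G := ((√(Real.pi / lam) : ℝ) : ℂ) * cexp (c ^ 2 / (4 * lam))
  set J := ∫ u : ℝ, (u : ℂ) * cexp (-lam * u ^ 2 + c * u)
  have h1 : J = c / (2 * lam) * G := by
    field_simp
    linear_combination -h0
  rw [h1]
  ring

end GaussianIntegrals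

/-! ### Bounds for sinh and cosh by the real part. -/

section HyperbolicBounds

open Complex Set
open scoped Topology

theorem abs_sinh_re_le_norm_sinh (z : ℂ) : |Real.sinh z.re| ≤ ‖sinh z‖ := by
  rw [sinh, Real.sinh_eq, norm_div, abs_div]
  have := abs_norm_sub_norm_le (exp z) (exp (-z))
  rw [norm_exp, norm_exp, neg_re] at this
  simpa using div_le_div_of_nonneg_right this (by norm_num : (0 : ℝ) ≤ 2)

theorem abs_sinh_re_le_norm_cosh (z : ℂ) : |Real.sinh z.re| ≤ ‖cosh z‖ := by
  rw [cosh, Real.sinh_eq, norm_div, abs_div]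
  have := abs_norm_sub_norm_le (exp z) (-exp (-z))
  rw [norm_neg, norm_exp, norm_exp, neg_re, sub_neg_eq_add] at this
  simpa using div_le_div_of_nonneg_right this (by norm_num : (0 : ℝ) ≤ 2)

theorem norm_sinh_le_cosh_re (z : ℂ) : ‖sinh z‖ ≤ Real.cosh z.re := by
  rw [sinh, Real.cosh_eq, norm_div]
  have := norm_sub_le (exp z) (exp (-z))
  rw [norm_exp, norm_exp, neg_re] at this
  simpa using div_le_div_of_nonneg_right this (by norm_num : (0 : ℝ) ≤ 2)

theorem le_abs_sinh {x : ℝ} : |x| ≤ |Real.sinh x| := by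
  rw [Real.abs_sinh]
  exact Real.self_le_sinh_iff.2 (abs_nonneg x)

theorem exists_int_of_sinh_eq_zero {z : ℂ} (h : sinh z = 0) : ∃ k : ℤ, z = k * Real.pi * I := by
  have h1 : sin (z * I) = 0 := by rw [sin_mul_I, h, zero_mul]
  obtain ⟨k, hk⟩ := sin_eq_zero_iff.1 h1
  refine ⟨-k, ?_⟩
  push_cast
  linear_combination (-I) * hk + z * I_sq

/-- A nowhere vanishing continuous function on the line that is bounded below near infinity is
bounded below. -/
theorem exists_pos_le_norm {g : ℝ → ℂ} (hg : Continuous g) (h0 : ∀ u, g u ≠ 0) {R : ℝ}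
    (hR : ∀ u, R ≤ |u| → 1 ≤ ‖g u‖) : ∃ δ : ℝ, 0 < δ ∧ ∀ u, δ ≤ ‖g u‖ := by
  obtain ⟨x, -, hx⟩ := (isCompact_Icc (a := -|R|) (b := |R|)).exists_isMinOn
    ⟨0, by simp⟩ hg.norm.continuousOn
  refine ⟨min 1 ‖g x‖, lt_min one_pos (norm_pos_iff.2 (h0 x)), fun u => ?_⟩
  by_cases hu : |u| ≤ |R|
  · exact (min_le_right _ _).trans (hx (abs_le.1 hu))
  · exact (min_le_left _ _).trans (hR u ((le_abs_self R).trans (not_le.1 hu).le))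

end HyperbolicBounds

/-! ### The shift of a Gaussian integral by πi, on the line through 0 in direction e^{πi/4}. -/

section StripResidue

open Complex MeasureTheory Set
open scoped Topology Interval

/-- The zeros are v = (r + kπ) e^{πi/4}, with imaginary parts (√2/2)(r + kπ). As 0 < r < π, only k =
0 falls into the strip. -/
theorem eighthRoot_mul_sub_eq_zero {v : ℂ} {r : ℝ} (hr0 : 0 < r) (hr : r < Real.pi)
    (h1 : 0 ≤ v.im) (h2 : v.im ≤ √2 / 2 * Real.pi) (h : sinh (eighthRoot * v - r * I) = 0) :
    v = r * eighthRoot := by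
  obtain ⟨k, hk⟩ := exists_int_of_sinh_eq_zero h
  have hv : v = ((r + k * Real.pi : ℝ) : ℂ) * eighthRoot := by
    refine mul_left_cancel₀ eighthRoot_ne_zero ?_
    push_cast
    linear_combination hk - (r + k * Real.pi) * eighthRoot_sq
  have him : v.im = √2 / 2 * (r + k * Real.pi) := by
    rw [hv, im_ofReal_mul]
    simp [eighthRoot]
    ring
  have hs : 0 < √2 / 2 := by positivity
  rw [him] at h1 h2
  have h1' : 0 ≤ r + k * Real.pi := nonneg_of_mul_nonneg_right h1 hs
  have h2' : r + k * Real.pi ≤ Real.pi := le_of_mul_le_mul_left h2 hs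
  have hpi := Real.pi_pos
  have k0 : k = 0 := by
    have ha : (-1 : ℝ) < k := by
      by_contra hcon
      push Not at hcon
      nlinarith
    have hb : (k : ℝ) < 1 := by
      by_contra hcon
      push Not at hcon
      nlinarith
    have ha' : -1 < k := by exact_mod_cast ha
    have hb' : k < 1 := by exact_mod_cast hb
    omega
  rw [hv, k0]
  simp

/-- The entire function `(α w + β) exp (i λ w ^ 2)`. -/
noncomputable def linGauss (lam : ℝ) (α β w : ℂ) : ℂ := (α * w + β) * cexp (I * lam * w ^ 2)

/-- On the rotated line the oscillation e^{iλw²} becomes the decay e^{-λv²}; this is the reason for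
the rotation. -/
theorem linGauss_eighthRoot_mul (lam : ℝ) (α β v : ℂ) :
    linGauss lam α β (eighthRoot * v) = (α * eighthRoot * v + β) * cexp (-lam * v ^ 2) := by
  unfold linGauss
  congr 1
  · ring
  · congr 1
    rw [mul_pow, eighthRoot_sq]
    linear_combination (lam * v ^ 2 : ℂ) * I_sq

theorem differentiable_linGauss (lam : ℝ) (α β : ℂ) : Differentiable ℂ (linGauss lam α β) := by
  unfold linGauss
  fun_prop

/-- The shift along the rotated line that corresponds to the translation by `π i`. -/
theorem eighthRoot_mul_add_pi (u : ℂ) :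
    eighthRoot * (u + ((√2 / 2 * Real.pi : ℝ) : ℂ) + ((√2 / 2 * Real.pi : ℝ) : ℂ) * I)
      = eighthRoot * u + Real.pi * I := by
  have h : ((√2 / 2 * Real.pi : ℝ) : ℂ) + ((√2 / 2 * Real.pi : ℝ) : ℂ) * I
      = eighthRoot * Real.pi := by
    unfold eighthRoot
    push_cast
    ring
  rw [add_assoc, h]
  linear_combination (Real.pi : ℂ) * eighthRoot_sq

theorem sinh_line_ne_zero {r : ℝ} (hr0 : 0 < r) (hr : r < Real.pi) (u : ℝ) :
    sinh (eighthRoot * u - r * I) ≠ 0 := by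
  intro h
  have := eighthRoot_mul_sub_eq_zero (v := u) hr0 hr (by simp)
    (by rw [ofReal_im]; positivity) h
  have him := congrArg Complex.im this
  rw [ofReal_im, im_ofReal_mul] at him
  have h2 : eighthRoot.im = √2 / 2 := by simp [eighthRoot]
  rw [h2] at him
  have : 0 < r * (√2 / 2) := by positivity
  linarith

/-- The argument has real part (√2/2)(Re v - Im v), and |sinh z| ≥ |sinh (Re z)| ≥ |Re z|. -/
theorem one_le_norm_sinh {v : ℂ} {r R : ℝ} (hR : 2 ≤ R) (hv : R ≤ |v.re - v.im|) :
    1 ≤ ‖sinh (eighthRoot * v - r * I)‖ := by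
  refine le_trans ?_ (abs_sinh_re_le_norm_sinh _)
  refine le_trans ?_ le_abs_sinh
  have h : (eighthRoot * v - r * I).re = √2 / 2 * (v.re - v.im) := by
    rw [sub_re, eighthRoot_mul_re]
    simp
  rw [h, abs_mul, abs_of_pos (by positivity : (0 : ℝ) < √2 / 2)]
  have h2 : (1 : ℝ) ≤ √2 := by
    rw [Real.one_le_sqrt]
    norm_num
  nlinarith

theorem exists_pos_le_norm_sinh_line {r : ℝ} (hr0 : 0 < r) (hr : r < Real.pi) :
    ∃ δ : ℝ, 0 < δ ∧ ∀ u : ℝ, δ ≤ ‖sinh (eighthRoot * u - r * I)‖ :=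
  exists_pos_le_norm (R := 2) (by fun_prop) (sinh_line_ne_zero hr0 hr)
    fun u hu => one_le_norm_sinh le_rfl (by simpa using hu)

theorem integrable_div_sinh {f : ℝ → ℂ} (hf : Integrable f) {r : ℝ} (hr0 : 0 < r)
    (hr : r < Real.pi) : Integrable fun u : ℝ => f u / sinh (eighthRoot * u - r * I) := by
  obtain ⟨δ, hδ, h⟩ := exists_pos_le_norm_sinh_line hr0 hr
  have hcont : Continuous fun u : ℝ => (sinh (eighthRoot * u - r * I))⁻¹ :=
    Continuous.inv₀ (by fun_prop) (sinh_line_ne_zero hr0 hr)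
  have := hf.bdd_mul (c := δ⁻¹) hcont.aestronglyMeasurable (ae_of_all _ fun u => by
    rw [norm_inv]
    exact inv_anti₀ hδ (h u))
  refine this.congr (ae_of_all _ fun u => ?_)
  beta_reduce
  rw [div_eq_mul_inv, mul_comm]

theorem integrable_linGauss_line {lam : ℝ} (hl : 0 < lam) (α β : ℂ) :
    Integrable fun u : ℝ => linGauss lam α β (eighthRoot * u) := by
  have := integrable_linear_mul_cexp_quadratic hl (α * eighthRoot) β 0 0
  simpa only [linGauss_eighthRoot_mul, zero_mul, add_zero] using this

theorem linGauss_add_pi (lam : ℝ) (α β w : ℂ) :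
    linGauss lam α β (w + Real.pi * I)
      = cexp (-(I * lam * Real.pi ^ 2)) * (cexp (-(2 * Real.pi * lam * w))
        * linGauss lam α (β + α * (Real.pi * I)) w) := by
  unfold linGauss
  have h : cexp (I * lam * (w + Real.pi * I) ^ 2) = cexp (-(I * lam * Real.pi ^ 2))
      * cexp (-(2 * Real.pi * lam * w)) * cexp (I * lam * w ^ 2) := by
    rw [← exp_add, ← exp_add]
    congr 1
    linear_combination (2 * lam * w * Real.pi + I * lam * Real.pi ^ 2) * I_sq
  rw [h]
  ring

theorem integrable_exp_mul_linGauss_line {lam : ℝ} (hl : 0 < lam) (α β c : ℂ) :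
    Integrable fun u : ℝ => cexp (c * (eighthRoot * u)) * linGauss lam α β (eighthRoot * u) := by
  have := integrable_linear_mul_cexp_quadratic hl (α * eighthRoot) β (c * eighthRoot) 0
  refine this.congr (ae_of_all _ fun u => ?_)
  simp only [linGauss_eighthRoot_mul]
  rw [add_zero, exp_add, mul_assoc c]
  ring

theorem integrable_linGauss_line_add_pi {lam : ℝ} (hl : 0 < lam) (α β : ℂ) :
    Integrable fun u : ℝ => linGauss lam α β (eighthRoot * u + Real.pi * I) := by
  simp only [linGauss_add_pi]
  have := integrable_exp_mul_linGauss_line hl α (β + α * (Real.pi * I)) (-(2 * Real.pi * lam))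
  simpa only [neg_mul] using this.const_mul _

theorem tendsto_linear_mul_gaussian {lam : ℝ} (hl : 0 < lam) (A B : ℝ) :
    Tendsto (fun R : ℝ => (A * R + B) * Real.exp (-lam * R ^ 2)) atTop (𝓝 0) := by
  have hexp : Tendsto (fun x : ℝ => Real.exp (-(1 / 2) * x)) atTop (𝓝 0) := by
    refine Real.tendsto_exp_atBot.comp ?_
    exact tendsto_id.const_mul_atTop_of_neg (by norm_num)
  have h1 := (rpow_mul_exp_neg_mul_sq_isLittleO_exp_neg hl 1).trans_tendsto hexp
  have h0 := (rpow_mul_exp_neg_mul_sq_isLittleO_exp_neg hl 0).trans_tendsto hexp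
  simp only [Real.rpow_one, Real.rpow_zero, one_mul] at h1 h0
  have := (h1.const_mul A).add (h0.const_mul B)
  simp only [mul_zero, add_zero] at this
  refine this.congr fun R => ?_
  ring

/-- The residue computation behind the shift of a Gaussian integral by `π i`. -/
theorem integral_linGauss_div_sinh {lam : ℝ} (hl : 0 < lam) (α β : ℂ) {r : ℝ} (hr0 : 0 < r)
    (hr : r < Real.pi) :
    ∫ u : ℝ, (linGauss lam α β (eighthRoot * u) + linGauss lam α β (eighthRoot * u + Real.pi * I))
        / sinh (eighthRoot * u - r * I)
      = 2 * Real.pi * I * (linGauss lam α β (r * I) / eighthRoot) := by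
  set Y : ℝ := √2 / 2 * Real.pi with hY
  have hs : 0 < √2 / 2 := by positivity
  have hY0 : 0 < Y := mul_pos hs Real.pi_pos
  set f : ℂ → ℂ := fun v => linGauss lam α β (eighthRoot * v) / sinh (eighthRoot * v - r * I)
    with hf
  set c : ℂ := r * eighthRoot with hc
  have hcre : c.re = r * (√2 / 2) := by
    rw [hc, re_ofReal_mul]
    simp [eighthRoot]
  have hcim : c.im = r * (√2 / 2) := by
    rw [hc, im_ofReal_mul]
    simp [eighthRoot]
  have hcI : eighthRoot * c = r * I := by
    rw [hc, ← eighthRoot_sq]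
    ring
  -- the function with its pole removed
  set G : ℂ → ℂ := fun v => linGauss lam α β (eighthRoot * v)
    / (eighthRoot * dslope sinh 0 (eighthRoot * v - r * I)) with hG
  have hds : ∀ z, z * dslope sinh 0 z = sinh z := by
    intro z
    have := sub_smul_dslope sinh 0 z
    simpa using this
  have hds0 : dslope sinh 0 0 = 1 := by
    rw [dslope_same, Complex.deriv_sinh, cosh_zero]
  have hfG : f = fun v => G v / (v - c) := by
    funext v
    simp only [hf, hG]
    have : eighthRoot * v - r * I = eighthRoot * (v - c) := by
      rw [mul_sub, hcI]
    rw [← hds (eighthRoot * v - r * I), div_div]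
    congr 1
    nth_rewrite 1 [this]
    ring
  have hGc : G c = linGauss lam α β (r * I) / eighthRoot := by
    simp only [hG]
    rw [hcI, sub_self, hds0, mul_one]
  have hGd : ∀ R : ℝ, DifferentiableOn ℂ G ([[-R, R]] ×ℂ [[0, Y]]) := by
    intro R v hv
    refine DifferentiableAt.differentiableWithinAt ?_
    have hdiff : Differentiable ℂ (dslope sinh 0) := by
      rw [← differentiableOn_univ, differentiableOn_dslope univ_mem]
      exact differentiable_sinh.differentiableOn
    refine DifferentiableAt.div ?_ ?_ ?_
    · exact ((differentiable_linGauss lam α β).comp (differentiable_id.const_mul _)) v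
    · exact ((hdiff.comp ((differentiable_id.const_mul _).sub_const _)).const_mul _) v
    · refine mul_ne_zero eighthRoot_ne_zero fun h0 => ?_
      have him := hv.2
      rw [mem_preimage, uIcc_of_le hY0.le] at him
      have hvc := eighthRoot_mul_sub_eq_zero hr0 hr him.1 him.2
        (by rw [← hds, h0, mul_zero])
      rw [hvc, ← hc, hcI, sub_self, hds0] at h0
      exact one_ne_zero h0
  -- the rectangle
  have hrect : ∀ R : ℝ, r * (√2 / 2) < R →
      rectIntegral f ((-R : ℝ) : ℂ) (R + Y * I) = 2 * Real.pi * I * G c := by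
    intro R hR
    have hr2 : 0 < r * (√2 / 2) := by positivity
    rw [hfG]
    refine rectIntegral_div ?_ ?_ ?_ ?_ ?_
    · rw [ofReal_re, hcre]
      linarith
    · simpa [hcre] using hR
    · rw [ofReal_im, hcim]
      exact hr2
    · have : r * (√2 / 2) < Y := by
        rw [hY]
        nlinarith
      simpa [hcim] using this
    · simpa using hGd R
  -- the horizontal sides
  have hint0 : Integrable fun x : ℝ => f x :=
    integrable_div_sinh (integrable_linGauss_line hl α β) hr0 hr
  have hint1 : Integrable fun u : ℝ =>
      linGauss lam α β (eighthRoot * u + Real.pi * I) / sinh (eighthRoot * u - r * I) :=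
    integrable_div_sinh (integrable_linGauss_line_add_pi hl α β) hr0 hr
  -- The top side, translated by Y to the left, is the original line moved by πi. The sign from sinh
  -- (z + πi) = -sinh z turns the difference of the horizontal sides into the sum in the statement.
  have hshift : ∀ x : ℝ, f (x + Y * I) = -(linGauss lam α β (eighthRoot * (x - Y : ℝ) + Real.pi * I)
      / sinh (eighthRoot * (x - Y : ℝ) - r * I)) := by
    intro x
    have h1 : eighthRoot * ((x : ℂ) + Y * I) = eighthRoot * (x - Y : ℝ) + Real.pi * I := by
      rw [← eighthRoot_mul_add_pi, ← hY]
      push_cast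
      ring
    simp only [hf]
    rw [h1, add_sub_right_comm, sinh_add_pi_mul_I, div_neg]
  have hinttop : Integrable fun x : ℝ => f (x + Y * I) := by
    simp only [hshift]
    exact (hint1.comp_sub_right Y).neg
  have hvaltop : ∫ x : ℝ, f (x + Y * I)
      = -∫ u : ℝ, linGauss lam α β (eighthRoot * u + Real.pi * I) / sinh (eighthRoot * u - r * I) := by
    simp only [hshift]
    rw [integral_neg]
    congr 1
    exact integral_sub_right_eq_self (fun u : ℝ =>
      linGauss lam α β (eighthRoot * u + Real.pi * I) / sinh (eighthRoot * u - r * I)) Y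
  -- the vertical sides
  have hbound : ∀ R : ℝ, 2 + Y ≤ R → ∀ x : ℝ, |x| = R → ∀ y ∈ Icc 0 Y,
      ‖f (x + y * I)‖ ≤ Real.exp (lam * Y ^ 2)
        * ((‖α‖ * R + (‖α‖ * Y + ‖β‖)) * Real.exp (-lam * R ^ 2)) := by
    intro R hR x hx y hy
    have hden : 1 ≤ ‖sinh (eighthRoot * (x + y * I) - r * I)‖ := by
      refine one_le_norm_sinh le_rfl ?_
      have : R - Y ≤ |x - y| := by
        calc R - Y ≤ |x| - |y| := by
              rw [hx, abs_of_nonneg hy.1]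
              linarith [hy.2]
          _ ≤ |x - y| := abs_sub_abs_le_abs_sub x y
      simp
      linarith
    have hnum : ‖linGauss lam α β (eighthRoot * (x + y * I))‖ ≤ Real.exp (lam * Y ^ 2)
        * ((‖α‖ * R + (‖α‖ * Y + ‖β‖)) * Real.exp (-lam * R ^ 2)) := by
      rw [linGauss_eighthRoot_mul, norm_mul, norm_exp]
      have e1 : (-(lam : ℂ) * ((x : ℂ) + y * I) ^ 2).re = -lam * R ^ 2 + lam * y ^ 2 := by
        rw [← hx, sq_abs]
        simp [pow_two]
        ring
      have e2 : ‖α * eighthRoot * ((x : ℂ) + y * I) + β‖ ≤ ‖α‖ * R + (‖α‖ * Y + ‖β‖) := by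
        refine (norm_add_le _ _).trans ?_
        rw [norm_mul, norm_mul, norm_eighthRoot, mul_one]
        have : ‖(x : ℂ) + y * I‖ ≤ R + Y := by
          refine (norm_add_le _ _).trans ?_
          rw [norm_mul, norm_I, mul_one, norm_real, norm_real, Real.norm_eq_abs, Real.norm_eq_abs,
            hx, abs_of_nonneg hy.1]
          linarith [hy.2]
        nlinarith [norm_nonneg α]
      have e3 : Real.exp (-lam * R ^ 2 + lam * y ^ 2)
          ≤ Real.exp (lam * Y ^ 2) * Real.exp (-lam * R ^ 2) := by
        rw [← Real.exp_add]
        refine Real.exp_le_exp.2 ?_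
        have : y ^ 2 ≤ Y ^ 2 := pow_le_pow_left₀ hy.1 hy.2 2
        nlinarith
      rw [e1]
      calc _ ≤ (‖α‖ * R + (‖α‖ * Y + ‖β‖))
            * (Real.exp (lam * Y ^ 2) * Real.exp (-lam * R ^ 2)) :=
            mul_le_mul e2 e3 (Real.exp_nonneg _) ((norm_nonneg _).trans e2)
        _ = _ := by ring
    simp only [hf, norm_div]
    exact (div_le_self (norm_nonneg _) hden).trans hnum
  have hvert : ∀ s : ℝ → ℝ, (∀ R, 0 ≤ R → |s R| = R) →
      Tendsto (fun R : ℝ => ∫ y : ℝ in (0 : ℝ)..Y, f (s R + y * I)) atTop (𝓝 0) := by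
    intro s hs'
    have hlim := ((tendsto_linear_mul_gaussian hl ‖α‖ (‖α‖ * Y + ‖β‖)).const_mul
      (Real.exp (lam * Y ^ 2))).mul_const |Y - 0|
    rw [mul_zero, zero_mul] at hlim
    refine squeeze_zero_norm' ?_ hlim
    filter_upwards [eventually_ge_atTop (2 + Y)] with R hR
    refine intervalIntegral.norm_integral_le_of_norm_le_const fun y hy => ?_
    rw [uIoc_of_le hY0.le] at hy
    exact hbound R hR _ (hs' R (by linarith)) y ⟨hy.1.le, hy.2⟩
  have hlimit : Tendsto (fun R : ℝ => rectIntegral f ((-R : ℝ) : ℂ) (R + Y * I)) atTop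
      (𝓝 ((∫ x : ℝ, f x) - (∫ x : ℝ, f (x + Y * I)) + I * 0 - I * 0)) := by
    have t0 := intervalIntegral_tendsto_integral hint0 tendsto_neg_atTop_atBot tendsto_id
    have t1 := intervalIntegral_tendsto_integral hinttop tendsto_neg_atTop_atBot tendsto_id
    have t2 := hvert (fun R => R) (fun R hR => abs_of_nonneg hR)
    have t3 := hvert (fun R => -R) (fun R hR => by rw [abs_neg, abs_of_nonneg hR])
    refine (((t0.sub t1).add (t2.const_mul I)).sub (t3.const_mul I)).congr fun R => ?_
    simp [rectIntegral]
  have hev : ∀ᶠ R : ℝ in atTop, rectIntegral f ((-R : ℝ) : ℂ) (R + Y * I)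
      = 2 * Real.pi * I * G c := by
    filter_upwards [eventually_gt_atTop (r * (√2 / 2))] with R hR using hrect R hR
  have huniq := tendsto_nhds_unique hlimit ((tendsto_congr' hev).2 tendsto_const_nhds)
  rw [hvaltop, hGc] at huniq
  have hsum : ∫ u : ℝ, (linGauss lam α β (eighthRoot * u)
        + linGauss lam α β (eighthRoot * u + Real.pi * I)) / sinh (eighthRoot * u - r * I)
      = (∫ x : ℝ, f x) + ∫ u : ℝ, linGauss lam α β (eighthRoot * u + Real.pi * I)
        / sinh (eighthRoot * u - r * I) := by
    rw [← integral_add hint0 hint1]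
    simp only [hf, add_div]
  rw [hsum]
  linear_combination huniq

end StripResidue

/-! ### Partial fractions and geometric expansion of the generating function. -/

section PartialFractions

open Complex MeasureTheory Set

/-- The generating function `sinh (2 (a + 1) w) / cosh ((2 m + 1) w)`. -/
noncomputable def hypRatio (m a : ℕ) (w : ℂ) : ℂ :=
  sinh ((2 * (a + 1) : ℂ) * w) / cosh ((2 * m + 1 : ℂ) * w)

/-- The positions of the poles of `hypRatio` on the imaginary axis. -/
noncomputable def polePos (m k : ℕ) : ℝ := (2 * k + 1) / (2 * (2 * m + 1)) * Real.pi

/-- The residues of `hypRatio`. -/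
noncomputable def poleRes (m a k : ℕ) : ℂ :=
  (-1) ^ k * (Real.sin ((a + 1) * ((2 * k + 1) / (2 * m + 1)) * Real.pi) : ℂ) / (2 * m + 1)

theorem two_mul_add_one_ne_zero (m : ℕ) : (2 * (m : ℂ) + 1) ≠ 0 := by
  exact_mod_cast (Nat.succ_ne_zero (2 * m))

theorem polePos_pos (m k : ℕ) : 0 < polePos m k := by
  unfold polePos
  have := Real.pi_pos
  positivity

theorem polePos_lt_pi {m k : ℕ} (hk : k < 2 * m + 1) : polePos m k < Real.pi := by
  unfold polePos
  have h : ((2 * k + 1 : ℝ)) / (2 * (2 * m + 1)) < 1 := by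
    rw [div_lt_one (by positivity)]
    have : (k : ℝ) + 1 ≤ 2 * m + 1 := by exact_mod_cast hk
    linarith
  have := Real.pi_pos
  nlinarith

/-- Up to a factor this is the sum of the powers of e^{2πit/(2m+1)}; the bound on t excludes nonzero
multiples of 2m + 1. -/
theorem sum_exp_polePos (m : ℕ) (t : ℤ) (ht : |t| < 2 * m + 1) :
    ∑ k ∈ Finset.range (2 * m + 1), cexp (2 * t * polePos m k * I)
      = if t = 0 then 2 * (m : ℂ) + 1 else 0 := by
  have hM := two_mul_add_one_ne_zero m
  split_ifs with h
  · subst h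
    simp
  · set ξ := cexp (2 * Real.pi * I * (t / (2 * m + 1))) with hξ
    have hterm : ∀ k ∈ Finset.range (2 * m + 1), cexp (2 * t * polePos m k * I)
        = cexp (Real.pi * I * (t / (2 * m + 1))) * ξ ^ k := by
      intro k _
      rw [hξ, ← exp_nat_mul, ← exp_add]
      congr 1
      unfold polePos
      push_cast
      field_simp
      ring
    have hξ1 : ξ ≠ 1 := by
      intro h1
      obtain ⟨n, hn⟩ := exp_eq_one_iff.1 h1
      have h2 : (t : ℂ) = n * (2 * m + 1) := by
        have hpi : (2 * Real.pi * I : ℂ) ≠ 0 := two_pi_I_ne_zero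
        have : (t : ℂ) / (2 * m + 1) = n := mul_left_cancel₀ hpi (by rw [hn]; ring)
        rw [← this]
        field_simp
      have h3 : t = n * (2 * m + 1) := by exact_mod_cast h2
      have hn0 : n ≠ 0 := by
        rintro rfl
        exact h (by simpa using h3)
      have : 1 ≤ |n| := Int.one_le_abs hn0
      rw [h3, abs_mul, abs_of_nonneg (by positivity : (0 : ℤ) ≤ 2 * m + 1)] at ht
      nlinarith
    have hξM : ξ ^ (2 * m + 1) = 1 := by
      rw [hξ, ← exp_nat_mul, exp_eq_one_iff]
      refine ⟨t, ?_⟩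
      push_cast
      field_simp
    rw [Finset.sum_congr rfl hterm, ← Finset.mul_sum, geom_sum_eq hξ1, hξM]
    simp

theorem sum_exp_mul_sinh (m : ℕ) (z : ℂ) :
    (∑ n ∈ Finset.range (2 * m + 1), cexp (2 * ((n : ℂ) - m) * z)) * sinh z
      = sinh ((2 * m + 1 : ℂ) * z) := by
  have hterm : ∀ n ∈ Finset.range (2 * m + 1), cexp (2 * ((n : ℂ) - m) * z)
      = cexp (-(2 * m * z)) * cexp (2 * z) ^ n := by
    intro n _
    rw [← exp_nat_mul, ← exp_add]
    congr 1
    ring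
  have hsinh : sinh z = (cexp (2 * z) - 1) * cexp (-z) / 2 := by
    rw [sinh, sub_mul, one_mul, ← exp_add]
    congr 3
    ring
  rw [Finset.sum_congr rfl hterm, ← Finset.mul_sum, hsinh]
  have hg := geom_sum_mul (cexp (2 * z)) (2 * m + 1)
  have h1 : cexp (-(2 * m * z)) * (cexp (2 * z) ^ (2 * m + 1) - 1) * cexp (-z)
      = cexp ((2 * m + 1 : ℂ) * z) - cexp (-((2 * m + 1 : ℂ) * z)) := by
    rw [← exp_nat_mul, mul_sub, sub_mul, mul_one, ← exp_add, ← exp_add, ← exp_add]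
    congr 2
    · push_cast
      ring
    · ring
  rw [sinh, ← h1, ← hg]
  ring

theorem cosh_eq_sinh_shift (m k : ℕ) (w : ℂ) :
    cosh ((2 * m + 1 : ℂ) * w)
      = (-1) ^ k * I * sinh ((2 * m + 1 : ℂ) * (w - polePos m k * I)) := by
  have hM := two_mul_add_one_ne_zero m
  have h : (2 * m + 1 : ℂ) * w = (2 * m + 1 : ℂ) * (w - polePos m k * I)
      + (Real.pi / 2 * I + k * (Real.pi * I)) := by
    unfold polePos
    push_cast
    field_simp
    ring
  have h1 : ∀ z : ℂ, cosh (z + (Real.pi / 2 * I + k * (Real.pi * I))) = (-1) ^ k * I * sinh z := by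
    intro z
    have e1 : cexp (z + (Real.pi / 2 * I + k * (Real.pi * I))) = cexp z * (I * (-1) ^ k) := by
      rw [exp_add, exp_add, exp_nat_mul, exp_pi_mul_I, exp_pi_div_two_mul_I]
    have e2 : cexp (-(z + (Real.pi / 2 * I + k * (Real.pi * I)))) = cexp (-z) * (-I * (-1) ^ k) := by
      have : -(z + (Real.pi / 2 * I + k * (Real.pi * I)))
          = -z + (-(Real.pi / 2 * I) + k * (-(Real.pi * I))) := by ring
      rw [this, exp_add, exp_add, exp_nat_mul, exp_neg (Real.pi * I), exp_pi_mul_I,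
        exp_neg (Real.pi / 2 * I), exp_pi_div_two_mul_I, inv_I]
      norm_num
    rw [cosh, e1, e2, sinh]
    ring
  rw [← h1, ← h]

/-- The partial fraction expansion of `hypRatio`. -/
theorem hypRatio_eq_sum {m a : ℕ} (ha : a < m) {w : ℂ} (hw : cosh ((2 * m + 1 : ℂ) * w) ≠ 0)
    (hs : ∀ k < 2 * m + 1, sinh (w - polePos m k * I) ≠ 0) :
    hypRatio m a w
      = ∑ k ∈ Finset.range (2 * m + 1), poleRes m a k / sinh (w - polePos m k * I) := by
  have hM := two_mul_add_one_ne_zero m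
  unfold hypRatio
  rw [div_eq_iff hw, Finset.sum_mul]
  have hsin : ∀ k : ℕ, (Real.sin ((a + 1) * ((2 * k + 1) / (2 * m + 1)) * Real.pi) : ℂ)
      = (cexp (2 * ((a + 1 : ℤ) : ℂ) * polePos m k * I)
          - cexp (-(2 * ((a + 1 : ℤ) : ℂ) * polePos m k * I))) / (2 * I) := by
    intro k
    have e : (((a + 1) * ((2 * k + 1) / (2 * m + 1)) * Real.pi : ℝ) : ℂ)
        = 2 * ((a + 1 : ℤ) : ℂ) * polePos m k := by
      unfold polePos
      push_cast
      field_simp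
    rw [ofReal_sin, e, sin]
    field_simp
    rw [show I ^ 2 = -1 from I_sq]
    ring_nf
  -- Around its k-th zero, cosh ((2m+1)w) is ±i sinh ((2m+1)(w - r_k i)), and dividing by sinh (w -
  -- r_k i) leaves a Dirichlet kernel, that is, a finite sum of exponentials.
  have hterm : ∀ k ∈ Finset.range (2 * m + 1),
      poleRes m a k / sinh (w - polePos m k * I) * cosh ((2 * m + 1 : ℂ) * w)
        = ∑ n ∈ Finset.range (2 * m + 1), cexp (2 * ((n : ℂ) - m) * w) / (2 * (2 * m + 1))
          * (cexp (2 * (((a : ℤ) + 1 - (n - m) : ℤ) : ℂ) * polePos m k * I)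
            - cexp (2 * ((-((a : ℤ) + 1) - (n - m) : ℤ) : ℂ) * polePos m k * I)) := by
    intro k hk
    have hk' := hs k (Finset.mem_range.1 hk)
    rw [cosh_eq_sinh_shift m k, ← sum_exp_mul_sinh]
    unfold poleRes
    rw [hsin k]
    have hsq : ((-1 : ℂ) ^ k) * (-1) ^ k = 1 := by rw [← mul_pow]; norm_num
    have hI := I_ne_zero
    have : (-1 : ℂ) ^ k * ((cexp (2 * ((a + 1 : ℤ) : ℂ) * polePos m k * I)
          - cexp (-(2 * ((a + 1 : ℤ) : ℂ) * polePos m k * I))) / (2 * I)) / (2 * m + 1)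
          / sinh (w - polePos m k * I)
        * ((-1) ^ k * I * ((∑ n ∈ Finset.range (2 * m + 1),
          cexp (2 * ((n : ℂ) - m) * (w - polePos m k * I))) * sinh (w - polePos m k * I)))
        = ((-1 : ℂ) ^ k * (-1) ^ k) * ((∑ n ∈ Finset.range (2 * m + 1),
          cexp (2 * ((n : ℂ) - m) * (w - polePos m k * I))) * ((cexp (2 * ((a + 1 : ℤ) : ℂ) * polePos m k * I)
          - cexp (-(2 * ((a + 1 : ℤ) : ℂ) * polePos m k * I))) / (2 * (2 * m + 1)))) := by
      field_simp
    rw [this, hsq, one_mul, Finset.sum_mul]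
    refine Finset.sum_congr rfl fun n _ => ?_
    have e1 : cexp (2 * ((n : ℂ) - m) * (w - polePos m k * I))
        = cexp (2 * ((n : ℂ) - m) * w) * cexp (-(2 * ((n : ℂ) - m) * polePos m k * I)) := by
      rw [← exp_add]
      ring_nf
    have e2 : cexp (2 * (((a : ℤ) + 1 - (n - m) : ℤ) : ℂ) * polePos m k * I)
        = cexp (-(2 * ((n : ℂ) - m) * polePos m k * I))
          * cexp (2 * ((a + 1 : ℤ) : ℂ) * polePos m k * I) := by
      rw [← exp_add]
      congr 1
      push_cast
      ring
    have e3 : cexp (2 * ((-((a : ℤ) + 1) - (n - m) : ℤ) : ℂ) * polePos m k * I)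
        = cexp (-(2 * ((n : ℂ) - m) * polePos m k * I))
          * cexp (-(2 * ((a + 1 : ℤ) : ℂ) * polePos m k * I)) := by
      rw [← exp_add]
      congr 1
      push_cast
      ring
    rw [e1, e2, e3]
    ring
  rw [Finset.sum_congr rfl hterm, Finset.sum_comm]
  -- Orthogonality in k keeps only n = m ± (a + 1), the two exponentials of sinh (2(a+1)w). The
  -- hypothesis a < m keeps both frequencies within the range of `sum_exp_polePos`.
  have hinner : ∀ n ∈ Finset.range (2 * m + 1),
      ∑ k ∈ Finset.range (2 * m + 1), cexp (2 * ((n : ℂ) - m) * w) / (2 * (2 * m + 1))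
          * (cexp (2 * (((a : ℤ) + 1 - (n - m) : ℤ) : ℂ) * polePos m k * I)
            - cexp (2 * ((-((a : ℤ) + 1) - (n - m) : ℤ) : ℂ) * polePos m k * I))
        = (if n = m + (a + 1) then cexp (2 * ((n : ℂ) - m) * w) / 2 else 0)
          - (if n = m - (a + 1) then cexp (2 * ((n : ℂ) - m) * w) / 2 else 0) := by
    intro n hn
    have hn' := Finset.mem_range.1 hn
    rw [← Finset.mul_sum, Finset.sum_sub_distrib, sum_exp_polePos, sum_exp_polePos]
    · have c1 : ((a : ℤ) + 1 - (n - m) = 0) ↔ n = m + (a + 1) := by omega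
      have c2 : (-((a : ℤ) + 1) - (n - m) = 0) ↔ n = m - (a + 1) := by omega
      simp only [c1, c2]
      split_ifs <;> field_simp <;> ring
    · rw [abs_lt]
      constructor <;> omega
    · rw [abs_lt]
      constructor <;> omega
  rw [Finset.sum_congr rfl hinner, Finset.sum_sub_distrib, Finset.sum_ite_eq', Finset.sum_ite_eq',
    if_pos (Finset.mem_range.2 (by omega)), if_pos (Finset.mem_range.2 (by omega)), sinh,
    Nat.cast_sub (by omega)]
  push_cast
  ring_nf

/-- The finite geometric expansion of `hypRatio`. -/
theorem hypRatio_mul_exp (m a N : ℕ) {w : ℂ} (hw : cosh ((2 * m + 1 : ℂ) * w) ≠ 0) :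
    (-1) ^ N * cexp (-(2 * (2 * m + 1) * N * w)) * hypRatio m a w
      = hypRatio m a w - ∑ j ∈ Finset.range N, (-1) ^ j
        * (cexp (-((2 * m + 1) * (2 * j + 1) - 2 * (a + 1) : ℂ) * w)
          - cexp (-((2 * m + 1) * (2 * j + 1) + 2 * (a + 1) : ℂ) * w)) := by
  have hg := mul_neg_geom_sum (-cexp (-(2 * (2 * m + 1) * w))) N
  have hp : (-cexp (-(2 * (2 * m + 1) * w))) ^ N
      = (-1) ^ N * cexp (-(2 * (2 * m + 1) * N * w)) := by
    rw [neg_pow, ← exp_nat_mul]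
    congr 2
    ring
  have hterm : ∀ j ∈ Finset.range N, (-1 : ℂ) ^ j
        * (cexp (-((2 * m + 1) * (2 * j + 1) - 2 * (a + 1) : ℂ) * w)
          - cexp (-((2 * m + 1) * (2 * j + 1) + 2 * (a + 1) : ℂ) * w))
      = 2 * sinh ((2 * (a + 1) : ℂ) * w) * cexp (-((2 * m + 1 : ℂ) * w))
        * (-cexp (-(2 * (2 * m + 1) * w))) ^ j := by
    intro j _
    rw [neg_pow (cexp _), ← exp_nat_mul, sinh]
    have e1 : cexp (-((2 * m + 1) * (2 * j + 1) - 2 * (a + 1) : ℂ) * w)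
        = cexp ((2 * (a + 1) : ℂ) * w) * cexp (-((2 * m + 1 : ℂ) * w))
          * cexp (j * -(2 * (2 * m + 1) * w)) := by
      rw [← exp_add, ← exp_add]
      ring_nf
    have e2 : cexp (-((2 * m + 1) * (2 * j + 1) + 2 * (a + 1) : ℂ) * w)
        = cexp (-((2 * (a + 1) : ℂ) * w)) * cexp (-((2 * m + 1 : ℂ) * w))
          * cexp (j * -(2 * (2 * m + 1) * w)) := by
      rw [← exp_add, ← exp_add]
      ring_nf
    rw [e1, e2]
    ring
  rw [Finset.sum_congr rfl hterm, ← Finset.mul_sum]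
  rw [hp] at hg
  set S := ∑ j ∈ Finset.range N, (-cexp (-(2 * (2 * m + 1) * w))) ^ j
  have hc : cosh ((2 * m + 1 : ℂ) * w) * 2 * cexp (-((2 * m + 1 : ℂ) * w))
      = 1 - -cexp (-(2 * (2 * m + 1) * w)) := by
    rw [cosh, div_mul_cancel₀ _ two_ne_zero, add_mul, ← exp_add, ← exp_add]
    rw [show (2 * m + 1 : ℂ) * w + -((2 * m + 1 : ℂ) * w) = 0 by ring, exp_zero]
    ring_nf
  unfold hypRatio
  generalize sinh ((2 * (a + 1) : ℂ) * w) = A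
  field_simp
  linear_combination A * (hg + S * hc)

end PartialFractions

/-! ### The q-series as a Mordell type integral plus residues. -/

section IntegralRepresentation

open Complex MeasureTheory Set

/-- The coefficient `(2 m + 1) N / π` of the Gaussian. -/
noncomputable def gaussCoeff (m N : ℕ) : ℝ := (2 * m + 1) * N / Real.pi

theorem gaussCoeff_pos (m : ℕ) {N : ℕ} (hN : 0 < N) : 0 < gaussCoeff m N := by
  unfold gaussCoeff
  have := Real.pi_pos
  positivity

theorem cosh_line_ne_zero (m : ℕ) (u : ℝ) : cosh ((2 * m + 1 : ℂ) * (eighthRoot * u)) ≠ 0 := by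
  rcases eq_or_ne u 0 with rfl | hu
  · simp
  · have h := abs_sinh_re_le_norm_cosh ((2 * m + 1 : ℂ) * (eighthRoot * u))
    have hre : ((2 * m + 1 : ℂ) * (eighthRoot * u)).re = (2 * m + 1) * (√2 / 2 * u) := by
      have : (2 * m + 1 : ℂ) = ((2 * m + 1 : ℝ) : ℂ) := by push_cast; rfl
      rw [this, re_ofReal_mul, eighthRoot_mul_re]
      simp
    rw [← norm_pos_iff]
    refine lt_of_lt_of_le ?_ (le_abs_sinh.trans h)
    rw [hre, abs_pos]
    have : (0 : ℝ) < √2 / 2 := by positivity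
    have : (0 : ℝ) < 2 * m + 1 := by positivity
    positivity

theorem integral_exp_mul_linGauss {lam : ℝ} (hl : 0 < lam) (n : ℂ) :
    ∫ u : ℝ, cexp (-n * (eighthRoot * u))
        * linGauss lam (1 / 2) (Real.pi * I / 4) (eighthRoot * u)
      = (√(Real.pi / lam) : ℝ) * ((Real.pi * I / 4 - n * I / (4 * lam))
        * cexp (n ^ 2 * I / (4 * lam))) := by
  have hl' : (lam : ℂ) ≠ 0 := by exact_mod_cast hl.ne'
  have h := integral_linear_mul_cexp_gaussian hl (eighthRoot / 2) (Real.pi * I / 4)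
    (-n * eighthRoot)
  have hfun : ∀ u : ℝ, cexp (-n * (eighthRoot * u))
        * linGauss lam (1 / 2) (Real.pi * I / 4) (eighthRoot * u)
      = (eighthRoot / 2 * u + Real.pi * I / 4) * cexp (-lam * u ^ 2 + -n * eighthRoot * u) := by
    intro u
    rw [linGauss_eighthRoot_mul, exp_add, mul_assoc (-n)]
    ring
  simp only [hfun]
  rw [h]
  have e1 : (-n * eighthRoot) ^ 2 / (4 * (lam : ℂ)) = n ^ 2 * I / (4 * lam) := by
    rw [mul_pow, eighthRoot_sq]
    ring
  have e2 : eighthRoot / 2 * (-n * eighthRoot / (2 * lam)) = -(n * I / (4 * lam)) := by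
    rw [← eighthRoot_sq]
    field_simp
    ring
  rw [e1, e2]
  ring

/-- Here λπ² = (2m+1)Nπ with 2m + 1 odd. With 2πλ = 2(2m+1)N, this makes the quasi-period factor of
the Gaussian equal to the N-th power of the geometric ratio. -/
theorem exp_neg_gaussCoeff (m N : ℕ) :
    cexp (-(I * gaussCoeff m N * Real.pi ^ 2)) = (-1) ^ N := by
  have hpi : (Real.pi : ℂ) ≠ 0 := ofReal_ne_zero.2 Real.pi_ne_zero
  have h : -(I * gaussCoeff m N * Real.pi ^ 2) = N * (Real.pi * I)
      + ((-((m : ℤ) + 1) * N : ℤ) : ℂ) * (2 * Real.pi * I) := by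
    unfold gaussCoeff
    push_cast
    field_simp
    ring
  rw [h, exp_add, exp_int_mul_two_pi_mul_I, exp_nat_mul, exp_pi_mul_I, mul_one]

/-- Evaluation of the Mordell type integral of `hypRatio`. -/
theorem integral_hypRatio {m a N : ℕ} (ha : a < m) (hN : 0 < N) :
    ∫ u : ℝ, eighthRoot * u * cexp (-gaussCoeff m N * u ^ 2) * hypRatio m a (eighthRoot * u)
      = 2 * Real.pi * I / eighthRoot * ∑ k ∈ Finset.range (2 * m + 1), poleRes m a k
          * linGauss (gaussCoeff m N) (1 / 2) (-(Real.pi * I / 4)) (polePos m k * I)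
        + (√(Real.pi / gaussCoeff m N) : ℝ) * ∑ j ∈ Finset.range N, (-1) ^ j
          * ((Real.pi * I / 4 - ((2 * m + 1) * (2 * j + 1) - 2 * (a + 1)) * I
                / (4 * gaussCoeff m N))
              * cexp (((2 * m + 1) * (2 * j + 1) - 2 * (a + 1)) ^ 2 * I / (4 * gaussCoeff m N))
            - (Real.pi * I / 4 - ((2 * m + 1) * (2 * j + 1) + 2 * (a + 1)) * I
                / (4 * gaussCoeff m N))
              * cexp (((2 * m + 1) * (2 * j + 1) + 2 * (a + 1)) ^ 2 * I
                / (4 * gaussCoeff m N))) := by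
  have hl := gaussCoeff_pos m hN
  set lam := gaussCoeff m N with hlam
  -- The linear factors w/2 - πi/4 of L and w/2 + πi/4 of L' differ by the shift by πi and add up to
  -- w.
  set L : ℂ → ℂ := linGauss lam (1 / 2) (-(Real.pi * I / 4)) with hL
  set L' : ℂ → ℂ := linGauss lam (1 / 2) (Real.pi * I / 4) with hL'
  have hpi : (Real.pi : ℂ) ≠ 0 := ofReal_ne_zero.2 Real.pi_ne_zero
  have hshift : ∀ w, L (w + Real.pi * I)
      = (-1) ^ N * cexp (-(2 * (2 * m + 1) * N * w)) * L' w := by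
    intro w
    simp only [hL, hL']
    rw [linGauss_add_pi, hlam, exp_neg_gaussCoeff, ← mul_assoc]
    congr 1
    · congr 3
      unfold gaussCoeff
      push_cast
      field_simp
    · congr 1
      ring
  have hLadd : ∀ u : ℝ, L (eighthRoot * u) + L' (eighthRoot * u)
      = eighthRoot * u * cexp (-lam * u ^ 2) := by
    intro u
    simp only [hL, hL', linGauss_eighthRoot_mul]
    ring
  -- The first sum is (L(w) + L(w + πi)) h(w) by partial fractions; the second is the rest, L'(w) (1
  -- - (-1)^N e^{-2(2m+1)Nw}) h(w), in which the geometric expansion removes the denominator.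
  have hpoint : ∀ u : ℝ,
      eighthRoot * u * cexp (-lam * u ^ 2) * hypRatio m a (eighthRoot * u)
        = (∑ k ∈ Finset.range (2 * m + 1), poleRes m a k
            * ((L (eighthRoot * u) + L (eighthRoot * u + Real.pi * I))
              / sinh (eighthRoot * u - polePos m k * I)))
          + ∑ j ∈ Finset.range N, (-1) ^ j
            * (cexp (-((2 * m + 1) * (2 * j + 1) - 2 * (a + 1) : ℂ) * (eighthRoot * u))
                * L' (eighthRoot * u)
              - cexp (-((2 * m + 1) * (2 * j + 1) + 2 * (a + 1) : ℂ) * (eighthRoot * u))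
                * L' (eighthRoot * u)) := by
    intro u
    have h1 := hypRatio_eq_sum ha (cosh_line_ne_zero m u)
      fun k hk => sinh_line_ne_zero (polePos_pos m k) (polePos_lt_pi hk) u
    have h2 := hypRatio_mul_exp m a N (cosh_line_ne_zero m u)
    have e1 : ∑ k ∈ Finset.range (2 * m + 1), poleRes m a k
            * ((L (eighthRoot * u) + L (eighthRoot * u + Real.pi * I))
              / sinh (eighthRoot * u - polePos m k * I))
        = (L (eighthRoot * u) + L (eighthRoot * u + Real.pi * I))
          * hypRatio m a (eighthRoot * u) := by
      rw [h1, Finset.mul_sum]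
      exact Finset.sum_congr rfl fun k _ => by ring
    have e2 : ∑ j ∈ Finset.range N, (-1 : ℂ) ^ j
            * (cexp (-((2 * m + 1) * (2 * j + 1) - 2 * (a + 1) : ℂ) * (eighthRoot * u))
                * L' (eighthRoot * u)
              - cexp (-((2 * m + 1) * (2 * j + 1) + 2 * (a + 1) : ℂ) * (eighthRoot * u))
                * L' (eighthRoot * u))
        = L' (eighthRoot * u) * ∑ j ∈ Finset.range N, (-1) ^ j
        * (cexp (-((2 * m + 1) * (2 * j + 1) - 2 * (a + 1) : ℂ) * (eighthRoot * u))
          - cexp (-((2 * m + 1) * (2 * j + 1) + 2 * (a + 1) : ℂ) * (eighthRoot * u))) := by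
      rw [Finset.mul_sum]
      exact Finset.sum_congr rfl fun k _ => by ring
    rw [e1, e2, hshift, ← hLadd]
    linear_combination (-L' (eighthRoot * u)) * h2
  have hintk : ∀ k ∈ Finset.range (2 * m + 1), Integrable fun u : ℝ => poleRes m a k
      * ((L (eighthRoot * u) + L (eighthRoot * u + Real.pi * I))
        / sinh (eighthRoot * u - polePos m k * I)) := by
    intro k hk
    exact (integrable_div_sinh ((integrable_linGauss_line hl _ _).add
      (integrable_linGauss_line_add_pi hl _ _)) (polePos_pos m k)
      (polePos_lt_pi (Finset.mem_range.1 hk))).const_mul _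
  have hintn : ∀ n : ℂ, Integrable fun u : ℝ =>
      cexp (-n * (eighthRoot * u)) * L' (eighthRoot * u) :=
    fun n => integrable_exp_mul_linGauss_line hl _ _ _
  have hintj : ∀ j ∈ Finset.range N, Integrable fun u : ℝ => (-1 : ℂ) ^ j
      * (cexp (-((2 * m + 1) * (2 * j + 1) - 2 * (a + 1) : ℂ) * (eighthRoot * u))
          * L' (eighthRoot * u)
        - cexp (-((2 * m + 1) * (2 * j + 1) + 2 * (a + 1) : ℂ) * (eighthRoot * u))
          * L' (eighthRoot * u)) :=
    fun j _ => ((hintn _).sub (hintn _)).const_mul _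
  simp only [hpoint]
  rw [integral_add (integrable_finsetSum _ hintk) (integrable_finsetSum _ hintj),
    integral_finsetSum _ hintk, integral_finsetSum _ hintj]
  congr 1
  · rw [Finset.mul_sum]
    refine Finset.sum_congr rfl fun k hk => ?_
    rw [integral_const_mul, integral_linGauss_div_sinh hl _ _ (polePos_pos m k)
      (polePos_lt_pi (Finset.mem_range.1 hk))]
    ring
  · rw [Finset.mul_sum]
    refine Finset.sum_congr rfl fun j _ => ?_
    rw [integral_const_mul, integral_sub (hintn _) (hintn _), integral_exp_mul_linGauss hl,
      integral_exp_mul_linGauss hl]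
    ring

theorem rootOmega_isPrimitiveRoot {N : ℕ} (hN : 0 < N) : IsPrimitiveRoot (rootOmega N) N := by
  have := isPrimitiveRoot_exp N hN.ne'
  unfold rootOmega
  exact this

/-- The `q`-series at `exp (2 π i / N)` in terms of a Mordell type integral. -/
theorem XSeries_rootOmega_eq {m a N : ℕ} (ha : a < m) (hN : 0 < N) :
    (√(Real.pi / gaussCoeff m N) : ℝ) * (I / gaussCoeff m N)
        * (cexp (Real.pi * I / N * expo m a) * XSeries m a (rootOmega N))
      = (∫ u : ℝ, eighthRoot * u * cexp (-gaussCoeff m N * u ^ 2) * hypRatio m a (eighthRoot * u))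
        - 2 * Real.pi * I / eighthRoot * ∑ k ∈ Finset.range (2 * m + 1), poleRes m a k
          * linGauss (gaussCoeff m N) (1 / 2) (-(Real.pi * I / 4)) (polePos m k * I) := by
  have hpi : (Real.pi : ℂ) ≠ 0 := ofReal_ne_zero.2 Real.pi_ne_zero
  have hN' : (N : ℂ) ≠ 0 := by exact_mod_cast hN.ne'
  have hM := two_mul_add_one_ne_zero m
  obtain ⟨h1, h2⟩ := XSeries_eq_partial_theta hN (rootOmega_isPrimitiveRoot hN) ha
  rw [integral_hypRatio ha hN, add_sub_cancel_left]
  have hlam : (gaussCoeff m N : ℂ) = (2 * m + 1) * N / Real.pi := by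
    unfold gaussCoeff
    push_cast
    ring
  set C : ℕ → ℂ := fun j => (-1) ^ j
    * rootOmega N ^ (j * (2 * m - a) + (2 * m + 1) * j.choose 2) with hC
  set W : ℕ → ℂ := fun j => rootOmega N ^ ((a + 1) * (2 * j + 1)) with hW
  set κ := cexp (Real.pi * I / N * expo m a) with hκ
  have hpow : ∀ n : ℕ, rootOmega N ^ n = cexp (2 * Real.pi * I / N * n) := by
    intro n
    unfold rootOmega
    rw [← exp_nat_mul]
    congr 1
    ring
  have hchoose : ∀ j : ℕ, ((j.choose 2 : ℕ) : ℂ) = j * (j - 1) / 2 := by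
    intro j
    rw [Nat.cast_choose_two]
  -- Completing the square: the part of the exponent independent of j is `expo m a`, and the rest is
  -- the exponent of ω in the theta sum.
  have hminus : ∀ j : ℕ, (-1) ^ j * cexp (((2 * m + 1) * (2 * j + 1) - 2 * (a + 1)) ^ 2 * I
      / (4 * gaussCoeff m N)) = κ * C j := by
    intro j
    simp only [hC, hκ]
    rw [hpow, mul_left_comm, ← exp_add, hlam]
    congr 2
    push_cast [Nat.cast_sub (show a ≤ 2 * m by omega)]
    rw [hchoose]
    unfold expo
    field_simp
    ring
  have hplus : ∀ j : ℕ, (-1) ^ j * cexp (((2 * m + 1) * (2 * j + 1) + 2 * (a + 1)) ^ 2 * I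
      / (4 * gaussCoeff m N)) = κ * (C j * W j) := by
    intro j
    rw [← mul_assoc, ← hminus]
    simp only [hW]
    rw [hpow, mul_assoc, ← exp_add, hlam]
    congr 2
    push_cast
    field_simp
    ring
  -- The frequencies are (2m - 2a - 1) + 2(2m+1)j, with 4(a+1) added in the second term. All that is
  -- constant in j multiplies the vanishing theta sum; the rest is the sum giving the q-series.
  have hsum : ∑ j ∈ Finset.range N, (-1 : ℂ) ^ j
          * ((Real.pi * I / 4 - ((2 * m + 1) * (2 * j + 1) - 2 * (a + 1)) * I
                / (4 * gaussCoeff m N))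
              * cexp (((2 * m + 1) * (2 * j + 1) - 2 * (a + 1)) ^ 2 * I / (4 * gaussCoeff m N))
            - (Real.pi * I / 4 - ((2 * m + 1) * (2 * j + 1) + 2 * (a + 1)) * I
                / (4 * gaussCoeff m N))
              * cexp (((2 * m + 1) * (2 * j + 1) + 2 * (a + 1)) ^ 2 * I
                / (4 * gaussCoeff m N)))
      = κ * ((Real.pi * I / 4 - (2 * m - 2 * a - 1) * I / (4 * gaussCoeff m N))
          * (∑ j ∈ Finset.range N, C j * (1 - W j))
        - 2 * I / (4 * gaussCoeff m N) * ∑ j ∈ Finset.range N,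
          C j * ((2 * m + 1) * j * (1 - W j) - (2 * a + 2) * W j)) := by
    rw [Finset.mul_sum, Finset.mul_sum, ← Finset.sum_sub_distrib, Finset.mul_sum]
    refine Finset.sum_congr rfl fun j _ => ?_
    linear_combination (Real.pi * I / 4 - ((2 * m + 1) * (2 * j + 1) - 2 * (a + 1)) * I
        / (4 * gaussCoeff m N)) * hminus j
      - (Real.pi * I / 4 - ((2 * m + 1) * (2 * j + 1) + 2 * (a + 1)) * I
        / (4 * gaussCoeff m N)) * hplus j
  rw [hsum, h2]
  linear_combination (κ * (√(Real.pi / gaussCoeff m N) : ℝ) * I / (2 * gaussCoeff m N)) * h1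

/-- The residue contribution, folded to half of the poles. -/
theorem sum_poleRes_mul_linGauss {m a N : ℕ} (hN : 0 < N) :
    ∑ k ∈ Finset.range (2 * m + 1), poleRes m a k
        * linGauss (gaussCoeff m N) (1 / 2) (-(Real.pi * I / 4)) (polePos m k * I)
      = -(Real.pi * I / (2 * m + 1) ^ 2) * ∑ k ∈ Finset.range m, (-1) ^ k * ((m : ℂ) - k)
        * (Real.sin ((a + 1) * ((2 * k + 1) / (2 * m + 1)) * Real.pi) : ℂ)
        * cexp (-(N * Real.pi * I * ((2 * k + 1) ^ 2 / (4 * (2 * m + 1))))) := by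
  have hpi : (Real.pi : ℂ) ≠ 0 := ofReal_ne_zero.2 Real.pi_ne_zero
  have hN' : (N : ℂ) ≠ 0 := by exact_mod_cast hN.ne'
  have hM := two_mul_add_one_ne_zero m
  set s : ℕ → ℂ := fun k => (-1) ^ k * ((m : ℂ) - k)
        * (Real.sin ((a + 1) * ((2 * k + 1) / (2 * m + 1)) * Real.pi) : ℂ)
        * cexp (-(N * Real.pi * I * ((2 * k + 1) ^ 2 / (4 * (2 * m + 1))))) with hs
  have hterm : ∀ k ∈ Finset.range (2 * m + 1), poleRes m a k
        * linGauss (gaussCoeff m N) (1 / 2) (-(Real.pi * I / 4)) (polePos m k * I)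
      = -(Real.pi * I / (2 * (2 * m + 1) ^ 2)) * s k := by
    intro k _
    have e : I * gaussCoeff m N * (polePos m k * I) ^ 2
        = -(N * Real.pi * I * ((2 * k + 1) ^ 2 / (4 * (2 * m + 1)))) := by
      unfold gaussCoeff polePos
      push_cast
      rw [mul_pow, I_sq]
      field_simp
      ring
    simp only [hs]
    unfold linGauss
    rw [e]
    unfold poleRes polePos
    push_cast
    field_simp
    ring
  rw [Finset.sum_congr rfl hterm, ← Finset.mul_sum]
  -- The reflection k ↦ 2m - k of the poles about πi/2 changes the sign of both the sine and the
  -- factor m - k.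
  have hrefl : ∀ k ∈ Finset.range m, s (m + 1 + k) = s (m - 1 - k) := by
    intro k hk
    have hk' := Finset.mem_range.1 hk
    obtain ⟨t, rfl⟩ := Nat.exists_eq_add_of_le (show k + 1 ≤ m from hk')
    have e0 : k + 1 + t - 1 - k = t := by omega
    rw [e0]
    simp only [hs]
    have hMr : (2 * ((k + 1 + t : ℕ) : ℝ) + 1) ≠ 0 := by positivity
    have e1 : (-1 : ℂ) ^ (k + 1 + t + 1 + k) = (-1) ^ t := by
      rw [show k + 1 + t + 1 + k = 2 * (k + 1) + t by ring, pow_add, pow_mul]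
      norm_num
    have e2 : Real.sin ((a + 1) * ((2 * ((k + 1 + t + 1 + k : ℕ) : ℝ) + 1)
          / (2 * ((k + 1 + t : ℕ) : ℝ) + 1)) * Real.pi)
        = -Real.sin ((a + 1) * ((2 * (t : ℝ) + 1) / (2 * ((k + 1 + t : ℕ) : ℝ) + 1)) * Real.pi) := by
      have : ((a + 1) * ((2 * ((k + 1 + t + 1 + k : ℕ) : ℝ) + 1)
          / (2 * ((k + 1 + t : ℕ) : ℝ) + 1)) * Real.pi)
          = ((a + 1 : ℕ) : ℝ) * (2 * Real.pi)
            - (a + 1) * ((2 * (t : ℝ) + 1) / (2 * ((k + 1 + t : ℕ) : ℝ) + 1)) * Real.pi := by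
        push_cast at hMr ⊢
        field_simp
        ring
      rw [this, Real.sin_nat_mul_two_pi_sub]
    have e3 : cexp (-(N * Real.pi * I * ((2 * ((k + 1 + t + 1 + k : ℕ) : ℂ) + 1) ^ 2
          / (4 * (2 * ((k + 1 + t : ℕ) : ℂ) + 1)))))
        = cexp (-(N * Real.pi * I * ((2 * (t : ℂ) + 1) ^ 2
          / (4 * (2 * ((k + 1 + t : ℕ) : ℂ) + 1))))) := by
      have : -(N * Real.pi * I * ((2 * ((k + 1 + t + 1 + k : ℕ) : ℂ) + 1) ^ 2
          / (4 * (2 * ((k + 1 + t : ℕ) : ℂ) + 1))))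
          = -(N * Real.pi * I * ((2 * (t : ℂ) + 1) ^ 2
          / (4 * (2 * ((k + 1 + t : ℕ) : ℂ) + 1))))
            + ((-(N * (k + 1)) : ℤ) : ℂ) * (2 * Real.pi * I) := by
        push_cast at hM ⊢
        field_simp
        ring
      rw [this, exp_add, exp_int_mul_two_pi_mul_I, mul_one]
    rw [e1, e2, e3]
    push_cast
    ring
  have hmid : s m = 0 := by simp [hs]
  rw [show 2 * m + 1 = m + 1 + m by ring, Finset.sum_range_add, Finset.sum_range_succ, hmid,
    Finset.sum_congr rfl hrefl, Finset.sum_range_reflect]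
  field_simp
  ring

end IntegralRepresentation

/-! ### The L-values as Taylor coefficients, through Bernoulli polynomials. -/

section TaylorCoefficients

open Complex
open scoped Topology

/-- The formal exponential `exp (c X)`. -/
noncomputable def expSeries (c : ℂ) : PowerSeries ℂ := PowerSeries.rescale c (PowerSeries.exp ℂ)

theorem expSeries_mul (c d : ℂ) : expSeries c * expSeries d = expSeries (c + d) :=
  PowerSeries.exp_mul_exp_eq_exp_add c d

theorem expSeries_zero : expSeries 0 = 1 := by
  unfold expSeries
  simp

theorem coeff_expSeries (c : ℂ) (n : ℕ) :
    PowerSeries.coeff n (expSeries c) = c ^ n / (n.factorial : ℂ) := by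
  unfold expSeries
  rw [PowerSeries.coeff_rescale, PowerSeries.coeff_exp]
  simp [div_eq_mul_inv]

theorem rescale_expSeries (c d : ℂ) :
    PowerSeries.rescale d (expSeries c) = expSeries (c * d) := by
  ext n
  rw [PowerSeries.coeff_rescale, coeff_expSeries, coeff_expSeries, mul_pow]
  ring

/-- The Taylor series of `hypRatio` at `0`. -/
noncomputable def hypSeries (m a : ℕ) : PowerSeries ℂ :=
  (expSeries (2 * (a + 1)) - expSeries (-(2 * (a + 1))))
    * (expSeries (2 * m + 1) + expSeries (-(2 * m + 1)))⁻¹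

theorem hypSeries_mul (m a : ℕ) :
    hypSeries m a * (expSeries (2 * m + 1) + expSeries (-(2 * m + 1)))
      = expSeries (2 * (a + 1)) - expSeries (-(2 * (a + 1))) := by
  unfold hypSeries
  rw [mul_assoc, PowerSeries.inv_mul_cancel, mul_one]
  rw [map_add, ← PowerSeries.coeff_zero_eq_constantCoeff_apply,
    ← PowerSeries.coeff_zero_eq_constantCoeff_apply, coeff_expSeries, coeff_expSeries]
  norm_num

theorem coshSeries_ne_zero (m : ℕ) :
    expSeries (2 * m + 1) + expSeries (-(2 * m + 1)) ≠ 0 := by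
  intro h
  have := congrArg (PowerSeries.coeff 0) h
  rw [map_add, coeff_expSeries, coeff_expSeries] at this
  norm_num at this

theorem coeff_hypSeries_even (m a n : ℕ) : PowerSeries.coeff (2 * n) (hypSeries m a) = 0 := by
  have h1 := hypSeries_mul m a
  have h2 := congrArg (PowerSeries.rescale (-1 : ℂ)) h1
  simp only [map_mul, map_add, map_sub, rescale_expSeries, mul_neg, mul_one, neg_neg] at h2
  have h3 : PowerSeries.rescale (-1 : ℂ) (hypSeries m a) = -hypSeries m a := by
    refine mul_right_cancel₀ (coshSeries_ne_zero m) ?_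
    linear_combination h2 + h1
  have h4 := congrArg (PowerSeries.coeff (2 * n)) h3
  rw [PowerSeries.coeff_rescale, pow_mul, map_neg] at h4
  norm_num at h4
  exact self_eq_neg.1 h4

/-- The values of `chiFun` as a combination of indicator functions. -/
theorem chiFun_eq {m a : ℕ} (ha : a < m) (n : ZMod (8 * m + 4)) :
    chiFun m a n = (if n = ((2 * m - 2 * a - 1 : ℕ) : ZMod (8 * m + 4)) then 1 else 0)
      - (if n = ((2 * m + 2 * a + 3 : ℕ) : ZMod (8 * m + 4)) then 1 else 0)
      - (if n = ((6 * m - 2 * a + 1 : ℕ) : ZMod (8 * m + 4)) then 1 else 0)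
      + (if n = ((6 * m + 2 * a + 5 : ℕ) : ZMod (8 * m + 4)) then 1 else 0) := by
  have e1 : ((2 * m - 2 * a - 1 : ℕ) : ZMod (8 * m + 4)) = 2 * m - 2 * a - 1 := by
    rw [Nat.cast_sub (by omega), Nat.cast_sub (by omega)]
    push_cast
    rfl
  have e2 : ((2 * m + 2 * a + 3 : ℕ) : ZMod (8 * m + 4)) = 2 * m + 2 * a + 3 := by
    push_cast
    rfl
  have e3 : ((6 * m - 2 * a + 1 : ℕ) : ZMod (8 * m + 4)) = 6 * m - 2 * a + 1 := by
    rw [Nat.cast_add, Nat.cast_sub (by omega)]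
    push_cast
    rfl
  have e4 : ((6 * m + 2 * a + 5 : ℕ) : ZMod (8 * m + 4)) = 6 * m + 2 * a + 5 := by
    push_cast
    rfl
  have hne : ∀ x y : ℕ, x < 8 * m + 4 → y < 8 * m + 4 → x ≠ y →
      (x : ZMod (8 * m + 4)) ≠ (y : ZMod (8 * m + 4)) := by
    intro x y hx hy hxy h
    rw [ZMod.natCast_eq_natCast_iff'] at h
    rw [Nat.mod_eq_of_lt hx, Nat.mod_eq_of_lt hy] at h
    exact hxy h
  have d12 := hne (2 * m - 2 * a - 1) (2 * m + 2 * a + 3) (by omega) (by omega) (by omega)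
  have d13 := hne (2 * m - 2 * a - 1) (6 * m - 2 * a + 1) (by omega) (by omega) (by omega)
  have d14 := hne (2 * m - 2 * a - 1) (6 * m + 2 * a + 5) (by omega) (by omega) (by omega)
  have d23 := hne (2 * m + 2 * a + 3) (6 * m - 2 * a + 1) (by omega) (by omega) (by omega)
  have d24 := hne (2 * m + 2 * a + 3) (6 * m + 2 * a + 5) (by omega) (by omega) (by omega)
  have d34 := hne (6 * m - 2 * a + 1) (6 * m + 2 * a + 5) (by omega) (by omega) (by omega)
  unfold chiFun
  rw [← e1, ← e2, ← e3, ← e4]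
  by_cases h1 : n = ((2 * m - 2 * a - 1 : ℕ) : ZMod (8 * m + 4))
  · subst h1
    rw [if_pos rfl, if_pos rfl, if_neg d12, if_neg d13, if_neg d14]
    ring
  rw [if_neg h1, if_neg h1]
  by_cases h2 : n = ((2 * m + 2 * a + 3 : ℕ) : ZMod (8 * m + 4))
  · subst h2
    rw [if_pos rfl, if_pos rfl, if_neg d23, if_neg d24]
    ring
  rw [if_neg h2, if_neg h2]
  by_cases h3 : n = ((6 * m - 2 * a + 1 : ℕ) : ZMod (8 * m + 4))
  · subst h3
    rw [if_pos rfl, if_pos rfl, if_neg d34]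
    ring
  rw [if_neg h3, if_neg h3]
  ring

theorem sum_chiFun_mul {m a : ℕ} (ha : a < m) (g : ZMod (8 * m + 4) → ℂ) :
    ∑ n, chiFun m a n * g n = g ((2 * m - 2 * a - 1 : ℕ) : ZMod (8 * m + 4))
      - g ((2 * m + 2 * a + 3 : ℕ) : ZMod (8 * m + 4))
      - g ((6 * m - 2 * a + 1 : ℕ) : ZMod (8 * m + 4))
      + g ((6 * m + 2 * a + 5 : ℕ) : ZMod (8 * m + 4)) := by
  simp only [chiFun_eq ha, add_mul, sub_mul, ite_mul, one_mul, zero_mul, Finset.sum_add_distrib,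
    Finset.sum_sub_distrib, Finset.sum_ite_eq', Finset.mem_univ, if_true]

/-- The generating series of the Bernoulli polynomials at `t`. -/
noncomputable def bernoulliSeries (t : ℂ) : PowerSeries ℂ :=
  PowerSeries.mk fun n => Polynomial.aeval t ((1 / n.factorial : ℚ) • Polynomial.bernoulli n)

theorem bernoulliSeries_mul (t : ℂ) :
    bernoulliSeries t * (expSeries 1 - 1) = PowerSeries.X * expSeries t := by
  have := Polynomial.bernoulli_generating_function t
  unfold bernoulliSeries expSeries
  rw [PowerSeries.rescale_one]
  exact this

/-- This is ζ(-k, x) = -B_{k+1}(x) / (k+1) at k = 2n + 1, written with coefficients of the Bernoulli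
generating series. -/
theorem hurwitzZeta_neg_odd {P : ℕ} [NeZero P] (r : ℕ) (hr : r < P) (n : ℕ) :
    HurwitzZeta.hurwitzZeta (ZMod.toAddCircle (r : ZMod P)) (-2 * n - 1)
      = -((2 * n + 1).factorial : ℂ)
        * PowerSeries.coeff (2 * n + 2) (bernoulliSeries ((r : ℂ) / P)) := by
  have hP : (0 : ℝ) < P := by exact_mod_cast Nat.pos_of_ne_zero (NeZero.ne P)
  have hmem : (r : ℝ) / P ∈ Set.Icc (0 : ℝ) 1 :=
    ⟨by positivity, by
      rw [div_le_one hP]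
      exact_mod_cast hr.le⟩
  have h := HurwitzZeta.hurwitzZeta_neg_nat (k := 2 * n + 1) (by omega) hmem
  have e : (-2 * (n : ℂ) - 1) = -((2 * n + 1 : ℕ) : ℂ) := by
    push_cast
    ring
  rw [ZMod.toAddCircle_natCast, e, h]
  unfold bernoulliSeries
  rw [PowerSeries.coeff_mk, map_smul, Polynomial.eval_map, ← Polynomial.aeval_def,
    Nat.factorial_succ (2 * n + 1), Rat.smul_def]
  have hf : ((2 * n + 1).factorial : ℂ) ≠ 0 := by exact_mod_cast Nat.factorial_ne_zero _
  have h2 : ((2 * n + 1 : ℕ) : ℂ) + 1 ≠ 0 := by exact_mod_cast Nat.succ_ne_zero (2 * n + 1)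
  push_cast at h2 ⊢
  field_simp

/-- Put x = e^{-(2m+1)w} and s, s' = e^{±2(a+1)w}. The four residues carry the exponentials xs,
-xs', -x³s, x³s', with sum (x - x³)(s - s'). The Bernoulli denominator contributes 1 - x⁴, and x(s -
s') / (1 + x²) is the quotient of sinh by cosh. -/
theorem chi_bernoulliSeries {m a : ℕ} (ha : a < m) :
    PowerSeries.rescale (-(8 * m + 4 : ℂ))
        (bernoulliSeries (((2 * m - 2 * a - 1 : ℕ) : ℂ) / ((8 * m + 4 : ℕ) : ℂ))
          - bernoulliSeries (((2 * m + 2 * a + 3 : ℕ) : ℂ) / ((8 * m + 4 : ℕ) : ℂ))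
          - bernoulliSeries (((6 * m - 2 * a + 1 : ℕ) : ℂ) / ((8 * m + 4 : ℕ) : ℂ))
          + bernoulliSeries (((6 * m + 2 * a + 5 : ℕ) : ℂ) / ((8 * m + 4 : ℕ) : ℂ)))
      = PowerSeries.C (8 * m + 4 : ℂ) * PowerSeries.X * hypSeries m a := by
  have hP : (8 * m + 4 : ℂ) ≠ 0 := by exact_mod_cast (Nat.succ_ne_zero (8 * m + 3))
  have hb : ∀ r : ℕ, PowerSeries.rescale (-(8 * m + 4 : ℂ))
      (bernoulliSeries ((r : ℂ) / ((8 * m + 4 : ℕ) : ℂ))) * (expSeries (-(8 * m + 4)) - 1)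
      = -(PowerSeries.C (8 * m + 4 : ℂ) * PowerSeries.X) * expSeries (-r) := by
    intro r
    have h := congrArg (PowerSeries.rescale (-(8 * m + 4 : ℂ)))
      (bernoulliSeries_mul ((r : ℂ) / ((8 * m + 4 : ℕ) : ℂ)))
    rw [map_mul, map_mul, map_sub, map_one, rescale_expSeries, rescale_expSeries,
      PowerSeries.rescale_X, one_mul] at h
    rw [h]
    have e : (r : ℂ) / ((8 * m + 4 : ℕ) : ℂ) * -(8 * m + 4) = -r := by
      push_cast
      field_simp
    rw [e, map_neg]
    generalize PowerSeries.C (8 * m + 4 : ℂ) = y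
    ring
  set x := expSeries (-(2 * m + 1 : ℂ)) with hx
  have hx2 : expSeries (-(8 * m + 4 : ℂ)) = x * x * (x * x) := by
    rw [hx, expSeries_mul, expSeries_mul]
    congr 1
    ring
  have hy : x * expSeries (2 * m + 1) = 1 := by
    rw [hx, expSeries_mul, neg_add_cancel, expSeries_zero]
  set s := expSeries (2 * (a + 1 : ℂ)) with hs
  set s' := expSeries (-(2 * (a + 1 : ℂ))) with hs'
  have r1 : expSeries (-((2 * m - 2 * a - 1 : ℕ) : ℂ)) = x * s := by
    rw [hx, hs, expSeries_mul, Nat.cast_sub (by omega), Nat.cast_sub (by omega)]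
    push_cast
    congr 1
    ring
  have r2 : expSeries (-((2 * m + 2 * a + 3 : ℕ) : ℂ)) = x * s' := by
    rw [hx, hs', expSeries_mul]
    push_cast
    congr 1
    ring
  have r3 : expSeries (-((6 * m - 2 * a + 1 : ℕ) : ℂ)) = x * x * x * s := by
    rw [hx, hs, expSeries_mul, expSeries_mul, expSeries_mul, Nat.cast_add, Nat.cast_sub (by omega)]
    push_cast
    congr 1
    ring
  have r4 : expSeries (-((6 * m + 2 * a + 5 : ℕ) : ℂ)) = x * x * x * s' := by
    rw [hx, hs', expSeries_mul, expSeries_mul, expSeries_mul]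
    push_cast
    congr 1
    ring
  have b1 := hb (2 * m - 2 * a - 1)
  have b2 := hb (2 * m + 2 * a + 3)
  have b3 := hb (6 * m - 2 * a + 1)
  have b4 := hb (6 * m + 2 * a + 5)
  rw [r1, hx2] at b1
  rw [r2, hx2] at b2
  rw [r3, hx2] at b3
  rw [r4, hx2] at b4
  have hH := hypSeries_mul m a
  rw [← hs, ← hs', ← hx] at hH
  have hne : x * x * (x * x) - 1 ≠ 0 := by
    rw [← hx2]
    intro h
    have := congrArg (PowerSeries.coeff 1) h
    rw [map_sub, coeff_expSeries, PowerSeries.coeff_one] at this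
    simp only [pow_one, Nat.factorial_one, Nat.cast_one, div_one, one_ne_zero, if_false, sub_zero,
      map_zero, neg_eq_zero] at this
    exact hP this
  refine mul_right_cancel₀ hne ?_
  generalize PowerSeries.C (8 * m + 4 : ℂ) * PowerSeries.X = y at b1 b2 b3 b4 ⊢
  rw [map_add, map_sub, map_sub]
  linear_combination b1 - b2 - b3 + b4 - y * x * (x * x - 1) * hH
    + y * hypSeries m a * (x * x - 1) * hy

/-- The numbers `T_m^{(a)}(n)` as Taylor coefficients of `hypRatio`. -/
theorem TCoeff_eq {m a : ℕ} (ha : a < m) (n : ℕ) :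
    TCoeff m a n = 1 / 2 * (-1) ^ n * ((2 * n + 1).factorial : ℂ)
      * PowerSeries.coeff (2 * n + 1) (hypSeries m a) := by
  have hP : (8 * m + 4 : ℂ) ≠ 0 := by exact_mod_cast (Nat.succ_ne_zero (8 * m + 3))
  have hcoef := congrArg (PowerSeries.coeff (2 * n + 2)) (chi_bernoulliSeries ha)
  rw [PowerSeries.coeff_rescale, mul_assoc, PowerSeries.coeff_C_mul, map_add, map_sub, map_sub,
    show 2 * n + 2 = (2 * n + 1) + 1 by ring, PowerSeries.coeff_succ_X_mul] at hcoef
  unfold TCoeff ZMod.LFunction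
  rw [sum_chiFun_mul ha fun j => HurwitzZeta.hurwitzZeta (ZMod.toAddCircle j) (-2 * n - 1),
    hurwitzZeta_neg_odd _ (by omega), hurwitzZeta_neg_odd _ (by omega),
    hurwitzZeta_neg_odd _ (by omega), hurwitzZeta_neg_odd _ (by omega)]
  have e : -(-2 * (n : ℂ) - 1) = ((2 * n + 1 : ℕ) : ℂ) := by
    push_cast
    ring
  rw [e, cpow_natCast]
  have hcast : (((8 * m + 4 : ℕ) : ℕ) : ℂ) = 8 * m + 4 := by
    push_cast
    ring
  rw [hcast] at hcoef ⊢
  rw [show 2 * n + 2 = (2 * n + 1) + 1 by ring]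
  -- The rescaling factor is negative, but the exponent is even.
  have hpow : (-(8 * m + 4 : ℂ)) ^ (2 * n + 1 + 1) = (8 * m + 4) ^ (2 * n + 1) * (8 * m + 4) := by
    rw [show 2 * n + 1 + 1 = 2 * (n + 1) by ring, pow_mul, neg_sq, ← pow_mul, ← pow_succ,
      show 2 * n + 1 + 1 = 2 * (n + 1) by ring]
  rw [hpow] at hcoef
  refine mul_right_cancel₀ hP ?_
  linear_combination (1 / 2 * (-1) ^ n * ((2 * n + 1).factorial : ℂ)) * hcoef

end TaylorCoefficients

/-! ### Taylor expansion at 0 as an asymptotic statement. -/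

section TaylorApproximation

open Complex MeasureTheory
open scoped Topology

/-- The power series `p` is the Taylor series of `f` at `0`, in the sense of asymptotics. -/
def HasTaylor (f : ℂ → ℂ) (p : PowerSeries ℂ) : Prop :=
  ∀ J : ℕ, (fun w => f w - (PowerSeries.trunc J p).eval w) =O[𝓝 0] fun w => w ^ J

theorem HasTaylor.add {f g : ℂ → ℂ} {p q : PowerSeries ℂ} (hf : HasTaylor f p)
    (hg : HasTaylor g q) : HasTaylor (fun w => f w + g w) (p + q) := by
  intro J
  refine ((hf J).add (hg J)).congr_left fun w => ?_
  rw [map_add, Polynomial.eval_add]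
  ring

theorem HasTaylor.sub {f g : ℂ → ℂ} {p q : PowerSeries ℂ} (hf : HasTaylor f p)
    (hg : HasTaylor g q) : HasTaylor (fun w => f w - g w) (p - q) := by
  intro J
  refine ((hf J).sub (hg J)).congr_left fun w => ?_
  rw [PowerSeries.trunc_sub, Polynomial.eval_sub]
  ring

theorem isBigO_eval_of_coeff_eq_zero {d : Polynomial ℂ} {J : ℕ} (h : ∀ n < J, d.coeff n = 0) :
    (fun w => d.eval w) =O[𝓝 0] fun w : ℂ => w ^ J := by
  obtain ⟨e, rfl⟩ := Polynomial.X_pow_dvd_iff.2 h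
  have he : (fun w => e.eval w) =O[𝓝 0] fun _ : ℂ => (1 : ℂ) :=
    (e.continuous.tendsto 0).isBigO_one ℂ
  simpa using (isBigO_refl (fun w : ℂ => w ^ J) (𝓝 0)).mul he

/-- Division of Taylor series. -/
theorem HasTaylor.of_mul {f g k : ℂ → ℂ} {p q r : PowerSeries ℂ} (hg : HasTaylor g q)
    (hk : HasTaylor k r) (hgc : ContinuousAt g 0) (hg0 : g 0 ≠ 0)
    (hmul : ∀ᶠ w in 𝓝 0, f w * g w = k w) (hpq : p * q = r) : HasTaylor f p := by
  intro J
  have hpoly := isBigO_eval_of_coeff_eq_zero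
    (d := PowerSeries.trunc J r - PowerSeries.trunc J p * PowerSeries.trunc J q) (J := J) (by
      intro n hn
      rw [Polynomial.coeff_sub, PowerSeries.coeff_trunc, if_pos hn, ← hpq,
        PowerSeries.coeff_mul_eq_coeff_trunc_mul_trunc _ _ hn, ← Polynomial.coe_mul,
        Polynomial.coeff_coe, sub_self])
  have hP : (fun w => (PowerSeries.trunc J p).eval w) =O[𝓝 0] fun _ : ℂ => (1 : ℂ) :=
    ((PowerSeries.trunc J p).continuous.tendsto 0).isBigO_one ℂ
  have hinv : (fun w => (g w)⁻¹) =O[𝓝 0] fun _ : ℂ => (1 : ℂ) :=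
    (hgc.tendsto.inv₀ hg0).isBigO_one ℂ
  have hPg : (fun w => (PowerSeries.trunc J p).eval w * (g w - (PowerSeries.trunc J q).eval w))
      =O[𝓝 0] fun w => w ^ J := by
    simpa using hP.mul (hg J)
  -- With truncations P, Q, R of p, q, r, one has (f - P) g = (k - R) - P (g - Q) + (R - P Q), and R
  -- - P Q has no terms below degree J.
  have hmain := (((hk J).sub hPg).add hpoly).mul hinv
  refine hmain.congr' ?_ (Eventually.of_forall fun w => mul_one _)
  filter_upwards [hmul, hgc.eventually_ne hg0] with w hw hgw
  rw [← hw, Polynomial.eval_sub, Polynomial.eval_mul, ← div_eq_mul_inv, div_eq_iff hgw]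
  ring

theorem hasTaylor_exp (c : ℂ) : HasTaylor (fun w => cexp (c * w)) (expSeries c) := by
  intro J
  have h1 : Tendsto (fun w : ℂ => c * w) (𝓝 0) (𝓝 0) := by
    have : Continuous fun w : ℂ => c * w := by fun_prop
    simpa using this.tendsto 0
  have h := (exp_sub_sum_range_isBigO_pow J).comp_tendsto h1
  refine (h.trans ?_).congr_left fun w => ?_
  · refine IsBigO.of_bound (‖c‖ ^ J) (Eventually.of_forall fun w => ?_)
    simp [mul_pow]
  · simp only [Function.comp_apply]
    congr 1
    rw [Polynomial.eval, PowerSeries.eval₂_trunc_eq_sum_range]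
    refine Finset.sum_congr rfl fun n _ => ?_
    rw [coeff_expSeries, mul_pow, RingHom.id_apply]
    ring

theorem hasTaylor_hypRatio (m a : ℕ) : HasTaylor (hypRatio m a) (hypSeries m a) := by
  refine HasTaylor.of_mul ((hasTaylor_exp (2 * m + 1)).add (hasTaylor_exp (-(2 * m + 1))))
    ((hasTaylor_exp (2 * (a + 1))).sub (hasTaylor_exp (-(2 * (a + 1))))) (by fun_prop) (by simp)
    ?_ (hypSeries_mul m a)
  have hc : ∀ᶠ w : ℂ in 𝓝 0, cosh ((2 * m + 1 : ℂ) * w) ≠ 0 := by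
    refine ContinuousAt.eventually_ne ?_ (by simp)
    exact (continuous_cosh.comp (continuous_const.mul continuous_id)).continuousAt
  filter_upwards [hc] with w hw
  have e1 : cexp ((2 * m + 1) * w) + cexp (-(2 * m + 1) * w) = 2 * cosh ((2 * m + 1) * w) := by
    rw [cosh, neg_mul]
    ring
  have e2 : cexp (2 * (a + 1) * w) - cexp (-(2 * (a + 1)) * w) = 2 * sinh (2 * (a + 1) * w) := by
    rw [sinh, neg_mul]
    ring
  rw [e1, e2]
  unfold hypRatio
  rw [mul_left_comm, div_mul_cancel₀ _ hw]

end TaylorApproximation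

/-! ### Uniform bounds on the line of integration. -/

section LineBounds

open Complex MeasureTheory
open scoped Topology

theorem continuous_hypRatio_line (m a : ℕ) : Continuous fun u : ℝ => hypRatio m a (eighthRoot * u) := by
  unfold hypRatio
  refine Continuous.div ?_ ?_ fun u => cosh_line_ne_zero m u
  · exact continuous_sinh.comp (by fun_prop)
  · exact continuous_cosh.comp (by fun_prop)

/-- As 2(a+1) ≤ 2m + 1, the numerator is at most 1 + |sinh ((2m+1) Re w)|. The second summand is
bounded by the modulus of the denominator, the first by a multiple of it since the denominator stays
away from 0 on the line. -/
theorem exists_norm_hypRatio_line_le {m a : ℕ} (ha : a < m) :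
    ∃ B : ℝ, ∀ u : ℝ, ‖hypRatio m a (eighthRoot * u)‖ ≤ B := by
  have hre : ∀ (b : ℝ) (u : ℝ), ((b : ℂ) * (eighthRoot * u)).re = b * (√2 / 2 * u) := by
    intro b u
    rw [re_ofReal_mul, eighthRoot_mul_re]
    simp
  have hM : (2 * m + 1 : ℂ) = ((2 * m + 1 : ℝ) : ℂ) := by push_cast; rfl
  have hA : (2 * (a + 1) : ℂ) = ((2 * (a + 1) : ℝ) : ℂ) := by push_cast; rfl
  have hs : (0 : ℝ) < √2 / 2 := by positivity
  have hlow : ∀ u : ℝ, |Real.sinh ((2 * m + 1) * (√2 / 2 * u))|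
      ≤ ‖cosh ((2 * m + 1 : ℂ) * (eighthRoot * u))‖ := by
    intro u
    rw [← hre, ← hM]
    exact_mod_cast abs_sinh_re_le_norm_cosh _
  obtain ⟨δ, hδ, hb⟩ := exists_pos_le_norm (g := fun u : ℝ => cosh ((2 * m + 1 : ℂ) * (eighthRoot * u)))
    (continuous_cosh.comp (by fun_prop)) (cosh_line_ne_zero m) (R := 2 / √2) (by
      intro u hu
      refine le_trans ?_ (le_abs_sinh.trans (hlow u))
      rw [abs_mul, abs_mul, abs_of_pos hs, abs_of_pos (by positivity)]
      have h1 : 1 ≤ √2 / 2 * |u| := by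
        calc (1 : ℝ) = √2 / 2 * (2 / √2) := by field_simp
          _ ≤ _ := by gcongr
      have : (0 : ℝ) ≤ m := by positivity
      nlinarith)
  refine ⟨1 / δ + 1, fun u => ?_⟩
  unfold hypRatio
  have hpos := hδ.trans_le (hb u)
  rw [norm_div, div_le_iff₀ hpos]
  have h1 : ‖sinh ((2 * (a + 1) : ℂ) * (eighthRoot * u))‖
      ≤ Real.cosh ((2 * (a + 1)) * (√2 / 2 * u)) := by
    rw [← hre, ← hA]
    exact_mod_cast norm_sinh_le_cosh_re _
  have h2 : Real.cosh ((2 * (a + 1)) * (√2 / 2 * u)) ≤ Real.cosh ((2 * m + 1) * (√2 / 2 * u)) := by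
    rw [Real.cosh_le_cosh, abs_mul, abs_mul (2 * (m : ℝ) + 1)]
    rw [abs_of_pos (by positivity : (0 : ℝ) < 2 * (a + 1)),
      abs_of_pos (by positivity : (0 : ℝ) < 2 * m + 1)]
    gcongr
    have : (a : ℝ) + 1 ≤ m := by exact_mod_cast ha
    linarith
  have h3 : ∀ x : ℝ, Real.cosh x ≤ 1 + |Real.sinh x| := by
    intro x
    refine abs_le_of_sq_le_sq' ?_ (by positivity) |>.2
    rw [Real.cosh_sq]
    nlinarith [sq_abs (Real.sinh x), abs_nonneg (Real.sinh x)]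
  have h4 : 1 ≤ 1 / δ * ‖cosh ((2 * m + 1 : ℂ) * (eighthRoot * u))‖ := by
    rw [one_div, inv_mul_eq_div, one_le_div hδ]
    exact hb u
  linarith [h3 ((2 * m + 1) * (√2 / 2 * u)), hlow u]

theorem norm_eval_trunc_le (p : PowerSeries ℂ) (J : ℕ) {ε : ℝ} (hε : 0 < ε) :
    ∃ B : ℝ, ∀ w : ℂ, ε ≤ ‖w‖ → ‖(PowerSeries.trunc J p).eval w‖ ≤ B * ‖w‖ ^ J := by
  refine ⟨∑ n ∈ Finset.range J, ‖PowerSeries.coeff n p‖ / ε ^ (J - n), fun w hw => ?_⟩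
  rw [Polynomial.eval, PowerSeries.eval₂_trunc_eq_sum_range, Finset.sum_mul]
  refine (norm_sum_le _ _).trans (Finset.sum_le_sum fun n hn => ?_)
  have hn' := (Finset.mem_range.1 hn).le
  rw [RingHom.id_apply, norm_mul, norm_pow, div_mul_eq_mul_div, le_div_iff₀ (by positivity),
    mul_assoc]
  gcongr
  calc ‖w‖ ^ n * ε ^ (J - n) ≤ ‖w‖ ^ n * ‖w‖ ^ (J - n) := by gcongr
    _ = ‖w‖ ^ J := by rw [← pow_add, Nat.add_sub_cancel' hn']

/-- Near 0 this is the Taylor estimate. Away from 0 the function is bounded and the truncation has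
degree below J, so both are bounded by multiples of |u|^J. -/
theorem exists_norm_hypRatio_sub_trunc_le {m a : ℕ} (ha : a < m) (J : ℕ) :
    ∃ C : ℝ, ∀ u : ℝ, ‖hypRatio m a (eighthRoot * u)
      - (PowerSeries.trunc J (hypSeries m a)).eval (eighthRoot * u)‖ ≤ C * |u| ^ J := by
  obtain ⟨B, hB⟩ := exists_norm_hypRatio_line_le ha
  obtain ⟨C, hC⟩ := (hasTaylor_hypRatio m a J).bound
  obtain ⟨ε, hε, hball⟩ := Metric.eventually_nhds_iff.1 hC
  obtain ⟨D, hD⟩ := norm_eval_trunc_le (hypSeries m a) J hε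
  have hB0 : 0 ≤ B := (norm_nonneg _).trans (hB 0)
  have hnorm : ∀ u : ℝ, ‖eighthRoot * (u : ℂ)‖ = |u| := by
    intro u
    rw [norm_mul, norm_eighthRoot, one_mul, norm_real, Real.norm_eq_abs]
  refine ⟨max C (B / ε ^ J + D), fun u => ?_⟩
  rcases lt_or_ge |u| ε with hu | hu
  · have h := hball (y := eighthRoot * u) (by rw [dist_zero_right, hnorm]; exact hu)
    rw [norm_pow, hnorm] at h
    exact h.trans (by gcongr; exact le_max_left _ _)
  · have h := hD (eighthRoot * u) (by rw [hnorm]; exact hu)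
    rw [hnorm] at h
    have h2 : B ≤ B / ε ^ J * |u| ^ J := by
      rw [div_mul_eq_mul_div, le_div_iff₀ (by positivity)]
      gcongr
    calc _ ≤ ‖hypRatio m a (eighthRoot * u)‖
          + ‖(PowerSeries.trunc J (hypSeries m a)).eval (eighthRoot * u)‖ := norm_sub_le _ _
      _ ≤ (B / ε ^ J + D) * |u| ^ J := by linarith [hB u]
      _ ≤ _ := by gcongr; exact le_max_right _ _

end LineBounds

/-! ### Termwise integration of the Taylor expansion against the Gaussian. -/

section Watson

open Complex MeasureTheory
open scoped Topology

theorem integrable_pow_mul_exp_neg_mul_sq {lam : ℝ} (hl : 0 < lam) (n : ℕ) :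
    Integrable fun u : ℝ => u ^ n * Real.exp (-lam * u ^ 2) := by
  have h := integrable_rpow_mul_exp_neg_mul_sq hl (s := n) (by
    have : (0 : ℝ) ≤ n := by positivity
    linarith)
  simpa only [Real.rpow_natCast] using h

/-- The even moments of a Gaussian. -/
theorem integral_pow_mul_exp_neg_mul_sq {lam : ℝ} (hl : 0 < lam) (n : ℕ) :
    ∫ u : ℝ, u ^ (2 * n) * Real.exp (-lam * u ^ 2)
      = √(Real.pi / lam) * ((2 * n).factorial / (n.factorial * (4 * lam) ^ n)) := by
  induction n with
  | zero => simpa using integral_gaussian lam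
  | succ n ih =>
    have h0 : ∫ u : ℝ, ((2 * n + 1) * (u ^ (2 * n) * Real.exp (-lam * u ^ 2))
        - 2 * lam * (u ^ (2 * (n + 1)) * Real.exp (-lam * u ^ 2))) = 0 := by
      refine integral_eq_zero_of_hasDerivAt_of_integrable
        (f := fun u : ℝ => u ^ (2 * n + 1) * Real.exp (-lam * u ^ 2)) (fun u => ?_)
        (((integrable_pow_mul_exp_neg_mul_sq hl _).const_mul _).sub
          ((integrable_pow_mul_exp_neg_mul_sq hl _).const_mul _))
        (integrable_pow_mul_exp_neg_mul_sq hl _)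
      have h1 := (hasDerivAt_pow (2 * n + 1) u).mul (((hasDerivAt_pow 2 u).const_mul (-lam)).exp)
      refine h1.congr_deriv ?_
      simp only [Nat.add_sub_cancel]
      push_cast
      ring
    rw [integral_sub ((integrable_pow_mul_exp_neg_mul_sq hl _).const_mul _)
      ((integrable_pow_mul_exp_neg_mul_sq hl _).const_mul _), integral_const_mul,
      integral_const_mul, ih] at h0
    have h1 : ∫ u : ℝ, u ^ (2 * (n + 1)) * Real.exp (-lam * u ^ 2)
        = (2 * n + 1) / (2 * lam)
          * (√(Real.pi / lam) * ((2 * n).factorial / (n.factorial * (4 * lam) ^ n))) := by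
      field_simp at h0 ⊢
      linarith
    rw [h1, show 2 * (n + 1) = 2 * n + 1 + 1 by ring, Nat.factorial_succ (2 * n + 1),
      Nat.factorial_succ (2 * n), Nat.factorial_succ n]
    push_cast
    field_simp
    ring

theorem integrable_hypRatio_line {m a : ℕ} (ha : a < m) {lam : ℝ} (hl : 0 < lam) :
    Integrable fun u : ℝ =>
      eighthRoot * u * cexp (-lam * u ^ 2) * hypRatio m a (eighthRoot * u) := by
  obtain ⟨B, hB⟩ := exists_norm_hypRatio_line_le ha
  have h1 : Integrable fun u : ℝ => eighthRoot * u * cexp (-lam * u ^ 2) := by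
    simpa using integrable_linear_mul_cexp_quadratic hl eighthRoot 0 0 0
  exact h1.mul_bdd (c := B) (continuous_hypRatio_line m a).aestronglyMeasurable (ae_of_all _ hB)

/-- The function is odd, so truncation below degree 2K + 1 keeps exactly K terms and leaves an error
of order 2K + 1. -/
theorem eval_trunc_hypSeries (m a K : ℕ) (w : ℂ) :
    (PowerSeries.trunc (2 * K + 1) (hypSeries m a)).eval w
      = ∑ n ∈ Finset.range K, PowerSeries.coeff (2 * n + 1) (hypSeries m a) * w ^ (2 * n + 1) := by
  rw [Polynomial.eval, PowerSeries.eval₂_trunc_eq_sum_range]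
  simp only [RingHom.id_apply]
  induction K with
  | zero => simpa using coeff_hypSeries_even m a 0
  | succ K ih =>
    rw [show 2 * (K + 1) + 1 = 2 * K + 1 + 1 + 1 by ring, Finset.sum_range_succ,
      Finset.sum_range_succ, ih, show 2 * K + 1 + 1 = 2 * (K + 1) by ring, coeff_hypSeries_even,
      Finset.sum_range_succ _ K]
    ring

/-- The asymptotic expansion of the Mordell type integral. -/
theorem exists_norm_integral_hypRatio_sub_le {m a : ℕ} (ha : a < m) (K : ℕ) :
    ∃ C : ℝ, ∀ lam : ℝ, 0 < lam →
      ‖(∫ u : ℝ, eighthRoot * u * cexp (-lam * u ^ 2) * hypRatio m a (eighthRoot * u))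
        - (√(Real.pi / lam) : ℝ) * ∑ n ∈ Finset.range K,
          PowerSeries.coeff (2 * n + 1) (hypSeries m a) * I ^ (n + 1)
            * ((2 * (n + 1)).factorial / ((n + 1).factorial * (4 * lam) ^ (n + 1)))‖
      ≤ C * (√(Real.pi / lam) / lam ^ (K + 1)) := by
  obtain ⟨C, hC⟩ := exists_norm_hypRatio_sub_trunc_le ha (2 * K + 1)
  refine ⟨C * ((2 * (K + 1)).factorial / ((K + 1).factorial * 4 ^ (K + 1))), fun lam hl => ?_⟩
  have hmom : ∀ n : ℕ, ∫ u : ℝ, ((u ^ (2 * n) * Real.exp (-lam * u ^ 2) : ℝ) : ℂ)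
      = (√(Real.pi / lam) : ℝ) * ((2 * n).factorial / (n.factorial * (4 * lam) ^ n)) := by
    intro n
    rw [integral_complex_ofReal, integral_pow_mul_exp_neg_mul_sq hl]
    push_cast
    rfl
  have hint : ∀ n ∈ Finset.range K, Integrable fun u : ℝ =>
      PowerSeries.coeff (2 * n + 1) (hypSeries m a) * I ^ (n + 1)
        * ((u ^ (2 * (n + 1)) * Real.exp (-lam * u ^ 2) : ℝ) : ℂ) :=
    fun n _ => ((integrable_pow_mul_exp_neg_mul_sq hl _).ofReal).const_mul _
  have hsum : ((√(Real.pi / lam) : ℝ) : ℂ) * ∑ n ∈ Finset.range K,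
          PowerSeries.coeff (2 * n + 1) (hypSeries m a) * I ^ (n + 1)
            * ((2 * (n + 1)).factorial / ((n + 1).factorial * (4 * lam) ^ (n + 1)))
      = ∫ u : ℝ, ∑ n ∈ Finset.range K, PowerSeries.coeff (2 * n + 1) (hypSeries m a) * I ^ (n + 1)
        * ((u ^ (2 * (n + 1)) * Real.exp (-lam * u ^ 2) : ℝ) : ℂ) := by
    rw [integral_finsetSum _ hint, Finset.mul_sum]
    refine Finset.sum_congr rfl fun n _ => ?_
    rw [integral_const_mul, hmom]
    ring
  rw [hsum, ← integral_sub (integrable_hypRatio_line ha hl) (integrable_finsetSum _ hint)]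
  have hbound : ∀ u : ℝ, ‖eighthRoot * u * cexp (-lam * u ^ 2) * hypRatio m a (eighthRoot * u)
      - ∑ n ∈ Finset.range K, PowerSeries.coeff (2 * n + 1) (hypSeries m a) * I ^ (n + 1)
        * ((u ^ (2 * (n + 1)) * Real.exp (-lam * u ^ 2) : ℝ) : ℂ)‖
      ≤ C * (u ^ (2 * (K + 1)) * Real.exp (-lam * u ^ 2)) := by
    intro u
    have e : eighthRoot * u * cexp (-lam * u ^ 2) * hypRatio m a (eighthRoot * u)
      - ∑ n ∈ Finset.range K, PowerSeries.coeff (2 * n + 1) (hypSeries m a) * I ^ (n + 1)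
        * ((u ^ (2 * (n + 1)) * Real.exp (-lam * u ^ 2) : ℝ) : ℂ)
      = eighthRoot * u * ((Real.exp (-lam * u ^ 2) : ℝ) : ℂ) * (hypRatio m a (eighthRoot * u)
        - (PowerSeries.trunc (2 * K + 1) (hypSeries m a)).eval (eighthRoot * u)) := by
      rw [eval_trunc_hypSeries, mul_sub, Finset.mul_sum]
      congr 1
      · push_cast
        rfl
      · refine Finset.sum_congr rfl fun n _ => ?_
        rw [← eighthRoot_sq]
        push_cast
        ring
    rw [e, norm_mul, norm_mul, norm_mul, norm_eighthRoot, one_mul, norm_real, norm_real,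
      Real.norm_eq_abs, Real.norm_eq_abs, abs_of_pos (Real.exp_pos _)]
    calc _ ≤ |u| * Real.exp (-lam * u ^ 2) * (C * |u| ^ (2 * K + 1)) := by gcongr; exact hC u
      _ = C * ((|u| ^ 2) ^ (K + 1) * Real.exp (-lam * u ^ 2)) := by ring
      _ = _ := by rw [sq_abs, ← pow_mul]
  refine (norm_integral_le_of_norm_le ((integrable_pow_mul_exp_neg_mul_sq hl _).const_mul C)
    (ae_of_all _ hbound)).trans (le_of_eq ?_)
  rw [integral_const_mul, integral_pow_mul_exp_neg_mul_sq hl, mul_pow]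
  field_simp

end Watson

/-! ### Normalization, leading term, and the vector form. -/

section Asymptotics

open Complex MeasureTheory

/-- The oscillating sum in the leading term. -/
noncomputable def leadSum (m a N : ℕ) : ℂ :=
  ∑ k ∈ Finset.range m, (-1) ^ k * ((m : ℂ) - k)
    * (Real.sin ((a + 1) * ((2 * k + 1) / (2 * m + 1)) * Real.pi) : ℂ)
    * cexp (-(N * Real.pi * I * ((2 * k + 1) ^ 2 / (4 * (2 * m + 1)))))

theorem exp_mul_leadTerm (m a N : ℕ) :
    cexp (Real.pi * I / N * expo m a) * leadTerm m a N
      = 2 / (Real.sqrt (2 * m + 1) : ℂ) * (((N : ℝ) ^ (3 / 2 : ℝ) : ℝ) : ℂ) * eighthRoot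
        * leadSum m a N := by
  unfold leadTerm
  rw [show Real.pi * I / 4 - Real.pi * I / N * expo m a
    = Real.pi * I / 4 + -(Real.pi * I / N * expo m a) by ring, exp_add, ← eighthRoot_eq_exp]
  have h : cexp (Real.pi * I / N * expo m a) * cexp (-(Real.pi * I / N * expo m a)) = 1 := by
    rw [← exp_add, add_neg_cancel, exp_zero]
  change _ * (_ * leadSum m a N) = _
  linear_combination (2 / (Real.sqrt (2 * m + 1) : ℂ) * (((N : ℝ) ^ (3 / 2 : ℝ) : ℝ) : ℂ)
    * eighthRoot * leadSum m a N) * h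

theorem rpow_three_halves {x : ℝ} (hx : 0 < x) : x ^ (3 / 2 : ℝ) = x * √x := by
  rw [show (3 / 2 : ℝ) = 1 + 1 / 2 by norm_num, Real.rpow_add hx, Real.rpow_one,
    ← Real.sqrt_eq_rpow]

theorem sqrt_pi_div_gaussCoeff_mul (m : ℕ) {N : ℕ} (hN : 0 < N) :
    √(Real.pi / gaussCoeff m N) * (1 / gaussCoeff m N)
      * (2 / √(2 * m + 1) * (N : ℝ) ^ (3 / 2 : ℝ)) = 2 * Real.pi ^ 2 / (2 * m + 1) ^ 2 := by
  have hN' : (0 : ℝ) < N := by exact_mod_cast hN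
  have hpi := Real.pi_pos
  have hM : (0 : ℝ) < 2 * m + 1 := by positivity
  have h1 : √(Real.pi / gaussCoeff m N) = Real.pi / (√(2 * m + 1) * √N) := by
    unfold gaussCoeff
    rw [div_div_eq_mul_div, ← sq, Real.sqrt_div (by positivity), Real.sqrt_sq hpi.le,
      Real.sqrt_mul hM.le]
  rw [h1, rpow_three_halves hN']
  unfold gaussCoeff
  have hs := Real.sq_sqrt hM.le
  have hs0 := Real.sqrt_pos.2 hM
  have hn0 := Real.sqrt_pos.2 hN'
  field_simp
  rw [hs]

/-- In the normalization of `XSeries_rootOmega_eq` the residue sum is the oscillating term exactly,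
so only the integral contributes an error. -/
theorem gaussCoeff_mul_leadTerm {m a N : ℕ} (hN : 0 < N) :
    (√(Real.pi / gaussCoeff m N) : ℝ) * (I / gaussCoeff m N)
        * (cexp (Real.pi * I / N * expo m a) * leadTerm m a N)
      = -(2 * Real.pi * I / eighthRoot * ∑ k ∈ Finset.range (2 * m + 1), poleRes m a k
          * linGauss (gaussCoeff m N) (1 / 2) (-(Real.pi * I / 4)) (polePos m k * I)) := by
  rw [exp_mul_leadTerm, sum_poleRes_mul_linGauss hN]
  change _ = -(2 * Real.pi * I / eighthRoot * (-(Real.pi * I / (2 * m + 1) ^ 2) * leadSum m a N))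
  have h : ((√(Real.pi / gaussCoeff m N) : ℝ) : ℂ) * (1 / gaussCoeff m N)
      * (2 / (√(2 * m + 1) : ℝ) * (((N : ℝ) ^ (3 / 2 : ℝ) : ℝ) : ℂ))
      = 2 * Real.pi ^ 2 / (2 * m + 1) ^ 2 := by
    exact_mod_cast congrArg ((↑) : ℝ → ℂ) (sqrt_pi_div_gaussCoeff_mul m hN)
  have h2 : eighthRoot = I / eighthRoot := by
    rw [eq_div_iff eighthRoot_ne_zero, ← sq, eighthRoot_sq]
  have h3 : -(2 * Real.pi * I / eighthRoot * (-(Real.pi * I / (2 * m + 1) ^ 2) * leadSum m a N))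
      = 2 * Real.pi ^ 2 / (2 * m + 1) ^ 2 * (I * (I / eighthRoot) * leadSum m a N) := by
    ring
  rw [h3, ← h, ← h2]
  ring

/-- The expansion variable π / (4(2m+1)Ni) is -i / (4λ); its powers of -1 cancel the sign (-1)^n in
`TCoeff_eq`. -/
theorem gaussCoeff_mul_TCoeff {m a N : ℕ} (ha : a < m) (hN : 0 < N) (n : ℕ) :
    I / gaussCoeff m N * (TCoeff m a n / (n.factorial : ℂ)
        * ((Real.pi : ℂ) / (4 * (2 * m + 1) * N * I)) ^ n)
      = PowerSeries.coeff (2 * n + 1) (hypSeries m a) * I ^ (n + 1)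
        * ((2 * (n + 1)).factorial / ((n + 1).factorial * (4 * gaussCoeff m N) ^ (n + 1))) := by
  have hl : (gaussCoeff m N : ℂ) ≠ 0 := ofReal_ne_zero.2 (gaussCoeff_pos m hN).ne'
  have hpi : (Real.pi : ℂ) ≠ 0 := ofReal_ne_zero.2 Real.pi_ne_zero
  have hN' : (N : ℂ) ≠ 0 := by exact_mod_cast hN.ne'
  have hM := two_mul_add_one_ne_zero m
  have h1 : (Real.pi : ℂ) / (4 * (2 * m + 1) * N * I) = -I / (4 * gaussCoeff m N) := by
    unfold gaussCoeff
    push_cast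
    field_simp
    rw [I_sq, neg_neg]
  have h2 : (-1 : ℂ) ^ n * (-I) ^ n = I ^ n := by
    rw [← mul_pow]
    simp
  rw [TCoeff_eq ha, h1, div_pow, show 2 * (n + 1) = 2 * n + 1 + 1 by ring,
    Nat.factorial_succ (2 * n + 1), Nat.factorial_succ n, pow_succ I, ← h2]
  have hn : (n.factorial : ℂ) ≠ 0 := by exact_mod_cast n.factorial_ne_zero
  have hn1 : (n : ℂ) + 1 ≠ 0 := by exact_mod_cast n.succ_ne_zero
  push_cast
  rw [pow_succ (4 * (gaussCoeff m N : ℂ))]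
  field_simp
  ring

/-- The asymptotic expansion of the `q`-series at `exp (2 π i / N)`. -/
theorem exists_norm_XSeries_sub_le {m a : ℕ} (ha : a < m) (K : ℕ) :
    ∃ C : ℝ, ∀ N : ℕ, 0 < N →
      ‖cexp (Real.pi * I / N * expo m a) * XSeries m a (rootOmega N)
        - cexp (Real.pi * I / N * expo m a) * leadTerm m a N
        - ∑ n ∈ Finset.range K, TCoeff m a n / (n.factorial : ℂ)
            * ((Real.pi : ℂ) / (4 * (2 * m + 1) * N * I)) ^ n‖ ≤ C * ((N : ℝ) ^ K)⁻¹ := by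
  obtain ⟨C, hC⟩ := exists_norm_integral_hypRatio_sub_le ha K
  refine ⟨C * (Real.pi / (2 * m + 1)) ^ K, fun N hN => ?_⟩
  have hl := gaussCoeff_pos m hN
  have hpi := Real.pi_pos
  have hN' : (0 : ℝ) < N := by exact_mod_cast hN
  have h := hC _ hl
  set A : ℂ := (√(Real.pi / gaussCoeff m N) : ℝ) * (I / gaussCoeff m N) with hA
  have hs : 0 < √(Real.pi / gaussCoeff m N) := Real.sqrt_pos.2 (by positivity)
  have hnA : ‖A‖ = √(Real.pi / gaussCoeff m N) / gaussCoeff m N := by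
    rw [hA, norm_mul, norm_div, norm_I, norm_real, norm_real, Real.norm_of_nonneg hs.le,
      Real.norm_of_nonneg hl.le, mul_one_div]
  have hT : A * ∑ n ∈ Finset.range K, TCoeff m a n / (n.factorial : ℂ)
        * ((Real.pi : ℂ) / (4 * (2 * m + 1) * N * I)) ^ n
      = (√(Real.pi / gaussCoeff m N) : ℝ) * ∑ n ∈ Finset.range K,
          PowerSeries.coeff (2 * n + 1) (hypSeries m a) * I ^ (n + 1)
            * ((2 * (n + 1)).factorial
              / ((n + 1).factorial * (4 * gaussCoeff m N) ^ (n + 1))) := by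
    rw [hA, mul_assoc, Finset.mul_sum]
    exact congrArg _ (Finset.sum_congr rfl fun n _ => gaussCoeff_mul_TCoeff ha hN n)
  have hX := XSeries_rootOmega_eq (m := m) ha hN
  have hL := gaussCoeff_mul_leadTerm (m := m) (a := a) hN
  rw [← hA] at hX hL
  rw [← hT] at h
  set D := cexp (Real.pi * I / N * expo m a) * XSeries m a (rootOmega N)
        - cexp (Real.pi * I / N * expo m a) * leadTerm m a N
        - ∑ n ∈ Finset.range K, TCoeff m a n / (n.factorial : ℂ)
            * ((Real.pi : ℂ) / (4 * (2 * m + 1) * N * I)) ^ n with hD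
  have hAD : A * D = (∫ u : ℝ, eighthRoot * u * cexp (-gaussCoeff m N * u ^ 2)
        * hypRatio m a (eighthRoot * u))
      - A * ∑ n ∈ Finset.range K, TCoeff m a n / (n.factorial : ℂ)
          * ((Real.pi : ℂ) / (4 * (2 * m + 1) * N * I)) ^ n := by
    rw [hD]
    linear_combination hX - hL
  rw [← hAD, norm_mul, hnA] at h
  have hpos : 0 < √(Real.pi / gaussCoeff m N) / gaussCoeff m N := by positivity
  -- The normalizing factor has modulus √(π/λ) / λ. Dividing by it turns the error √(π/λ) / λ^{K+1}
  -- into λ^{-K}, a constant times N^{-K}.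
  refine le_of_mul_le_mul_left (h.trans (le_of_eq ?_)) hpos
  have hlam : (Real.pi / (2 * m + 1)) ^ K * ((N : ℝ) ^ K)⁻¹ = (gaussCoeff m N ^ K)⁻¹ := by
    rw [← inv_pow, ← inv_pow, ← mul_pow]
    congr 1
    unfold gaussCoeff
    field_simp
  rw [mul_assoc, hlam, pow_succ]
  field_simp

theorem isBigO_XSeries_sub {m a : ℕ} (ha : a < m) (K : ℕ) :
    (fun N : ℕ => cexp (Real.pi * I / N * expo m a) * XSeries m a (rootOmega N)
        - cexp (Real.pi * I / N * expo m a) * leadTerm m a N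
        - ∑ n ∈ Finset.range K, TCoeff m a n / (n.factorial : ℂ)
            * ((Real.pi : ℂ) / (4 * (2 * m + 1) * N * I)) ^ n)
      =O[atTop] fun N : ℕ => ((N : ℝ) ^ K)⁻¹ := by
  obtain ⟨C, hC⟩ := exists_norm_XSeries_sub_le ha K
  refine IsBigO.of_bound C ?_
  filter_upwards [eventually_gt_atTop 0] with N hN
  rw [Real.norm_of_nonneg (by positivity : (0 : ℝ) ≤ ((N : ℝ) ^ K)⁻¹)]
  exact hC N hN

theorem expo_eq_ofReal (m a : ℕ) :
    expo m a = (((2 * m - 2 * a - 1) ^ 2 / (4 * (2 * m + 1)) : ℝ) : ℂ) := by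
  unfold expo
  push_cast
  rfl

theorem norm_exp_expo (m a N : ℕ) : ‖cexp (-(Real.pi * I / N * expo m a))‖ = 1 := by
  rw [expo_eq_ofReal, show ∀ x : ℝ, -(Real.pi * I / N * (x : ℂ))
    = ((-(Real.pi / N * x) : ℝ) : ℂ) * I by intro x; push_cast; ring]
  exact norm_exp_ofReal_mul_I _

/-- The value of the `q`-series at `q = 1`. -/
theorem XSeries_one {m a : ℕ} (ha : a < m) : XSeries m a 1 = a + 1 := by
  -- For N = 1 the theta sum has the single term j = 0, equal to -(2a + 2).
  have h := (XSeries_eq_partial_theta one_pos IsPrimitiveRoot.one ha).1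
  simp at h
  linear_combination h / 2

theorem PhiTilde_one_div (m a N : ℕ) :
    PhiTilde m a (1 / (N : ℚ))
      = cexp (Real.pi * I / N * expo m a) * XSeries m a (rootOmega N) := by
  unfold PhiTilde rootOmega
  push_cast
  congr 2
  · ring
  · rw [mul_one_div]

theorem PhiTilde_neg_natCast {m j : ℕ} (hj : j < m) (N : ℕ) :
    PhiTilde m (m - 1 - j) (-(N : ℚ)) = ((m : ℂ) - j)
      * cexp (-(N * Real.pi * I * ((2 * j + 1) ^ 2 / (4 * (2 * m + 1))))) := by
  unfold PhiTilde expo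
  have h1 : cexp (2 * Real.pi * I * ((-(N : ℚ) : ℚ) : ℂ)) = 1 := by
    have : 2 * Real.pi * I * ((-(N : ℚ) : ℚ) : ℂ) = ((-N : ℤ) : ℂ) * (2 * Real.pi * I) := by
      push_cast
      ring
    rw [this, exp_int_mul_two_pi_mul_I]
  have h2 : ((m - 1 - j : ℕ) : ℂ) = m - 1 - j := by
    rw [Nat.cast_sub (by omega), Nat.cast_sub (by omega)]
    simp
  rw [h1, XSeries_one (by omega), h2, mul_comm]
  congr 1
  · ring
  · congr 1
    push_cast
    ring

/-- The principal argument of -iN is -π/2, and -3π/4 = π/4 - π produces the minus sign. -/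
theorem neg_I_mul_cpow {N : ℕ} (hN : 0 < N) :
    (-I * N) ^ (3 / 2 : ℂ) = -((((N : ℝ) ^ (3 / 2 : ℝ) : ℝ) : ℂ) * eighthRoot) := by
  have hN' : (0 : ℝ) < N := by exact_mod_cast hN
  have hne : -I * (N : ℂ) ≠ 0 := mul_ne_zero (neg_ne_zero.2 I_ne_zero) (by exact_mod_cast hN.ne')
  have hlog : log (-I * (N : ℂ)) = Real.log N + -(Real.pi / 2) * I := by
    have := log_mul_ofReal N hN' (-I) (neg_ne_zero.2 I_ne_zero)
    rw [log_neg_I] at this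
    exact_mod_cast this
  rw [cpow_def_of_ne_zero hne, hlog, Real.rpow_def_of_pos hN', eighthRoot_eq_exp, ofReal_exp,
    ← exp_add]
  have : ((Real.log N : ℂ) + -(Real.pi / 2) * I) * (3 / 2)
      = ((Real.log N * (3 / 2) : ℝ) : ℂ) + Real.pi * I / 4 - Real.pi * I := by
    push_cast
    ring
  rw [this, exp_sub, exp_pi_mul_I]
  ring

/-- With a = m - 1 - i the factor a + 1 is m - i, and the angle equals kπ + π/2 minus that of the
cosine. The sign (-1)^k cancels the one in the leading term. -/
theorem sin_eq_cos {m i : ℕ} (hi : i < m) (k : ℕ) :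
    Real.sin ((((m - 1 - i : ℕ) : ℝ) + 1) * ((2 * k + 1) / (2 * m + 1)) * Real.pi)
      = (-1) ^ k * Real.cos ((2 * i + 1) * (2 * k + 1) / (2 * (2 * m + 1)) * Real.pi) := by
  have h2 : ((m - 1 - i : ℕ) : ℝ) = m - 1 - i := by
    rw [Nat.cast_sub (by omega), Nat.cast_sub (by omega)]
    simp
  have h : (((m - 1 - i : ℕ) : ℝ) + 1) * ((2 * k + 1) / (2 * m + 1)) * Real.pi
      = (Real.pi / 2 - (2 * i + 1) * (2 * k + 1) / (2 * (2 * m + 1)) * Real.pi)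
        + k * Real.pi := by
    rw [h2]
    field_simp
    ring
  rw [h, Real.sin_add_nat_mul_pi, Real.sin_pi_div_two_sub]

/-- The transformed vector is the negative of the leading term. -/
theorem cpow_smul_MMat_mulVec {m N : ℕ} (hN : 0 < N) (i : Fin m) :
    ((-I * N) ^ (3 / 2 : ℂ) • (MMat m).mulVec (PhiTildeVec m (-(N : ℚ)))) i
      = -(cexp (Real.pi * I / N * expo m (m - 1 - i)) * leadTerm m (m - 1 - i) N) := by
  rw [Pi.smul_apply, smul_eq_mul, neg_I_mul_cpow hN, exp_mul_leadTerm]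
  have h : (MMat m).mulVec (PhiTildeVec m (-(N : ℚ))) i
      = 2 / (Real.sqrt (2 * m + 1) : ℂ) * leadSum m (m - 1 - i) N := by
    unfold Matrix.mulVec dotProduct leadSum PhiTildeVec
    rw [Finset.mul_sum, ← Fin.sum_univ_eq_sum_range fun k : ℕ => 2 / (Real.sqrt (2 * m + 1) : ℂ)
      * ((-1) ^ k * ((m : ℂ) - k)
        * (Real.sin ((((m - 1 - i : ℕ) : ℝ) + 1) * ((2 * k + 1) / (2 * m + 1)) * Real.pi) : ℂ)
        * cexp (-(N * Real.pi * I * ((2 * k + 1) ^ 2 / (4 * (2 * m + 1))))))]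
    refine Finset.sum_congr rfl fun j _ => ?_
    have hM : MMat m i j = ((2 / Real.sqrt (2 * m + 1)
      * Real.cos ((2 * (i : ℕ) + 1) * (2 * (j : ℕ) + 1) / (2 * (2 * m + 1)) * Real.pi) : ℝ) : ℂ) :=
      rfl
    change MMat m i j * _ = _
    rw [PhiTilde_neg_natCast j.2, sin_eq_cos i.2, hM]
    have h1 : ((-1 : ℂ) ^ (j : ℕ)) * (-1) ^ (j : ℕ) = 1 := by
      rw [← mul_pow]
      simp
    simp only [ofReal_mul, ofReal_div, ofReal_pow, ofReal_neg, ofReal_one, ofReal_ofNat]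
    generalize ((Real.cos _ : ℝ) : ℂ) = c
    generalize cexp _ = e
    linear_combination (-(2 / (Real.sqrt (2 * m + 1) : ℂ) * c * ((m : ℂ) - j) * e)) * h1
  rw [h]
  ring

end Asymptotics

theorem theorem3 (m : ℕ) (hm : 0 < m) :
    (∀ a : ℕ, a < m → ∀ K : ℕ,
      (fun N : ℕ => XSeries m a (rootOmega N) - leadTerm m a N
          - Complex.exp (-(Real.pi * Complex.I / N * expo m a))
            * ∑ n ∈ Finset.range K, TCoeff m a n / (n.factorial : ℂ)
                * ((Real.pi : ℂ) / (4 * (2 * m + 1) * N * Complex.I)) ^ n)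
        =O[atTop] fun N : ℕ => ((N : ℝ) ^ K)⁻¹) ∧
    (∀ K : ℕ,
      (fun N : ℕ => PhiTildeVec m (1 / (N : ℚ))
          + (-Complex.I * N) ^ (3 / 2 : ℂ) • (MMat m).mulVec (PhiTildeVec m (-(N : ℚ)))
          - ∑ n ∈ Finset.range K,
              (((Real.pi : ℂ) / (4 * (2 * m + 1) * Complex.I * N)) ^ n / (n.factorial : ℂ))
                • TVec m n)
        =O[atTop] fun N : ℕ => ((N : ℝ) ^ K)⁻¹) := by
  refine ⟨fun a ha K => ?_, fun K => ?_⟩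
  -- The estimate is known after multiplication by e^{πi expo/N}; undoing this is harmless because
  -- the factor has modulus 1.
  · have hunit : (fun N : ℕ => Complex.exp (-(Real.pi * Complex.I / N * expo m a)))
        =O[atTop] fun _ => (1 : ℝ) :=
      IsBigO.of_bound 1 (Eventually.of_forall fun N => by rw [norm_exp_expo]; simp)
    refine (hunit.mul (isBigO_XSeries_sub ha K)).congr (fun N => ?_) fun N => one_mul _
    have h : Complex.exp (-(Real.pi * Complex.I / N * expo m a))
        * Complex.exp (Real.pi * Complex.I / N * expo m a) = 1 := by
      rw [← Complex.exp_add, neg_add_cancel, Complex.exp_zero]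
    linear_combination (XSeries m a (rootOmega N) - leadTerm m a N) * h
  · refine isBigO_pi.2 fun i => ?_
    have hi : m - 1 - (i : ℕ) < m := by omega
    refine (isBigO_XSeries_sub hi K).congr' ?_ EventuallyEq.rfl
    filter_upwards [eventually_gt_atTop 0] with N hN
    rw [Pi.sub_apply, Pi.add_apply, cpow_smul_MMat_mulVec hN, Finset.sum_apply, PhiTildeVec,
      PhiTilde_one_div, ← sub_eq_add_neg]
    congr 1
    refine Finset.sum_congr rfl fun n _ => ?_
    rw [Pi.smul_apply, smul_eq_mul, TVec, mul_right_comm _ Complex.I]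
    ring
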